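/- Let $d\ge 0$, let $\Omega\subset\mathbb R^d$ be compact and convex with nonempty interior, let $\alpha>0$, and let $\mathcal M(\Omega)=\{\rho\in L^1(\Omega):\rho\ge 0\text{ a.e.}\}$. For $\mu_0,\mu_1\in\mathcal M(\Omega)$ put $$UW_2(\mu_0,\mu_1)^2=\inf_{(v,\mu,f)}\int_0^1\!\!\int_\Omega \|v\|^2\mu\,dx\,dt+\frac1\alpha\int_0^1\!\!\int_\Omega |f|^2\,dx\,dt .$$ The infimum is over nonnegative densities $\mu$ on $[0,1]\times\Omega$ that are continuous on $(0,1)\times\Omega$, Borel vector fields $v:[0,1]\times\Omega\to\mathbb R^d$ and Borel functions $f:[0,1]\times\Omega\to\mathbb R$, with $\mu$, $\mu v$ and $f$ integrable on $[0,1]\times\Omega$, such that $\partial_t\mu+\nabla\cdot(\mu v)=f$ with zero flux through $[0,1]\times\partial\Omega$, $\mu(0,\cdot)=\mu_0$ and $\mu(1,\cdot)=\mu_1$ a.e. on $\Omega$. The equation and its boundary and end conditions are understood weakly: $$\int_\Omega\varphi(1,x)\mu(1,x)\,dx-\int_\Omega\varphi(0,x)\mu(0,x)\,dx=\int_0^1\!\!\int_\Omega\big(\mu\,\partial_t\varphi+\nabla\varphi\cdot\mu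 v+\varphi f\big)\,dx\,dt\qquad\text{for all }\varphi\in C^1(\mathbb R\times\mathbb R^d).$$ Then $UW_2$ is a well-defined metric on $\mathcal M(\Omega)$: it is finite, it vanishes exactly when $\mu_0=\mu_1$ (a.e.), it is symmetric, and it satisfies the triangle inequality. Moreover, if $(v,\mu,f)$ attains the infimum for some $\mu_0,\mu_1\in\mathcal M(\Omega)$, then there is a locally integrable function $\Phi$ on $(0,1)\times\operatorname{int}\Omega$ that has a weak spatial gradient $\nabla\Phi$, with $\|\nabla\Phi\|^2$ locally integrable there, such that 1. $v=\nabla\Phi$ almost everywhere on $\{\mu>0\}$, and $f=\alpha\Phi$ almost everywhere on $[0,1]\times\Omega$; 2. $\partial_t\mu+\nabla\cdot(\mu\nabla\Phi)=\alpha\Phi$ on $[0,1]\times\Omega$, in the weak sense above (with zero flux, and with the same end values); 3. $\partial_t\Phi+\frac12\|\nabla\Phi\|^2\le 0$ in the sense of distributions on $(0,1)\times\operatorname{int}\Omega$; 4. $\partial_t\Phi+\frac12\|\nabla\Phi\|^2=0$ in the sense of distributions on the open set $\{(t,x)\in(0,1)\times\operatorname{int}\Omega:\mu(t,x)>0\}$.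 -/

import Mathlib

open MeasureTheory Set
open scoped ENNReal ContDiff

namespace UnnormalizedOT

noncomputable section

/-- Euclidean space of dimension `d`. -/
abbrev E (d : ℕ) := EuclideanSpace ℝ (Fin d)

/-- The unnormalized densities on `Ω`: the nonnegative elements of `L¹(Ω)`. -/
abbrev Density {d : ℕ} (Ω : Set (E d)) :=
  {ρ : Lp ℝ 1 (volume.restrict Ω) // ∀ᵐ x ∂(volume.restrict Ω), 0 ≤ ρ x}

/-- The space-time cylinder `[0,1] × Ω`. -/
def cylinder {d : ℕ} (Ω : Set (E d)) : Set (ℝ × E d) := Icc (0 : ℝ) 1 ×ˢ Ω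

/-- The open space-time cylinder `(0,1) × int Ω`. -/
def openCylinder {d : ℕ} (Ω : Set (E d)) : Set (ℝ × E d) := Ioo (0 : ℝ) 1 ×ˢ interior Ω

/-- The time derivative `∂ₜφ` of a differentiable function of `(t, x)`. -/
def timeDeriv {d : ℕ} (φ : ℝ × E d → ℝ) (z : ℝ × E d) : ℝ :=
  deriv (fun s => φ (s, z.2)) z.1

/-- The spatial gradient `∇φ` of a differentiable function of `(t, x)`. -/
def spaceGrad {d : ℕ} (φ : ℝ × E d → ℝ) (z : ℝ × E d) : E d :=
  gradient (fun y => φ (z.1, y)) z.2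

/-- `∂ₜμ + ∇·(μ v) = f` on `[0,1] × Ω` with zero flux through `[0,1] × ∂Ω`, in the weak sense.
The test functions need not vanish on `∂Ω` (this is the zero flux condition), nor at `t = 0` and
`t = 1` (so `μ (0, ·)` and `μ (1, ·)` are the initial and the terminal value of the solution). -/
structure SolvesContinuityEq {d : ℕ} (Ω : Set (E d))
    (μ : ℝ × E d → ℝ) (v : ℝ × E d → E d) (f : ℝ × E d → ℝ) : Prop where
  integrable_density : IntegrableOn μ (cylinder Ω)
  integrable_initial : IntegrableOn (fun x => μ (0, x)) Ω
  integrable_terminal : IntegrableOn (fun x => μ (1, x)) Ω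
  integrable_flux : IntegrableOn (fun z => μ z • v z) (cylinder Ω)
  integrable_source : IntegrableOn f (cylinder Ω)
  weak_eq : ∀ φ : ℝ × E d → ℝ, ContDiff ℝ 1 φ →
    (∫ x in Ω, φ (1, x) * μ (1, x)) - (∫ x in Ω, φ (0, x) * μ (0, x)) =
      ∫ z in cylinder Ω,
        (timeDeriv φ z * μ z + inner ℝ (spaceGrad φ z) (μ z • v z) + φ z * f z)

/-- The triples `(v, μ, f)` over which the infimum is taken. A density `μ` that is continuous up to
`t = 0, 1` could only join continuous `ρ₀`, `ρ₁`, while these are arbitrary in `L¹(Ω)`; so `μ` is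
continuous on `(0,1) × Ω` and takes its end values through the weak equation. -/
structure Admissible {d : ℕ} (Ω : Set (E d)) (ρ₀ ρ₁ : Density Ω)
    (v : ℝ × E d → E d) (μ : ℝ × E d → ℝ) (f : ℝ × E d → ℝ) : Prop where
  continuousOn : ContinuousOn μ (Ioo (0 : ℝ) 1 ×ˢ Ω)
  nonneg : ∀ z ∈ cylinder Ω, 0 ≤ μ z
  measurable_velocity : Measurable v
  measurable_source : Measurable f
  continuityEq : SolvesContinuityEq Ω μ v f
  initial : ∀ᵐ x ∂(volume.restrict Ω), μ (0, x) = ρ₀.1 x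
  terminal : ∀ᵐ x ∂(volume.restrict Ω), μ (1, x) = ρ₁.1 x

/-- `∫₀¹ ∫_Ω ‖v‖² μ dx dt + (1/α) ∫₀¹ ∫_Ω |f|² dx dt`. -/
def action {d : ℕ} (α : ℝ) (Ω : Set (E d))
    (v : ℝ × E d → E d) (μ : ℝ × E d → ℝ) (f : ℝ × E d → ℝ) : ℝ≥0∞ :=
  (∫⁻ z in cylinder Ω, ENNReal.ofReal (‖v z‖ ^ 2 * μ z)) +
    ENNReal.ofReal (1 / α) * ∫⁻ z in cylinder Ω, ENNReal.ofReal (|f z| ^ 2)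

/-- The infimum that defines `UW₂(ρ₀, ρ₁)²` (`⊤` if there is no triple of finite action). -/
def UW2sq {d : ℕ} (α : ℝ) (Ω : Set (E d)) (ρ₀ ρ₁ : Density Ω) : ℝ≥0∞ :=
  ⨅ (v : ℝ × E d → E d) (μ : ℝ × E d → ℝ) (f : ℝ × E d → ℝ)
    (_ : Admissible Ω ρ₀ ρ₁ v μ f), action α Ω v μ f

/-- The `L²` generalized unnormalized Wasserstein distance. -/
def UW2 {d : ℕ} (α : ℝ) (Ω : Set (E d)) (ρ₀ ρ₁ : Density Ω) : ℝ≥0∞ :=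
  UW2sq α Ω ρ₀ ρ₁ ^ (1 / 2 : ℝ)

/-- `(v, μ, f)` attains the infimum that defines `UW₂(ρ₀, ρ₁)²`. -/
def IsMinimizer {d : ℕ} (α : ℝ) (Ω : Set (E d)) (ρ₀ ρ₁ : Density Ω)
    (v : ℝ × E d → E d) (μ : ℝ × E d → ℝ) (f : ℝ × E d → ℝ) : Prop :=
  Admissible Ω ρ₀ ρ₁ v μ f ∧ action α Ω v μ f = UW2sq α Ω ρ₀ ρ₁

/-- Smooth functions with compact support in `U`. -/
def IsTestFunction {d : ℕ} (U : Set (ℝ × E d)) (ψ : ℝ × E d → ℝ) : Prop :=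
  ContDiff ℝ ∞ ψ ∧ HasCompactSupport ψ ∧ tsupport ψ ⊆ U

/-- `G` is the weak spatial gradient `∇Φ` on the open set `U`. -/
def IsWeakSpaceGrad {d : ℕ} (U : Set (ℝ × E d)) (Φ : ℝ × E d → ℝ) (G : ℝ × E d → E d) : Prop :=
  LocallyIntegrableOn Φ U ∧ LocallyIntegrableOn G U ∧
    ∀ ψ, IsTestFunction U ψ →
      ∫ z in U, Φ z • spaceGrad ψ z = - ∫ z in U, ψ z • G z

/-- `∂ₜΦ + ½ ‖G‖² ≤ 0` in the sense of distributions on the open set `U`. -/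
def HamiltonJacobiLe {d : ℕ} (U : Set (ℝ × E d)) (Φ : ℝ × E d → ℝ) (G : ℝ × E d → E d) : Prop :=
  LocallyIntegrableOn Φ U ∧ LocallyIntegrableOn (fun z => ‖G z‖ ^ 2) U ∧
    ∀ ψ, IsTestFunction U ψ → (∀ z, 0 ≤ ψ z) →
      ∫ z in U, (-(Φ z * timeDeriv ψ z) + (1 / 2) * ‖G z‖ ^ 2 * ψ z) ≤ 0

/-- `∂ₜΦ + ½ ‖G‖² = 0` in the sense of distributions on the open set `U`. -/
def HamiltonJacobiEq {d : ℕ} (U : Set (ℝ × E d)) (Φ : ℝ × E d → ℝ) (G : ℝ × E d → E d) : Prop :=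
  LocallyIntegrableOn Φ U ∧ LocallyIntegrableOn (fun z => ‖G z‖ ^ 2) U ∧
    ∀ ψ, IsTestFunction U ψ →
      ∫ z in U, (-(Φ z * timeDeriv ψ z) + (1 / 2) * ‖G z‖ ^ 2 * ψ z) = 0

end

end UnnormalizedOT

open MeasureTheory Set
open scoped ENNReal ContDiff

namespace UnnormalizedOT

noncomputable section

/-! ### Space-time calculus -/

section Calculus

variable {d : ℕ}

/-! In the variables μ, m = μ v and f the constraint is linear and the action is convex, since
|m|²/μ is jointly convex and homogeneous of degree one. Both halves of the theorem use this:
convexity makes averages of curves cheap, and linearity makes perturbations explicit.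

The metric. Admissible densities must be continuous on (0,1) × Ω, but the natural competitors (a
constant curve, a linear interpolation of L¹ data, two curves run one after the other) are only
weakly continuous in time. The key is the relaxation `IsCurve.UW2sq_le`: every weakly continuous
curve in the sense of `IsCurve` bounds the distance of its end points by its action. To prove it,
the particle at x at time t is moved to (1 - ε) x + ε Y, where ε = L t (1 - t) and Y is random with
a C¹ density supported in Ω. Convexity keeps the particle in Ω; ε = 0 at both end times, so the end
values do not change; for frozen Y a C¹ test function composed with the motion is again C¹, so the
weak equation survives. The average over Y has a density that is continuous for 0 < t < 1. By
Cauchy-Schwarz its kinetic energy exceeds the old one by O(L) only, and its source energy grows by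
at most (1 - L)^(-d). Now let L tend to 0.

Symmetry is reversal of time. For the triangle inequality, two curves of actions below a² and b² are
run on the time intervals [0,s] and [s,1]; the action becomes a²/s + b²/(1 - s), which is (a + b)²
for s = a/(a + b). For finiteness, the interpolation (1 - X) ρ₀ + X ρ₁ with zero velocity has a
source that is merely L¹ in space; the regularization with L = 1 makes it bounded, because the
kernel blows up like (t (1 - t))^(-d) and X' is chosen proportional to (t (1 - t))^d. If the
distance is zero, curves of action at most δ² change the integral against a C¹ function by O(δ)
only, so the end points agree.

The optimality conditions. Put Φ = f/α. Adding δ(ν, w, ∂ₜν + div w) to (μ, μ v, f) keeps the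
equation when ν vanishes at the end times and w has compact support in the cylinder. If ν ≥ 0 and w
= ν u, subadditivity of |m|²/μ gives the one-sided condition `IsMinimizer.first_order_nonneg`: ½ ∫
ν|u|² + ∫ Φ (∂ₜν + div(ν u)) ≥ 0. With ν = t (1 - t) and w = s ψ eᵢ this is a nonnegative quadratic
polynomial in s; its discriminant bounds ∫ Φ ∂ᵢψ by a weighted L² norm of ψ, and Riesz
representation yields the weak gradient G. With ν = ψ ≥ 0 and smooth u close to G, it becomes the
Hamilton-Jacobi inequality, because ½|u|² - ⟨G, u⟩ has its minimum -½|G|² at u = G.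

On the open set {μ > 0} inside the open cylinder both signs of δ are allowed
(`IsMinimizer.first_order_eq`). Varying the momentum alone gives v = G there, and varying the
density alone gives the Hamilton-Jacobi equation. -/

theorem hasDerivAt_time {φ : ℝ × E d → ℝ} {z : ℝ × E d} {L : ℝ × E d →L[ℝ] ℝ}
    (h : HasFDerivAt φ L z) : HasDerivAt (fun s => φ (s, z.2)) (L (1, 0)) z.1 := by
  have h1 : HasDerivAt (fun s : ℝ => (s, z.2)) ((1 : ℝ), (0 : E d)) z.1 :=
    (hasDerivAt_id z.1).prodMk (hasDerivAt_const z.1 z.2)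
  exact HasFDerivAt.comp_hasDerivAt (x := z.1) (f := fun s : ℝ => (s, z.2)) (l := φ) h h1

theorem timeDeriv_eq_of_hasFDerivAt {φ : ℝ × E d → ℝ} {z : ℝ × E d} {L : ℝ × E d →L[ℝ] ℝ}
    (h : HasFDerivAt φ L z) : timeDeriv φ z = L (1, 0) :=
  (hasDerivAt_time h).deriv

theorem spaceGrad_eq_of_hasFDerivAt {φ : ℝ × E d → ℝ} {z : ℝ × E d} {L : ℝ × E d →L[ℝ] ℝ}
    (h : HasFDerivAt φ L z) :
    spaceGrad φ z =
      (InnerProductSpace.toDual ℝ (E d)).symm (L.comp (ContinuousLinearMap.inr ℝ ℝ (E d))) := by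
  have h1 : HasFDerivAt (fun y : E d => (z.1, y)) (ContinuousLinearMap.inr ℝ ℝ (E d)) z.2 :=
    hasFDerivAt_prodMk_right z.1 z.2
  have h2 : HasFDerivAt (fun y => φ (z.1, y)) (L.comp (ContinuousLinearMap.inr ℝ ℝ (E d))) z.2 :=
    HasFDerivAt.comp (x := z.2) (f := fun y : E d => (z.1, y)) (g := φ) h h1
  unfold spaceGrad gradient
  rw [h2.fderiv]

theorem inner_spaceGrad_of_hasFDerivAt {φ : ℝ × E d → ℝ} {z : ℝ × E d} {L : ℝ × E d →L[ℝ] ℝ}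
    (h : HasFDerivAt φ L z) (w : E d) : inner ℝ (spaceGrad φ z) w = L (0, w) := by
  rw [spaceGrad_eq_of_hasFDerivAt h, InnerProductSpace.toDual_symm_apply]
  simp

theorem timeDeriv_eq {φ : ℝ × E d → ℝ} (hφ : ContDiff ℝ 1 φ) (z : ℝ × E d) :
    timeDeriv φ z = fderiv ℝ φ z (1, 0) :=
  timeDeriv_eq_of_hasFDerivAt (hφ.differentiable one_ne_zero z).hasFDerivAt

theorem inner_spaceGrad {φ : ℝ × E d → ℝ} (hφ : ContDiff ℝ 1 φ) (z : ℝ × E d) (w : E d) :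
    inner ℝ (spaceGrad φ z) w = fderiv ℝ φ z (0, w) :=
  inner_spaceGrad_of_hasFDerivAt (hφ.differentiable one_ne_zero z).hasFDerivAt w

theorem spaceGrad_apply {φ : ℝ × E d → ℝ} (hφ : ContDiff ℝ 1 φ) (z : ℝ × E d) (i : Fin d) :
    spaceGrad φ z i = fderiv ℝ φ z (0, EuclideanSpace.single i 1) := by
  rw [← inner_spaceGrad hφ, EuclideanSpace.inner_single_right]
  simp

theorem continuous_timeDeriv {φ : ℝ × E d → ℝ} (hφ : ContDiff ℝ 1 φ) :
    Continuous (timeDeriv φ) := by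
  have : timeDeriv φ = fun z => fderiv ℝ φ z (1, 0) := funext (timeDeriv_eq hφ)
  rw [this]
  exact (hφ.continuous_fderiv one_ne_zero).clm_apply continuous_const

theorem continuous_spaceGrad {φ : ℝ × E d → ℝ} (hφ : ContDiff ℝ 1 φ) :
    Continuous (spaceGrad φ) := by
  have : spaceGrad φ = fun z => (InnerProductSpace.toDual ℝ (E d)).symm
      ((fderiv ℝ φ z).comp (ContinuousLinearMap.inr ℝ ℝ (E d))) :=
    funext fun z => spaceGrad_eq_of_hasFDerivAt (hφ.differentiable one_ne_zero z).hasFDerivAt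
  rw [this]
  exact (LinearIsometryEquiv.continuous _).comp
    ((hφ.continuous_fderiv one_ne_zero).clm_comp continuous_const)

end Calculus

/-! ### The space-time cylinder -/

section Cylinder

variable {d : ℕ} {Ω : Set (E d)}

theorem isCompact_cylinder (hΩ : IsCompact Ω) : IsCompact (cylinder Ω) :=
  isCompact_Icc.prod hΩ

theorem measurableSet_cylinder (hΩ : IsCompact Ω) : MeasurableSet (cylinder Ω) :=
  (isCompact_cylinder hΩ).measurableSet

theorem isOpen_openCylinder : IsOpen (openCylinder Ω) :=
  isOpen_Ioo.prod isOpen_interior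

theorem openCylinder_subset_cylinder : openCylinder Ω ⊆ cylinder Ω :=
  prod_mono Ioo_subset_Icc_self interior_subset

theorem restrict_cylinder :
    (volume : Measure (ℝ × E d)).restrict (cylinder Ω) =
      ((volume : Measure ℝ).restrict (Icc 0 1)).prod ((volume : Measure (E d)).restrict Ω) := by
  rw [Measure.prod_restrict]
  rfl

theorem isFiniteMeasure_restrict_space (hΩ : IsCompact Ω) :
    IsFiniteMeasure ((volume : Measure (E d)).restrict Ω) :=
  MeasureTheory.isFiniteMeasure_restrict.2 hΩ.measure_lt_top.ne

theorem isFiniteMeasure_restrict_cylinder (hΩ : IsCompact Ω) :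
    IsFiniteMeasure ((volume : Measure (ℝ × E d)).restrict (cylinder Ω)) :=
  MeasureTheory.isFiniteMeasure_restrict.2 (isCompact_cylinder hΩ).measure_lt_top.ne

/-- The frontier of a convex set is null. Integrals over the open and over the closed cylinder may
therefore be interchanged. -/
theorem interior_ae_eq (hΩ : IsCompact Ω) (hconv : Convex ℝ Ω) :
    (interior Ω : Set (E d)) =ᵐ[volume] Ω := by
  refine Filter.EventuallyLE.antisymm interior_subset.eventuallyLE ?_
  have h := hconv.addHaar_frontier (volume : Measure (E d))
  rw [hΩ.isClosed.frontier_eq] at h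
  exact ae_le_set.2 h

theorem openCylinder_ae_eq (hΩ : IsCompact Ω) (hconv : Convex ℝ Ω) :
    (openCylinder Ω : Set (ℝ × E d)) =ᵐ[volume] cylinder Ω :=
  Measure.set_prod_ae_eq Ioo_ae_eq_Icc (interior_ae_eq hΩ hconv)

theorem restrict_openCylinder (hΩ : IsCompact Ω) (hconv : Convex ℝ Ω) :
    (volume : Measure (ℝ × E d)).restrict (openCylinder Ω) = volume.restrict (cylinder Ω) :=
  Measure.restrict_congr_set (openCylinder_ae_eq hΩ hconv)

theorem ae_mem_Ioo_prod (hΩ : IsCompact Ω) :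
    ∀ᵐ z ∂((volume : Measure (ℝ × E d)).restrict (cylinder Ω)), z ∈ Ioo (0 : ℝ) 1 ×ˢ Ω := by
  have h : (Ioo (0 : ℝ) 1 ×ˢ Ω : Set (ℝ × E d)) =ᵐ[volume] cylinder Ω :=
    Measure.set_prod_ae_eq Ioo_ae_eq_Icc (ae_eq_refl Ω)
  rw [← Measure.restrict_congr_set h]
  exact ae_restrict_mem (measurableSet_Ioo.prod hΩ.measurableSet)

/-- A continuous function is bounded on the cylinder. -/
theorem exists_bound_of_continuous {F : Type*} [SeminormedAddCommGroup F] (hΩ : IsCompact Ω)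
    {g : ℝ × E d → F} (hg : Continuous g) : ∃ C, 0 ≤ C ∧ ∀ z ∈ cylinder Ω, ‖g z‖ ≤ C := by
  obtain ⟨C, hC⟩ := (isCompact_cylinder hΩ).exists_bound_of_continuousOn hg.continuousOn
  exact ⟨max C 0, le_max_right _ _, fun z hz => (hC z hz).trans (le_max_left _ _)⟩

theorem integrableOn_mul_of_continuous (hΩ : IsCompact Ω) {g h : ℝ × E d → ℝ}
    (hg : Continuous g) (hh : IntegrableOn h (cylinder Ω)) :
    IntegrableOn (fun z => g z * h z) (cylinder Ω) :=
  IntegrableOn.continuousOn_mul hg.continuousOn hh (isCompact_cylinder hΩ)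

theorem integrableOn_inner_of_continuous (hΩ : IsCompact Ω) {g h : ℝ × E d → E d}
    (hg : Continuous g) (hh : IntegrableOn h (cylinder Ω)) :
    IntegrableOn (fun z => (inner ℝ (g z) (h z) : ℝ)) (cylinder Ω) := by
  obtain ⟨C, -, hC⟩ := exists_bound_of_continuous hΩ hg
  refine Integrable.mono' (hh.norm.const_mul C)
    (hg.aestronglyMeasurable.inner hh.aestronglyMeasurable) ?_
  filter_upwards [ae_restrict_mem (measurableSet_cylinder hΩ)] with z hz
  exact (norm_inner_le_norm _ _).trans (by gcongr; exact hC z hz)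

/-- The integrand of the weak continuity equation. -/
def weakIntegrand (μ : ℝ × E d → ℝ) (m : ℝ × E d → E d) (f φ : ℝ × E d → ℝ) (z : ℝ × E d) : ℝ :=
  timeDeriv φ z * μ z + inner ℝ (spaceGrad φ z) (m z) + φ z * f z

theorem integrableOn_weakIntegrand (hΩ : IsCompact Ω) {μ f φ : ℝ × E d → ℝ} {m : ℝ × E d → E d}
    (hμ : IntegrableOn μ (cylinder Ω)) (hm : IntegrableOn m (cylinder Ω))
    (hf : IntegrableOn f (cylinder Ω)) (hφ : ContDiff ℝ 1 φ) :
    IntegrableOn (weakIntegrand μ m f φ) (cylinder Ω) :=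
  ((integrableOn_mul_of_continuous hΩ (continuous_timeDeriv hφ) hμ).add
    (integrableOn_inner_of_continuous hΩ (continuous_spaceGrad hφ) hm)).add
    (integrableOn_mul_of_continuous hΩ hφ.continuous hf)

theorem integral_cylinder {g : ℝ × E d → ℝ} (hg : IntegrableOn g (cylinder Ω)) :
    ∫ z in cylinder Ω, g z = ∫ t in (0 : ℝ)..1, ∫ x in Ω, g (t, x) := by
  unfold IntegrableOn at hg
  rw [restrict_cylinder] at hg ⊢
  rw [integral_prod _ hg, intervalIntegral.integral_of_le zero_le_one, integral_Icc_eq_integral_Ioc]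

theorem integral_cylinder_symm (hΩ : IsCompact Ω) {g : ℝ × E d → ℝ}
    (hg : IntegrableOn g (cylinder Ω)) :
    ∫ z in cylinder Ω, g z = ∫ x in Ω, ∫ t in (0 : ℝ)..1, g (t, x) := by
  have := isFiniteMeasure_restrict_space hΩ
  unfold IntegrableOn at hg
  rw [restrict_cylinder] at hg ⊢
  rw [integral_prod_symm _ hg]
  simp_rw [intervalIntegral.integral_of_le zero_le_one, integral_Icc_eq_integral_Ioc]

end Cylinder

/-! ### Perturbations of a minimizer -/

section Perturbation

variable {d : ℕ} {Ω : Set (E d)}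

/-- The spatial divergence of a time dependent vector field. -/
def spaceDiv (w : ℝ × E d → E d) (z : ℝ × E d) : ℝ :=
  ∑ i, fderiv ℝ w z (0, EuclideanSpace.single i 1) i

theorem continuous_spaceDiv {w : ℝ × E d → E d} (hw : ContDiff ℝ 1 w) :
    Continuous (spaceDiv w) := by
  refine continuous_finsetSum _ fun i _ => ?_
  exact (EuclideanSpace.proj (𝕜 := ℝ) i).continuous.comp
    ((hw.continuous_fderiv one_ne_zero).clm_apply continuous_const)

theorem fderiv_coord {w : ℝ × E d → E d} (hw : ContDiff ℝ 1 w) (z y : ℝ × E d) (i : Fin d) :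
    fderiv ℝ (fun z => w z i) z y = fderiv ℝ w z y i := by
  have h : HasFDerivAt (fun z => w z i) ((EuclideanSpace.proj (𝕜 := ℝ) i).comp (fderiv ℝ w z)) z :=
    (EuclideanSpace.proj (𝕜 := ℝ) i).hasFDerivAt.comp z
      (hw.differentiable one_ne_zero z).hasFDerivAt
  rw [h.fderiv]
  rfl

theorem contDiff_coord {n : ℕ∞ω} {w : ℝ × E d → E d} (hw : ContDiff ℝ n w) (i : Fin d) :
    ContDiff ℝ n fun z => w z i :=
  (EuclideanSpace.proj (𝕜 := ℝ) i).contDiff.comp hw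

theorem hasCompactSupport_coord {w : ℝ × E d → E d} (hw : HasCompactSupport w) (i : Fin d) :
    HasCompactSupport fun z => w z i :=
  hw.comp_left (g := fun x : E d => x i) rfl

theorem spaceDiv_eq_sum {w : ℝ × E d → E d} (hw : ContDiff ℝ 1 w) (z : ℝ × E d) :
    spaceDiv w z = ∑ i, spaceGrad (fun z => w z i) z i := by
  refine Finset.sum_congr rfl fun i _ => ?_
  rw [spaceGrad_apply (contDiff_coord hw i), fderiv_coord hw]

theorem spaceGrad_eq_zero_of_notMem_tsupport {φ : ℝ × E d → ℝ} {z : ℝ × E d}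
    (hφ : ContDiff ℝ 1 φ) (hz : z ∉ tsupport φ) : spaceGrad φ z = 0 := by
  have h : fderiv ℝ φ z = 0 := by
    by_contra h
    exact hz (support_fderiv_subset ℝ h)
  refine ext_inner_right ℝ fun w => ?_
  rw [inner_spaceGrad hφ, h]
  simp

theorem timeDeriv_eq_zero_of_notMem_tsupport {φ : ℝ × E d → ℝ} {z : ℝ × E d}
    (hφ : ContDiff ℝ 1 φ) (hz : z ∉ tsupport φ) : timeDeriv φ z = 0 := by
  have h : fderiv ℝ φ z = 0 := by
    by_contra h
    exact hz (support_fderiv_subset ℝ h)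
  rw [timeDeriv_eq hφ, h]
  simp

theorem spaceDiv_eq_zero_of_notMem_tsupport {w : ℝ × E d → E d} {z : ℝ × E d}
    (hz : z ∉ tsupport w) : spaceDiv w z = 0 := by
  have h : fderiv ℝ w z = 0 := by
    by_contra h
    exact hz (support_fderiv_subset ℝ h)
  simp [spaceDiv, h]

/-- Integration by parts in each coordinate. Compact support of w suffices to remove the boundary
terms, so φ stays arbitrary, as the zero flux condition requires. -/
theorem integral_inner_spaceGrad_add_mul_spaceDiv {w : ℝ × E d → E d} (hw : ContDiff ℝ 1 w)
    (hc : HasCompactSupport w) {φ : ℝ × E d → ℝ} (hφ : ContDiff ℝ 1 φ) :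
    ∫ z, (inner ℝ (spaceGrad φ z) (w z) + φ z * spaceDiv w z) = 0 := by
  have : (volume : Measure (ℝ × E d)).IsAddHaarMeasure :=
    Measure.prod.instIsAddHaarMeasure volume volume
  set e : Fin d → ℝ × E d := fun i => (0, EuclideanSpace.single i 1) with he
  have hexp : ∀ z, inner ℝ (spaceGrad φ z) (w z) + φ z * spaceDiv w z =
      ∑ i, (fderiv ℝ φ z (e i) * w z i + φ z * fderiv ℝ (fun z => w z i) z (e i)) := by
    intro z
    rw [Finset.sum_add_distrib, spaceDiv, Finset.mul_sum, PiLp.inner_apply]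
    congr 1
    · refine Finset.sum_congr rfl fun i _ => ?_
      rw [spaceGrad_apply hφ]
      simp [he, mul_comm]
    · refine Finset.sum_congr rfl fun i _ => ?_
      rw [fderiv_coord hw]
  have hi1 : ∀ i, Integrable fun z => fderiv ℝ φ z (e i) * w z i := fun i =>
    (((hφ.continuous_fderiv one_ne_zero).clm_apply continuous_const).mul
      (contDiff_coord hw i).continuous).integrable_of_hasCompactSupport
      (hasCompactSupport_coord hc i).mul_left
  have hi2 : ∀ i, Integrable fun z => φ z * fderiv ℝ (fun z => w z i) z (e i) := fun i =>
    (hφ.continuous.mul (((contDiff_coord hw i).continuous_fderiv one_ne_zero).clm_apply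
      continuous_const)).integrable_of_hasCompactSupport
      ((hasCompactSupport_coord hc i).fderiv_apply ℝ (e i)).mul_left
  have hi3 : ∀ i, Integrable fun z => φ z * w z i := fun i =>
    (hφ.continuous.mul (contDiff_coord hw i).continuous).integrable_of_hasCompactSupport
      (hasCompactSupport_coord hc i).mul_left
  have hi12 : ∀ i, Integrable fun z => fderiv ℝ φ z (e i) * w z i +
      φ z * fderiv ℝ (fun z => w z i) z (e i) := fun i => (hi1 i).add (hi2 i)
  simp_rw [hexp]
  rw [integral_finsetSum _ fun i _ => hi12 i]
  refine Finset.sum_eq_zero fun i _ => ?_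
  rw [integral_add (hi1 i) (hi2 i), integral_mul_fderiv_eq_neg_fderiv_mul_of_integrable (hi1 i)
    (hi2 i) (hi3 i) (fun z _ => hφ.differentiable one_ne_zero z)
    (fun z _ => (contDiff_coord hw i).differentiable one_ne_zero z), add_neg_cancel]

theorem integral_timeDeriv_mul (hΩ : IsCompact Ω) {φ ν : ℝ × E d → ℝ} (hφ : ContDiff ℝ 1 φ)
    (hν : ContDiff ℝ 1 ν) :
    ∫ z in cylinder Ω, (timeDeriv φ z * ν z + φ z * timeDeriv ν z) =
      ∫ x in Ω, (φ (1, x) * ν (1, x) - φ (0, x) * ν (0, x)) := by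
  have hc : Continuous fun z => timeDeriv φ z * ν z + φ z * timeDeriv ν z :=
    ((continuous_timeDeriv hφ).mul hν.continuous).add (hφ.continuous.mul (continuous_timeDeriv hν))
  rw [integral_cylinder_symm hΩ (hc.continuousOn.integrableOn_compact (isCompact_cylinder hΩ))]
  congr 1
  ext x
  have h := intervalIntegral.integral_eq_sub_of_hasDerivAt (a := 0) (b := 1)
    (f := fun t => φ (t, x) * ν (t, x))
    (f' := fun t => timeDeriv φ (t, x) * ν (t, x) + φ (t, x) * timeDeriv ν (t, x))
    (fun t _ => by
      rw [timeDeriv_eq hφ, timeDeriv_eq hν]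
      exact (hasDerivAt_time (hφ.differentiable one_ne_zero (t, x)).hasFDerivAt).mul
        (hasDerivAt_time (hν.differentiable one_ne_zero (t, x)).hasFDerivAt))
    ((hc.comp (Continuous.prodMk continuous_id continuous_const)).intervalIntegrable _ _)
  exact h

/-- These are the directions in which a solution can be perturbed. In time, ν vanishes at both ends;
in space, only w must have compact support in the cylinder, while ν may be nonzero on the lateral
boundary. The latter freedom is needed for ν = t (1 - t). -/
theorem integral_weakIntegrand_eq_zero (hΩ : IsCompact Ω) {ν : ℝ × E d → ℝ} {w : ℝ × E d → E d}
    (hν : ContDiff ℝ 1 ν) (h0 : ∀ x, ν (0, x) = 0) (h1 : ∀ x, ν (1, x) = 0)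
    (hw : ContDiff ℝ 1 w) (hc : HasCompactSupport w) (hs : tsupport w ⊆ cylinder Ω)
    {φ : ℝ × E d → ℝ} (hφ : ContDiff ℝ 1 φ) :
    ∫ z in cylinder Ω, weakIntegrand ν w (fun z => timeDeriv ν z + spaceDiv w z) φ z = 0 := by
  have e1 : ∀ z, weakIntegrand ν w (fun z => timeDeriv ν z + spaceDiv w z) φ z =
      (timeDeriv φ z * ν z + φ z * timeDeriv ν z) +
        (inner ℝ (spaceGrad φ z) (w z) + φ z * spaceDiv w z) := by
    intro z; simp only [weakIntegrand]; ring
  simp_rw [e1]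
  rw [integral_add, integral_timeDeriv_mul hΩ hφ hν,
    setIntegral_eq_integral_of_forall_compl_eq_zero
      (f := fun z => (inner ℝ (spaceGrad φ z) (w z) : ℝ) + φ z * spaceDiv w z),
    integral_inner_spaceGrad_add_mul_spaceDiv hw hc hφ]
  · simp [h0, h1]
  · intro z hz
    have hz' : z ∉ tsupport w := fun h => hz (hs h)
    simp [spaceDiv_eq_zero_of_notMem_tsupport hz', image_eq_zero_of_notMem_tsupport hz']
  · exact (((continuous_timeDeriv hφ).mul hν.continuous).add
      (hφ.continuous.mul (continuous_timeDeriv hν))).continuousOn.integrableOn_compact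
      (isCompact_cylinder hΩ)
  · exact (((continuous_spaceGrad hφ).inner hw.continuous).add
      (hφ.continuous.mul (continuous_spaceDiv hw))).continuousOn.integrableOn_compact
      (isCompact_cylinder hΩ)

/-- Only the restriction of μ to (0,1) × Ω is known to be Borel, through continuity; this is why the
perturbed velocity is built from the indicator. -/
theorem Admissible.measurable_indicator {ρ₀ ρ₁ : Density Ω} {v : ℝ × E d → E d}
    {μ f : ℝ × E d → ℝ} (hΩ : IsCompact Ω) (h : Admissible Ω ρ₀ ρ₁ v μ f) :
    Measurable ((Ioo (0 : ℝ) 1 ×ˢ Ω).indicator μ) := by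
  have hm : MeasurableSet (Ioo (0 : ℝ) 1 ×ˢ Ω) := measurableSet_Ioo.prod hΩ.measurableSet
  classical
  rw [← piecewise_eq_indicator]
  exact h.continuousOn.measurable_piecewise continuousOn_const hm

/-- The velocity of the curve with density `μ + δ ν` and momentum `μ v + δ w`. -/
def perturbedVelocity (Ω : Set (E d)) (μ : ℝ × E d → ℝ) (v : ℝ × E d → E d) (δ : ℝ)
    (ν : ℝ × E d → ℝ) (w : ℝ × E d → E d) (z : ℝ × E d) : E d :=
  ((Ioo (0 : ℝ) 1 ×ˢ Ω).indicator μ z + δ * ν z)⁻¹ •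
    ((Ioo (0 : ℝ) 1 ×ˢ Ω).indicator μ z • v z + δ • w z)

/-- The condition `hzero` makes the new momentum vanish wherever the new density does; without it
the momentum would not be a density times a velocity. -/
theorem Admissible.perturb {ρ₀ ρ₁ : Density Ω} {v : ℝ × E d → E d} {μ f : ℝ × E d → ℝ}
    (hΩ : IsCompact Ω) (h : Admissible Ω ρ₀ ρ₁ v μ f) {δ : ℝ} {ν g : ℝ × E d → ℝ}
    {w : ℝ × E d → E d} (hν : Continuous ν) (hw : Continuous w) (hg : Continuous g)
    (h0 : ∀ x, ν (0, x) = 0) (h1 : ∀ x, ν (1, x) = 0)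
    (hweak : ∀ φ : ℝ × E d → ℝ, ContDiff ℝ 1 φ →
      ∫ z in cylinder Ω, weakIntegrand ν w g φ z = 0)
    (hpos : ∀ z ∈ cylinder Ω, 0 ≤ μ z + δ * ν z)
    (hzero : ∀ z ∈ cylinder Ω, μ z + δ * ν z = 0 → μ z • v z + δ • w z = 0) :
    Admissible Ω ρ₀ ρ₁ (perturbedVelocity Ω μ v δ ν w) (fun z => μ z + δ * ν z)
      (fun z => f z + δ * g z) := by
  have hK := isCompact_cylinder hΩ
  have hνi : IntegrableOn ν (cylinder Ω) := hν.continuousOn.integrableOn_compact hK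
  have hwi : IntegrableOn w (cylinder Ω) := hw.continuousOn.integrableOn_compact hK
  have hgi : IntegrableOn g (cylinder Ω) := hg.continuousOn.integrableOn_compact hK
  have hm := h.measurable_indicator hΩ
  -- The indicator in `perturbedVelocity` differs from μ on the cylinder only at the end times, a
  -- null set. Where the new density is zero, the inverse is 0 and both sides vanish.
  have hflux : ∀ᵐ z ∂(volume.restrict (cylinder Ω)),
      (μ z + δ * ν z) • perturbedVelocity Ω μ v δ ν w z = μ z • v z + δ • w z := by
    filter_upwards [ae_mem_Ioo_prod hΩ] with z hz
    have hz' : z ∈ cylinder Ω := prod_mono_left Ioo_subset_Icc_self hz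
    simp only [perturbedVelocity, indicator_of_mem hz]
    by_cases h0 : μ z + δ * ν z = 0
    · rw [h0, hzero z hz' h0]; simp
    · rw [smul_smul, mul_inv_cancel₀ h0, one_smul]
  refine ⟨h.continuousOn.add (hν.continuousOn.const_smul δ), hpos, ?_,
    h.measurable_source.add (hg.measurable.const_mul δ), ⟨?_, ?_, ?_, ?_, ?_, ?_⟩, ?_, ?_⟩
  · unfold perturbedVelocity
    exact (hm.add (hν.measurable.const_mul δ)).inv.smul
      ((hm.smul h.measurable_velocity).add (hw.measurable.const_smul δ))
  · exact h.continuityEq.integrable_density.add (hνi.const_mul δ)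
  · simpa [h0] using h.continuityEq.integrable_initial
  · simpa [h1] using h.continuityEq.integrable_terminal
  · exact IntegrableOn.congr_fun_ae (h.continuityEq.integrable_flux.add (hwi.smul δ))
      (hflux.mono fun z hz => hz.symm)
  · exact h.continuityEq.integrable_source.add (hgi.const_mul δ)
  · intro φ hφ
    have e : ∫ z in cylinder Ω, (timeDeriv φ z * (μ z + δ * ν z) +
        inner ℝ (spaceGrad φ z) ((μ z + δ * ν z) • perturbedVelocity Ω μ v δ ν w z) +
        φ z * (f z + δ * g z)) =
        ∫ z in cylinder Ω, (weakIntegrand μ (fun z => μ z • v z) f φ z +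
          δ * weakIntegrand ν w g φ z) := by
      refine integral_congr_ae ?_
      filter_upwards [hflux] with z hz
      rw [hz]
      simp only [weakIntegrand, inner_add_right, inner_smul_right]
      ring
    rw [e, integral_add (integrableOn_weakIntegrand hΩ h.continuityEq.integrable_density
        h.continuityEq.integrable_flux h.continuityEq.integrable_source hφ)
      ((integrableOn_weakIntegrand hΩ hνi hwi hgi hφ).const_mul δ), integral_const_mul,
      hweak φ hφ, mul_zero, add_zero]
    simp only [h0, h1, mul_zero, add_zero]
    exact h.continuityEq.weak_eq φ hφ
  · simpa [h0] using h.initial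
  · simpa [h1] using h.terminal

theorem Admissible.aestronglyMeasurable_velocity_sq_mul {ρ₀ ρ₁ : Density Ω} {v : ℝ × E d → E d}
    {μ f : ℝ × E d → ℝ} (h : Admissible Ω ρ₀ ρ₁ v μ f) :
    AEStronglyMeasurable (fun z => ‖v z‖ ^ 2 * μ z) (volume.restrict (cylinder Ω)) :=
  (h.measurable_velocity.norm.pow_const 2).aestronglyMeasurable.mul
    h.continuityEq.integrable_density.aestronglyMeasurable

theorem Admissible.nonneg_ae {ρ₀ ρ₁ : Density Ω} {v : ℝ × E d → E d} {μ f : ℝ × E d → ℝ}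
    (hΩ : IsCompact Ω) (h : Admissible Ω ρ₀ ρ₁ v μ f) :
    ∀ᵐ z ∂(volume.restrict (cylinder Ω)), 0 ≤ μ z :=
  (ae_restrict_mem (measurableSet_cylinder hΩ)).mono h.nonneg

theorem Admissible.integrableOn_kinetic {ρ₀ ρ₁ : Density Ω} {v : ℝ × E d → E d}
    {μ f : ℝ × E d → ℝ} (hΩ : IsCompact Ω) {α : ℝ} (h : Admissible Ω ρ₀ ρ₁ v μ f)
    (hfin : action α Ω v μ f ≠ ⊤) : IntegrableOn (fun z => ‖v z‖ ^ 2 * μ z) (cylinder Ω) := by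
  refine ⟨h.aestronglyMeasurable_velocity_sq_mul, ?_⟩
  rw [hasFiniteIntegral_iff_ofReal
    ((h.nonneg_ae hΩ).mono fun z hz => mul_nonneg (sq_nonneg _) hz)]
  exact (ENNReal.add_ne_top.1 hfin).1.lt_top

theorem Admissible.integrableOn_source_sq {ρ₀ ρ₁ : Density Ω} {v : ℝ × E d → E d}
    {μ f : ℝ × E d → ℝ} {α : ℝ} (hα : 0 < α) (h : Admissible Ω ρ₀ ρ₁ v μ f)
    (hfin : action α Ω v μ f ≠ ⊤) : IntegrableOn (fun z => f z ^ 2) (cylinder Ω) := by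
  refine ⟨(h.measurable_source.pow_const 2).aestronglyMeasurable, ?_⟩
  rw [hasFiniteIntegral_iff_ofReal (.of_forall fun z => sq_nonneg _)]
  have h2 := (ENNReal.add_ne_top.1 hfin).2
  simp_rw [sq_abs] at h2
  rcases eq_or_ne (∫⁻ z in cylinder Ω, ENNReal.ofReal (f z ^ 2)) ⊤ with h3 | h3
  · rw [h3, ENNReal.mul_top (by simpa using hα)] at h2
    exact absurd rfl h2
  · exact h3.lt_top

/-- Comparison of a minimizer with its perturbations. -/
theorem IsMinimizer.variation {ρ₀ ρ₁ : Density Ω} {v : ℝ × E d → E d} {μ f : ℝ × E d → ℝ}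
    (hΩ : IsCompact Ω) {α : ℝ} (hα : 0 < α) (hmin : IsMinimizer α Ω ρ₀ ρ₁ v μ f)
    (hfin : action α Ω v μ f ≠ ⊤) {δ : ℝ} {ν g : ℝ × E d → ℝ}
    {w : ℝ × E d → E d} (hν : Continuous ν) (hw : Continuous w) (hg : Continuous g)
    (h0 : ∀ x, ν (0, x) = 0) (h1 : ∀ x, ν (1, x) = 0)
    (hweak : ∀ φ : ℝ × E d → ℝ, ContDiff ℝ 1 φ →
      ∫ z in cylinder Ω, weakIntegrand ν w g φ z = 0)
    (hpos : ∀ z ∈ cylinder Ω, 0 ≤ μ z + δ * ν z)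
    (hzero : ∀ z ∈ cylinder Ω, μ z + δ * ν z = 0 → μ z • v z + δ • w z = 0)
    {r : ℝ × E d → ℝ} (hr : IntegrableOn r (cylinder Ω))
    (hle : ∀ z ∈ cylinder Ω,
      (μ z + δ * ν z)⁻¹ * ‖μ z • v z + δ • w z‖ ^ 2 ≤ ‖v z‖ ^ 2 * μ z + r z) :
    0 ≤ (∫ z in cylinder Ω, r z) +
      1 / α * (2 * δ * (∫ z in cylinder Ω, f z * g z) + δ ^ 2 * ∫ z in cylinder Ω, g z ^ 2) := by
  obtain ⟨h, heq⟩ := hmin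
  have hK := isCompact_cylinder hΩ
  have hadm := h.perturb hΩ hν hw hg h0 h1 hweak hpos hzero
  have hcomp : action α Ω v μ f ≤ action α Ω (perturbedVelocity Ω μ v δ ν w)
      (fun z => μ z + δ * ν z) (fun z => f z + δ * g z) := by
    rw [heq]
    exact iInf_le_of_le _ (iInf_le_of_le _ (iInf_le_of_le _ (iInf_le _ hadm)))
  have hkin := h.integrableOn_kinetic hΩ hfin
  have hsrc := h.integrableOn_source_sq hα hfin
  have hfg : IntegrableOn (fun z => f z * g z) (cylinder Ω) := by
    simpa [mul_comm] using integrableOn_mul_of_continuous hΩ hg h.continuityEq.integrable_source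
  have hgg : IntegrableOn (fun z => g z ^ 2) (cylinder Ω) :=
    (hg.pow 2).continuousOn.integrableOn_compact hK
  have hsrc' : IntegrableOn (fun z => (f z + δ * g z) ^ 2) (cylinder Ω) := by
    refine ((hsrc.add (hfg.const_mul (2 * δ))).add (hgg.const_mul (δ ^ 2))).congr ?_
    exact .of_forall fun z => by simp only [Pi.add_apply]; ring
  have hsum : IntegrableOn (fun z => f z ^ 2 + 2 * δ * (f z * g z)) (cylinder Ω) :=
    hsrc.add (hfg.const_mul (2 * δ))
  have hkr : IntegrableOn (fun z => ‖v z‖ ^ 2 * μ z + r z) (cylinder Ω) := hkin.add hr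
  have hs' : ∫ z in cylinder Ω, (f z + δ * g z) ^ 2 = (∫ z in cylinder Ω, f z ^ 2) +
      2 * δ * (∫ z in cylinder Ω, f z * g z) + δ ^ 2 * ∫ z in cylinder Ω, g z ^ 2 := by
    rw [← integral_const_mul, ← integral_const_mul, ← integral_add hsrc (hfg.const_mul _),
      ← integral_add hsum (hgg.const_mul _)]
    exact integral_congr_ae (.of_forall fun z => by simp only; ring)
  have hnn : ∀ᵐ z ∂(volume.restrict (cylinder Ω)), 0 ≤ ‖v z‖ ^ 2 * μ z :=
    (h.nonneg_ae hΩ).mono fun z hz => mul_nonneg (sq_nonneg _) hz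
  have hnn' : ∀ᵐ z ∂(volume.restrict (cylinder Ω)), 0 ≤ ‖v z‖ ^ 2 * μ z + r z := by
    filter_upwards [ae_restrict_mem (measurableSet_cylinder hΩ)] with z hz
    exact le_trans (mul_nonneg (inv_nonneg.2 (hpos z hz)) (sq_nonneg _)) (hle z hz)
  have hA : action α Ω v μ f = ENNReal.ofReal ((∫ z in cylinder Ω, ‖v z‖ ^ 2 * μ z) +
      1 / α * ∫ z in cylinder Ω, f z ^ 2) := by
    unfold action
    simp_rw [sq_abs]
    rw [← ofReal_integral_eq_lintegral_ofReal hkin hnn,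
      ← ofReal_integral_eq_lintegral_ofReal hsrc (.of_forall fun z => sq_nonneg _),
      ← ENNReal.ofReal_mul (by positivity), ← ENNReal.ofReal_add]
    · exact integral_nonneg_of_ae hnn
    · exact mul_nonneg (by positivity) (integral_nonneg fun z => sq_nonneg _)
  -- The function r majorizes the increase of the kinetic energy density, so an upper bound for the
  -- action of the competitor is enough. No integrability of the competitor's kinetic energy has to
  -- be checked separately.
  have hB : action α Ω (perturbedVelocity Ω μ v δ ν w) (fun z => μ z + δ * ν z)
      (fun z => f z + δ * g z) ≤ ENNReal.ofReal ((∫ z in cylinder Ω, (‖v z‖ ^ 2 * μ z + r z)) +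
      1 / α * ∫ z in cylinder Ω, (f z + δ * g z) ^ 2) := by
    unfold action
    simp_rw [sq_abs]
    rw [ENNReal.ofReal_add (integral_nonneg_of_ae hnn')
      (mul_nonneg (by positivity) (integral_nonneg fun z => sq_nonneg _)),
      ENNReal.ofReal_mul (by positivity),
      ofReal_integral_eq_lintegral_ofReal hkr hnn',
      ofReal_integral_eq_lintegral_ofReal hsrc' (.of_forall fun z => sq_nonneg _)]
    gcongr 1
    refine lintegral_mono_ae ?_
    filter_upwards [ae_mem_Ioo_prod hΩ] with z hz
    have hz' : z ∈ cylinder Ω := prod_mono_left Ioo_subset_Icc_self hz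
    refine ENNReal.ofReal_le_ofReal (le_trans (le_of_eq ?_) (hle z hz'))
    simp only [perturbedVelocity, indicator_of_mem hz, norm_smul, norm_inv, mul_pow, inv_pow,
      Real.norm_eq_abs, sq_abs]
    by_cases h0 : μ z + δ * ν z = 0
    · simp [h0]
    · field_simp
  rw [hA] at hcomp
  have hfinal := hcomp.trans hB
  rw [ENNReal.ofReal_le_ofReal_iff] at hfinal
  · rw [integral_add hkin hr, hs'] at hfinal
    nlinarith [hfinal]
  · exact add_nonneg (integral_nonneg_of_ae hnn')
      (mul_nonneg (by positivity) (integral_nonneg fun z => sq_nonneg _))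

end Perturbation

/-! ### First order conditions -/

section FirstOrder

variable {d : ℕ} {Ω : Set (E d)}

theorem nonneg_of_forall_small {A B δ₀ : ℝ} (hδ₀ : 0 < δ₀)
    (h : ∀ δ, 0 < δ → δ ≤ δ₀ → 0 ≤ δ * A + δ ^ 2 * B) : 0 ≤ A := by
  by_contra! hA
  have hB : 0 < |B| + 1 := by positivity
  -- This choice gives δ (|B| + 1) ≤ -A/2, whence A + δ B ≤ A/2 < 0.
  set δ := min δ₀ (-A / (2 * (|B| + 1))) with hδ
  have hδ0 : 0 < δ := lt_min hδ₀ (div_pos (by linarith) (by positivity))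
  have h1 := h δ hδ0 (min_le_left _ _)
  have h2 : δ * (|B| + 1) ≤ -A / 2 := by
    calc δ * (|B| + 1) ≤ -A / (2 * (|B| + 1)) * (|B| + 1) := by gcongr; exact min_le_right _ _
      _ = -A / 2 := by field_simp
  have h3 : 0 ≤ A + δ * B := by
    have : 0 ≤ δ * (A + δ * B) := by nlinarith [h1]
    exact nonneg_of_mul_nonneg_right this hδ0
  have h4 : δ * B ≤ δ * |B| := by gcongr; exact le_abs_self B
  nlinarith

/-- Subadditivity of |m|²/μ. After multiplication by a + b the gap between the two sides is a b ‖v -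
u‖². The degenerate case a = b = 0 is covered by the convention that the inverse of 0 is 0. -/
theorem inv_mul_norm_add_sq_le {F : Type*} [NormedAddCommGroup F] [InnerProductSpace ℝ F]
    {a b : ℝ} (ha : 0 ≤ a) (hb : 0 ≤ b) (v u : F) :
    (a + b)⁻¹ * ‖a • v + b • u‖ ^ 2 ≤ a * ‖v‖ ^ 2 + b * ‖u‖ ^ 2 := by
  rcases eq_or_lt_of_le (add_nonneg ha hb) with h | h
  · rw [← h]; simp; positivity
  · rw [inv_mul_le_iff₀ h]
    have h1 : ‖a • v + b • u‖ ^ 2 = a ^ 2 * ‖v‖ ^ 2 + 2 * (a * b * inner ℝ v u) +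
        b ^ 2 * ‖u‖ ^ 2 := by
      rw [norm_add_sq_real, inner_smul_left, inner_smul_right, norm_smul, norm_smul, mul_pow,
        mul_pow]
      simp; ring
    have h2 := mul_nonneg (mul_nonneg ha hb) (sq_nonneg ‖v - u‖)
    rw [norm_sub_sq_real] at h2
    rw [h1]
    linarith

/-- Exact expansion of |m|²/μ at the point (a, a v) in the direction (n, w). The remainder is a
square divided by the new density, hence under control as long as that density stays away from 0. -/
theorem inv_mul_norm_add_sq_eq {F : Type*} [NormedAddCommGroup F] [InnerProductSpace ℝ F]
    {a n δ : ℝ} (h : a + δ * n ≠ 0) (v w : F) :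
    (a + δ * n)⁻¹ * ‖a • v + δ • w‖ ^ 2 = ‖v‖ ^ 2 * a +
      (δ * (2 * inner ℝ v w - ‖v‖ ^ 2 * n) + δ ^ 2 * ((a + δ * n)⁻¹ * ‖w - n • v‖ ^ 2)) := by
  have h1 : ‖a • v + δ • w‖ ^ 2 = a ^ 2 * ‖v‖ ^ 2 + 2 * (a * δ * inner ℝ v w) +
      δ ^ 2 * ‖w‖ ^ 2 := by
    rw [norm_add_sq_real, inner_smul_left, inner_smul_right, norm_smul, norm_smul, mul_pow,
      mul_pow]
    simp; ring
  have h2 : ‖w - n • v‖ ^ 2 = ‖w‖ ^ 2 - 2 * (n * inner ℝ v w) + n ^ 2 * ‖v‖ ^ 2 := by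
    rw [norm_sub_sq_real, inner_smul_right, norm_smul, mul_pow, real_inner_comm]
    simp
  rw [h1, h2]
  field_simp
  ring

/-- One-sided first order condition: adding mass. -/
theorem IsMinimizer.first_order_nonneg {ρ₀ ρ₁ : Density Ω} {v : ℝ × E d → E d}
    {μ f : ℝ × E d → ℝ} (hΩ : IsCompact Ω) {α : ℝ} (hα : 0 < α)
    (hmin : IsMinimizer α Ω ρ₀ ρ₁ v μ f) (hfin : action α Ω v μ f ≠ ⊤) {ν : ℝ × E d → ℝ}
    {w u : ℝ × E d → E d} (hν : ContDiff ℝ 1 ν) (h0 : ∀ x, ν (0, x) = 0) (h1 : ∀ x, ν (1, x) = 0)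
    (hpos : ∀ z ∈ cylinder Ω, 0 ≤ ν z) (hw : ContDiff ℝ 1 w) (hc : HasCompactSupport w)
    (hs : tsupport w ⊆ cylinder Ω) (hwu : ∀ z ∈ cylinder Ω, w z = ν z • u z)
    (hint : IntegrableOn (fun z => ν z * ‖u z‖ ^ 2) (cylinder Ω)) :
    0 ≤ (1 / 2) * (∫ z in cylinder Ω, ν z * ‖u z‖ ^ 2) +
      ∫ z in cylinder Ω, f z / α * (timeDeriv ν z + spaceDiv w z) := by
  have hg : Continuous fun z => timeDeriv ν z + spaceDiv w z :=
    (continuous_timeDeriv hν).add (continuous_spaceDiv hw)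
  have key : ∀ δ : ℝ, 0 < δ → δ ≤ 1 →
      0 ≤ δ * ((∫ z in cylinder Ω, ν z * ‖u z‖ ^ 2) +
        2 / α * ∫ z in cylinder Ω, f z * (timeDeriv ν z + spaceDiv w z)) +
        δ ^ 2 * (1 / α * ∫ z in cylinder Ω, (timeDeriv ν z + spaceDiv w z) ^ 2) := by
    intro δ hδ _
    have hvar := hmin.variation hΩ hα hfin hν.continuous hw.continuous hg h0 h1
      (fun φ hφ => integral_weakIntegrand_eq_zero hΩ hν h0 h1 hw hc hs hφ) (δ := δ)
      (fun z hz => add_nonneg (hmin.1.nonneg z hz) (mul_nonneg hδ.le (hpos z hz)))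
      (fun z hz hzero => by
        have hμ := hmin.1.nonneg z hz
        have hν' := mul_nonneg hδ.le (hpos z hz)
        have e1 : μ z = 0 := by linarith
        have e2 : δ * ν z = 0 := by linarith
        rw [hwu z hz, smul_smul, e1, e2]; simp)
      (hint.const_mul δ)
      (fun z hz => by
        rw [hwu z hz, smul_smul]
        refine (inv_mul_norm_add_sq_le (hmin.1.nonneg z hz) (mul_nonneg hδ.le (hpos z hz))
          (v z) (u z)).trans (le_of_eq ?_)
        ring)
    rw [integral_const_mul] at hvar
    refine hvar.trans (le_of_eq ?_)
    ring
  have h := nonneg_of_forall_small one_pos key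
  have e : ∫ z in cylinder Ω, f z / α * (timeDeriv ν z + spaceDiv w z) =
      1 / α * ∫ z in cylinder Ω, f z * (timeDeriv ν z + spaceDiv w z) := by
    rw [← integral_const_mul]
    congr 1; ext z; ring
  rw [e]
  have : 2 / α * (∫ z in cylinder Ω, f z * (timeDeriv ν z + spaceDiv w z)) =
    2 * (1 / α * ∫ z in cylinder Ω, f z * (timeDeriv ν z + spaceDiv w z)) := by ring
  linarith

theorem Admissible.isOpen_pos {ρ₀ ρ₁ : Density Ω} {v : ℝ × E d → E d} {μ f : ℝ × E d → ℝ}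
    (h : Admissible Ω ρ₀ ρ₁ v μ f) : IsOpen (openCylinder Ω ∩ {z | 0 < μ z}) :=
  (h.continuousOn.mono (prod_mono_right interior_subset)).isOpen_inter_preimage
    isOpen_openCylinder isOpen_Ioi

theorem Admissible.exists_pos_le {ρ₀ ρ₁ : Density Ω} {v : ℝ × E d → E d} {μ f : ℝ × E d → ℝ}
    (h : Admissible Ω ρ₀ ρ₁ v μ f) {K : Set (ℝ × E d)} (hK : IsCompact K)
    (hKU : K ⊆ openCylinder Ω ∩ {z | 0 < μ z}) : ∃ c, 0 < c ∧ ∀ z ∈ K, c ≤ μ z := by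
  rcases K.eq_empty_or_nonempty with rfl | hne
  · exact ⟨1, one_pos, by simp⟩
  · obtain ⟨z, hz, hz'⟩ := hK.exists_isMinOn hne (h.continuousOn.mono
      (hKU.trans (inter_subset_left.trans (prod_mono_right interior_subset))))
    exact ⟨μ z, (hKU hz).2, fun y hy => hz' hy⟩

theorem Admissible.integrableOn_velocity_sq {ρ₀ ρ₁ : Density Ω} {v : ℝ × E d → E d}
    {μ f : ℝ × E d → ℝ} (hΩ : IsCompact Ω) {α : ℝ} (h : Admissible Ω ρ₀ ρ₁ v μ f)
    (hfin : action α Ω v μ f ≠ ⊤) {K : Set (ℝ × E d)} (hK : IsCompact K)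
    (hKU : K ⊆ openCylinder Ω ∩ {z | 0 < μ z}) : IntegrableOn (fun z => ‖v z‖ ^ 2) K := by
  obtain ⟨c, hc, hcK⟩ := h.exists_pos_le hK hKU
  have h1 : IntegrableOn (fun z => c⁻¹ * (‖v z‖ ^ 2 * μ z)) K :=
    ((h.integrableOn_kinetic hΩ hfin).mono_set
      (hKU.trans (inter_subset_left.trans openCylinder_subset_cylinder))).const_mul _
  refine Integrable.mono' h1 (h.measurable_velocity.norm.pow_const 2).aestronglyMeasurable ?_
  filter_upwards [ae_restrict_mem hK.measurableSet] with z hz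
  rw [Real.norm_of_nonneg (sq_nonneg _), ← div_eq_inv_mul, le_div_iff₀ hc]
  gcongr
  exact hcK z hz

/-- Two-sided first order condition on the set where the density is positive. -/
theorem IsMinimizer.first_order_eq {ρ₀ ρ₁ : Density Ω} {v : ℝ × E d → E d}
    {μ f : ℝ × E d → ℝ} (hΩ : IsCompact Ω) {α : ℝ} (hα : 0 < α)
    (hmin : IsMinimizer α Ω ρ₀ ρ₁ v μ f) (hfin : action α Ω v μ f ≠ ⊤) {ν : ℝ × E d → ℝ}
    {w : ℝ × E d → E d} (hν : ContDiff ℝ 1 ν) (hw : ContDiff ℝ 1 w)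
    (hcν : HasCompactSupport ν) (hcw : HasCompactSupport w)
    (hsν : tsupport ν ⊆ openCylinder Ω ∩ {z | 0 < μ z})
    (hsw : tsupport w ⊆ openCylinder Ω ∩ {z | 0 < μ z}) :
    (∫ z in cylinder Ω, (2 * inner ℝ (v z) (w z) - ‖v z‖ ^ 2 * ν z)) +
      2 * ∫ z in cylinder Ω, f z / α * (timeDeriv ν z + spaceDiv w z) = 0 := by
  have hadm := hmin.1
  set K := tsupport ν ∪ tsupport w with hKdef
  have hK : IsCompact K := hcν.isCompact.union hcw.isCompact
  have hKU : K ⊆ openCylinder Ω ∩ {z | 0 < μ z} := union_subset hsν hsw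
  have hKc : K ⊆ cylinder Ω := hKU.trans (inter_subset_left.trans openCylinder_subset_cylinder)
  have hν0 : ∀ z, z ∉ K → ν z = 0 := fun z hz =>
    image_eq_zero_of_notMem_tsupport fun h => hz (Or.inl h)
  have hw0 : ∀ z, z ∉ K → w z = 0 := fun z hz =>
    image_eq_zero_of_notMem_tsupport fun h => hz (Or.inr h)
  obtain ⟨c, hc, hcK⟩ := hadm.exists_pos_le hK hKU
  obtain ⟨N, hN0, hN⟩ := exists_bound_of_continuous hΩ hν.continuous
  have hvK := hadm.integrableOn_velocity_sq hΩ hfin hK hKU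
  have hmeas := hadm.measurable_velocity
  have hg : Continuous fun z => timeDeriv ν z + spaceDiv w z :=
    (continuous_timeDeriv hν).add (continuous_spaceDiv hw)
  have hwK : IntegrableOn (fun z => ‖w z‖ ^ 2) K :=
    (hw.continuous.norm.pow 2).continuousOn.integrableOn_compact hK
  have hvνK : IntegrableOn (fun z => ‖v z‖ ^ 2 * ν z) K :=
    IntegrableOn.mul_continuousOn hvK hν.continuous.continuousOn hK
  have hvννK : IntegrableOn (fun z => ‖v z‖ ^ 2 * (ν z ^ 2)) K :=
    IntegrableOn.mul_continuousOn hvK (hν.continuous.pow 2).continuousOn hK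
  have hvwK : IntegrableOn (fun z => inner ℝ (v z) (w z)) K := by
    refine Integrable.mono' (hvK.add hwK)
      (hmeas.aestronglyMeasurable.inner hw.continuous.aestronglyMeasurable)
      (.of_forall fun z => ?_)
    have := norm_inner_le_norm (𝕜 := ℝ) (v z) (w z)
    simp only [Pi.add_apply]
    nlinarith [sq_nonneg (‖v z‖ - ‖w z‖), norm_nonneg (v z), norm_nonneg (w z)]
  have hr1K : IntegrableOn (fun z => 2 * inner ℝ (v z) (w z) - ‖v z‖ ^ 2 * ν z) K :=
    (hvwK.const_mul 2).sub hvνK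
  have hr2K : IntegrableOn (fun z => ‖w z - ν z • v z‖ ^ 2) K := by
    refine Integrable.mono' ((hwK.const_mul 2).add (hvννK.const_mul 2))
      ((hw.continuous.measurable.sub (hν.continuous.measurable.smul hmeas)).norm.pow_const
        2).aestronglyMeasurable (.of_forall fun z => ?_)
    rw [Real.norm_of_nonneg (sq_nonneg _)]
    have h1 := norm_sub_le (w z) (ν z • v z)
    have h2 : ‖ν z • v z‖ ^ 2 = ‖v z‖ ^ 2 * ν z ^ 2 := by
      rw [norm_smul, mul_pow, Real.norm_eq_abs, sq_abs, mul_comm]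
    simp only [Pi.add_apply]
    rw [← h2]
    nlinarith [sq_nonneg (‖w z‖ - ‖ν z • v z‖), norm_nonneg (w z), norm_nonneg (ν z • v z),
      norm_nonneg (w z - ν z • v z)]
  have hr1 : IntegrableOn (fun z => 2 * inner ℝ (v z) (w z) - ‖v z‖ ^ 2 * ν z) (cylinder Ω) :=
    hr1K.of_forall_sdiff_eq_zero (measurableSet_cylinder hΩ)
      fun z hz => by simp [hν0 z hz.2, hw0 z hz.2]
  have hr2 : IntegrableOn (fun z => ‖w z - ν z • v z‖ ^ 2) (cylinder Ω) :=
    hr2K.of_forall_sdiff_eq_zero (measurableSet_cylinder hΩ)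
      fun z hz => by simp [hν0 z hz.2, hw0 z hz.2]
  set A := (∫ z in cylinder Ω, (2 * inner ℝ (v z) (w z) - ‖v z‖ ^ 2 * ν z)) +
      2 / α * ∫ z in cylinder Ω, f z * (timeDeriv ν z + spaceDiv w z) with hA
  -- A is the coefficient of δ, and B majorizes that of δ²; the factor 2/c bounds the inverse of the
  -- perturbed density on K.
  set B := 2 / c * (∫ z in cylinder Ω, ‖w z - ν z • v z‖ ^ 2) +
      1 / α * ∫ z in cylinder Ω, (timeDeriv ν z + spaceDiv w z) ^ 2 with hB
  have hT : ∀ {z : ℝ × E d}, (z.1 = 0 ∨ z.1 = 1) → z ∉ K := by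
    intro z hz hzK
    have := (hKU hzK).1.1
    rcases hz with h | h <;> simp [h] at this
  have h0 : ∀ x, ν (0, x) = 0 := fun x => hν0 _ (hT (Or.inl rfl))
  have h1 : ∀ x, ν (1, x) = 0 := fun x => hν0 _ (hT (Or.inr rfl))
  -- For such δ one has |δ ν| ≤ c/2 on K, so the perturbed density is at least c/2 there, whatever
  -- the sign of δ. Off K nothing is perturbed. The summand 1 in N + 1 avoids a division by 0.
  have key : ∀ δ : ℝ, |δ| ≤ c / (2 * (N + 1)) → 0 ≤ δ * A + δ ^ 2 * B := by
    intro δ hδ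
    have hlow : ∀ z ∈ K, c / 2 ≤ μ z + δ * ν z := by
      intro z hz
      have h2 : |δ * ν z| ≤ c / 2 := by
        rw [abs_mul]
        have h3 : |ν z| ≤ N := hN z (hKc hz)
        calc |δ| * |ν z| ≤ c / (2 * (N + 1)) * (N + 1) := by
              gcongr; linarith
          _ = c / 2 := by field_simp
      linarith [hcK z hz, neg_abs_le (δ * ν z)]
    have hvar := hmin.variation hΩ hα hfin hν.continuous hw.continuous hg h0 h1
      (fun φ hφ => integral_weakIntegrand_eq_zero hΩ hν h0 h1 hw hcw
        (subset_union_right.trans hKc) hφ) (δ := δ)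
      (fun z hz => by
        by_cases hzK : z ∈ K
        · linarith [hlow z hzK]
        · simpa [hν0 z hzK] using hadm.nonneg z hz)
      (fun z hz hzero => by
        by_cases hzK : z ∈ K
        · linarith [hlow z hzK]
        · have hμ : μ z = 0 := by simpa [hν0 z hzK] using hzero
          simp [hμ, hw0 z hzK])
      ((hr1.const_mul δ).add (hr2.const_mul (δ ^ 2 * (2 / c))))
      (fun z hz => by
        simp only [Pi.add_apply]
        by_cases hzK : z ∈ K
        · have hp : 0 < μ z + δ * ν z := lt_of_lt_of_le (by positivity) (hlow z hzK)
          rw [inv_mul_norm_add_sq_eq hp.ne']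
          have : (μ z + δ * ν z)⁻¹ ≤ 2 / c := by
            rw [inv_le_comm₀ hp (by positivity), inv_div]
            exact hlow z hzK
          rw [mul_assoc (δ ^ 2)]
          gcongr
        · simp only [hν0 z hzK, hw0 z hzK, mul_zero, add_zero, smul_zero, inner_zero_right,
            sub_zero, zero_smul, norm_zero, norm_smul, mul_pow, Real.norm_eq_abs, sq_abs]
          rcases eq_or_ne (μ z) 0 with h | h
          · simp [h]
          · field_simp
            simp)
    simp only [Pi.add_apply] at hvar
    rw [integral_add (hr1.const_mul δ) (hr2.const_mul _), integral_const_mul,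
      integral_const_mul] at hvar
    refine hvar.trans (le_of_eq ?_)
    rw [hA, hB]
    ring
  have hδ₀ : 0 < c / (2 * (N + 1)) := by positivity
  have hA1 : 0 ≤ A := nonneg_of_forall_small hδ₀ fun δ h1 h2 => key δ (by rwa [abs_of_pos h1])
  have hA2 : 0 ≤ -A := nonneg_of_forall_small (B := B) hδ₀ fun δ h1 h2 => by
    have := key (-δ) (by rwa [abs_neg, abs_of_pos h1])
    rw [neg_sq] at this
    linarith
  have e : ∫ z in cylinder Ω, f z / α * (timeDeriv ν z + spaceDiv w z) =
      1 / α * ∫ z in cylinder Ω, f z * (timeDeriv ν z + spaceDiv w z) := by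
    rw [← integral_const_mul]
    congr 1; ext z; ring
  rw [e]
  have hA0 : A = 0 := le_antisymm (by linarith) hA1
  rw [← hA0, hA]
  ring

end FirstOrder

/-! ### The potential of a minimizer -/

section Potential

variable {d : ℕ} {Ω : Set (E d)}

/-- A bounded functional in the `L²` seminorm of `T` is represented by an element of `L²`. -/
theorem exists_representer {V H : Type*} [AddCommGroup V] [Module ℝ V] [NormedAddCommGroup H]
    [InnerProductSpace ℝ H] [CompleteSpace H] (ℓ : V →ₗ[ℝ] ℝ) (T : V →ₗ[ℝ] H) (C : ℝ)
    (h : ∀ x, ‖ℓ x‖ ≤ C * ‖T x‖) : ∃ g : H, ∀ x, ℓ x = inner ℝ g (T x) := by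
  obtain ⟨L, hL, -⟩ := _root_.exists_extension_norm_eq (LinearMap.range T) (ℓ.compLeftInverse T)
  refine ⟨(InnerProductSpace.toDual ℝ H).symm L, fun x => ?_⟩
  rw [InnerProductSpace.toDual_symm_apply]
  have h1 := hL ⟨T x, LinearMap.mem_range_self T x⟩
  rw [LinearMap.compLeftInverse_apply_of_bdd ℓ T ⟨C, h⟩ x (T x) rfl] at h1
  exact h1.symm

/-- The weight `t (1 - t)`. -/
def timeWeight (z : ℝ × E d) : ℝ := z.1 * (1 - z.1)

theorem contDiff_timeWeight : ContDiff ℝ 1 (timeWeight : ℝ × E d → ℝ) :=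
  contDiff_fst.mul (contDiff_const.sub contDiff_fst)

theorem timeWeight_nonneg {z : ℝ × E d} (hz : z ∈ cylinder Ω) : 0 ≤ timeWeight z :=
  mul_nonneg hz.1.1 (by linarith [hz.1.2])

theorem timeWeight_pos {z : ℝ × E d} (hz : z ∈ openCylinder Ω) : 0 < timeWeight z :=
  mul_pos hz.1.1 (by linarith [hz.1.2])

theorem exists_le_timeWeight {K : Set (ℝ × E d)} (hK : IsCompact K) (hKU : K ⊆ openCylinder Ω) :
    ∃ c, 0 < c ∧ ∀ z ∈ K, c ≤ timeWeight z := by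
  rcases K.eq_empty_or_nonempty with rfl | hne
  · exact ⟨1, one_pos, by simp⟩
  · obtain ⟨z, hz, hz'⟩ := hK.exists_isMinOn hne contDiff_timeWeight.continuous.continuousOn
    exact ⟨_, timeWeight_pos (hKU hz), fun y hy => hz' hy⟩

/-- The test functions on `U`, as a linear space. -/
def testSubmodule (U : Set (ℝ × E d)) : Submodule ℝ (ℝ × E d → ℝ) where
  carrier := {ψ | IsTestFunction U ψ}
  add_mem' := fun ha hb => ⟨ha.1.add hb.1, ha.2.1.add hb.2.1,
    (tsupport_add _ _).trans (union_subset ha.2.2 hb.2.2)⟩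
  zero_mem' := ⟨contDiff_const, HasCompactSupport.zero, by
    rw [tsupport_eq_empty_iff.2 rfl]
    exact empty_subset _⟩
  smul_mem' := fun c _ ha => ⟨contDiff_const.mul ha.1, ha.2.1.mul_left,
    (tsupport_mul_subset_right).trans ha.2.2⟩

theorem IsTestFunction.contDiff_one {U : Set (ℝ × E d)} {ψ : ℝ × E d → ℝ}
    (h : IsTestFunction U ψ) : ContDiff ℝ 1 ψ :=
  h.1.of_le (by exact_mod_cast le_top)

theorem spaceGrad_add_apply {φ ψ : ℝ × E d → ℝ} (hφ : ContDiff ℝ 1 φ) (hψ : ContDiff ℝ 1 ψ)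
    (z : ℝ × E d) (i : Fin d) : spaceGrad (φ + ψ) z i = spaceGrad φ z i + spaceGrad ψ z i := by
  rw [spaceGrad_apply (φ := φ + ψ) (hφ.add hψ), spaceGrad_apply hφ, spaceGrad_apply hψ,
    fderiv_add (hφ.differentiable one_ne_zero z) (hψ.differentiable one_ne_zero z)]
  rfl

theorem spaceGrad_smul_apply {φ : ℝ × E d → ℝ} (hφ : ContDiff ℝ 1 φ) (c : ℝ)
    (z : ℝ × E d) (i : Fin d) : spaceGrad (c • φ) z i = c * spaceGrad φ z i := by
  rw [spaceGrad_apply (φ := c • φ) (hφ.const_smul c), spaceGrad_apply hφ,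
    fderiv_const_smul (hφ.differentiable one_ne_zero z)]
  rfl

/-- The vector field `ψ eᵢ`. -/
def coordField (i : Fin d) (ψ : ℝ × E d → ℝ) (z : ℝ × E d) : E d :=
  ψ z • EuclideanSpace.single i 1

theorem contDiff_coordField {n : ℕ∞ω} {ψ : ℝ × E d → ℝ} (hψ : ContDiff ℝ n ψ) (i : Fin d) :
    ContDiff ℝ n (coordField i ψ) :=
  hψ.smul contDiff_const

theorem tsupport_coordField_subset (ψ : ℝ × E d → ℝ) (i : Fin d) :
    tsupport (coordField i ψ) ⊆ tsupport ψ :=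
  closure_mono fun z hz h => hz (by simp [coordField, h])

theorem hasCompactSupport_coordField {ψ : ℝ × E d → ℝ} (hψ : HasCompactSupport ψ) (i : Fin d) :
    HasCompactSupport (coordField i ψ) :=
  hψ.smul_right

theorem spaceDiv_coordField {ψ : ℝ × E d → ℝ} (hψ : ContDiff ℝ 1 ψ) (i : Fin d) (z : ℝ × E d) :
    spaceDiv (coordField i ψ) z = spaceGrad ψ z i := by
  rw [spaceDiv_eq_sum (contDiff_coordField hψ i), Finset.sum_eq_single i]
  · have : (fun z => coordField i ψ z i) = ψ := by
      ext z; simp [coordField]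
    rw [this]
  · intro j _ hj
    have : (fun z => coordField i ψ z j) = fun _ => (0 : ℝ) := by
      ext z; simp [coordField, hj]
    rw [this]
    simp [spaceGrad, gradient]
  · simp

theorem norm_coordField (ψ : ℝ × E d → ℝ) (i : Fin d) (z : ℝ × E d) :
    ‖coordField i ψ z‖ = |ψ z| := by
  simp [coordField, norm_smul]

theorem continuous_spaceGrad_apply {ψ : ℝ × E d → ℝ} (hψ : ContDiff ℝ 1 ψ) (i : Fin d) :
    Continuous fun z => spaceGrad ψ z i :=
  (EuclideanSpace.proj (𝕜 := ℝ) i).continuous.comp (continuous_spaceGrad hψ)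

theorem memLp_div_sqrt_timeWeight {ψ : ℝ × E d → ℝ} (hΩ : IsCompact Ω)
    (hψ : IsTestFunction (openCylinder Ω) ψ) :
    MemLp (fun z => (Real.sqrt (timeWeight z))⁻¹ * ψ z) 2 (volume.restrict (cylinder Ω)) := by
  have := isFiniteMeasure_restrict_cylinder hΩ
  obtain ⟨c, hc, hcK⟩ := exists_le_timeWeight hψ.2.1.isCompact hψ.2.2
  obtain ⟨N, hN0, hN⟩ := exists_bound_of_continuous hΩ hψ.1.continuous
  refine MemLp.of_bound ((contDiff_timeWeight.continuous.sqrt.measurable.inv.mul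
    hψ.1.continuous.measurable).aestronglyMeasurable) ((Real.sqrt c)⁻¹ * N) ?_
  filter_upwards [ae_restrict_mem (measurableSet_cylinder hΩ)] with z hz
  by_cases hzs : z ∈ tsupport ψ
  · rw [norm_mul, norm_inv, Real.norm_of_nonneg (Real.sqrt_nonneg _)]
    have := hcK z hzs
    have h2 : 0 < Real.sqrt c := Real.sqrt_pos.2 hc
    gcongr
    exact hN z hz
  · rw [image_eq_zero_of_notMem_tsupport hzs]
    simp; positivity

theorem sq_sqrt_timeWeight_inv_mul {ψ : ℝ × E d → ℝ} {z : ℝ × E d} (hz : z ∈ cylinder Ω) :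
    ((Real.sqrt (timeWeight z))⁻¹ * ψ z) ^ 2 = (timeWeight z)⁻¹ * ψ z ^ 2 := by
  rw [mul_pow, inv_pow, Real.sq_sqrt (timeWeight_nonneg hz)]

/-- The potential `f / α` of a minimizer has a weak gradient in a weighted `L²` space. -/
theorem IsMinimizer.exists_gradient {ρ₀ ρ₁ : Density Ω} {v : ℝ × E d → E d}
    {μ f : ℝ × E d → ℝ} (hΩ : IsCompact Ω) {α : ℝ} (hα : 0 < α)
    (hmin : IsMinimizer α Ω ρ₀ ρ₁ v μ f) (hfin : action α Ω v μ f ≠ ⊤) (i : Fin d) :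
    ∃ G : ℝ × E d → ℝ, Measurable G ∧
      IntegrableOn (fun z => timeWeight z * G z ^ 2) (cylinder Ω) ∧
      ∀ ψ, IsTestFunction (openCylinder Ω) ψ →
        ∫ z in cylinder Ω, f z / α * spaceGrad ψ z i = - ∫ z in cylinder Ω, ψ z * G z := by
  set P := (volume : Measure (ℝ × E d)).restrict (cylinder Ω) with hP
  have hΦ : Integrable (fun z => f z / α) P := hmin.1.continuityEq.integrable_source.div_const α
  have hint : ∀ {g : ℝ × E d → ℝ}, Continuous g → Integrable (fun z => f z / α * g z) P := by
    intro g hg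
    have := integrableOn_mul_of_continuous hΩ hg hΦ
    exact this.congr (.of_forall fun z => mul_comm _ _)
  let V := testSubmodule (openCylinder Ω)
  let ℓ : V →ₗ[ℝ] ℝ :=
    { toFun := fun ψ => ∫ z, f z / α * spaceGrad ψ.1 z i ∂P
      map_add' := fun φ ψ => by
        have hφ := IsTestFunction.contDiff_one φ.2
        have hψ := IsTestFunction.contDiff_one ψ.2
        rw [← integral_add (hint (continuous_spaceGrad_apply hφ i))
          (hint (continuous_spaceGrad_apply hψ i))]
        congr 1; ext z
        rw [← mul_add, ← spaceGrad_add_apply hφ hψ]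
        rfl
      map_smul' := fun c ψ => by
        have hψ := IsTestFunction.contDiff_one ψ.2
        rw [RingHom.id_apply, smul_eq_mul, ← integral_const_mul]
        congr 1; ext z
        rw [Submodule.coe_smul, spaceGrad_smul_apply hψ]
        ring }
  let T : V →ₗ[ℝ] Lp ℝ 2 P :=
    { toFun := fun ψ => (memLp_div_sqrt_timeWeight hΩ ψ.2).toLp _
      map_add' := fun φ ψ => by
        rw [← MemLp.toLp_add]
        congr 1; ext z
        simp [mul_add]
      map_smul' := fun c ψ => by
        rw [RingHom.id_apply, ← MemLp.toLp_const_smul]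
        congr 1; ext z
        simp [mul_left_comm] }
  have hTnorm : ∀ ψ : V, ‖T ψ‖ ^ 2 = ∫ z, (timeWeight z)⁻¹ * ψ.1 z ^ 2 ∂P := by
    intro ψ
    rw [← real_inner_self_eq_norm_sq, L2.inner_def]
    refine integral_congr_ae ?_
    filter_upwards [(memLp_div_sqrt_timeWeight hΩ ψ.2).coeFn_toLp,
      ae_restrict_mem (measurableSet_cylinder hΩ)] with z hz hzc
    change inner ℝ (((memLp_div_sqrt_timeWeight hΩ ψ.2).toLp _) z)
      (((memLp_div_sqrt_timeWeight hΩ ψ.2).toLp _) z) = _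
    rw [hz, real_inner_self_eq_norm_sq, Real.norm_eq_abs, sq_abs, sq_sqrt_timeWeight_inv_mul hzc]
  have hTint : ∀ ψ : V, Integrable (fun z => (timeWeight z)⁻¹ * ψ.1 z ^ 2) P := by
    intro ψ
    refine (memLp_div_sqrt_timeWeight hΩ ψ.2).integrable_sq.congr ?_
    filter_upwards [ae_restrict_mem (measurableSet_cylinder hΩ)] with z hzc
    exact sq_sqrt_timeWeight_inv_mul hzc
  -- The contribution of ν = t (1 - t) alone; it does not depend on ψ.
  set C := ∫ z, f z / α * timeDeriv timeWeight z ∂P with hC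
  -- The one-sided condition for ν = t (1 - t) and momentum s ψ eᵢ, that is, u = s ψ eᵢ / (t (1 -
  -- t)). The kinetic term is then ½ s² ‖T ψ‖², and s ranges over all reals because ν does not
  -- change with s.
  have hquad : ∀ (ψ : V) (s : ℝ), 0 ≤ (1 / 2 * ‖T ψ‖ ^ 2) * (s * s) + ℓ ψ * s + C := by
    intro ψ s
    have hψ := IsTestFunction.contDiff_one ψ.2
    have hψs : ContDiff ℝ 1 (s • ψ.1) := hψ.const_smul s
    have hts : tsupport (coordField i (s • ψ.1)) ⊆ openCylinder Ω :=
      (tsupport_coordField_subset _ _).trans ((s • ψ).2.2.2)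
    have hz0 : ∀ {z : ℝ × E d}, z ∈ cylinder Ω → timeWeight z = 0 → ψ.1 z = 0 := by
      intro z _ hz
      apply image_eq_zero_of_notMem_tsupport
      intro h
      exact (timeWeight_pos (ψ.2.2.2 h)).ne' hz
    have hr : ∀ {z : ℝ × E d}, z ∈ cylinder Ω →
        timeWeight z * ‖(timeWeight z)⁻¹ • coordField i (s • ψ.1) z‖ ^ 2 =
          s ^ 2 * ((timeWeight z)⁻¹ * ψ.1 z ^ 2) := by
      intro z hz
      rw [norm_smul, norm_coordField, mul_pow, sq_abs, Real.norm_eq_abs, sq_abs]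
      rcases eq_or_ne (timeWeight z) 0 with h | h
      · simp [h]
      · simp only [Pi.smul_apply, smul_eq_mul]
        field_simp
    have h := hmin.first_order_nonneg hΩ hα hfin (ν := timeWeight)
      (w := coordField i (s • ψ.1)) (u := fun z => (timeWeight z)⁻¹ • coordField i (s • ψ.1) z)
      contDiff_timeWeight (fun x => by simp [timeWeight]) (fun x => by simp [timeWeight])
      (fun z hz => timeWeight_nonneg hz) (contDiff_coordField hψs i)
      (hasCompactSupport_coordField (s • ψ).2.2.1 i) (hts.trans openCylinder_subset_cylinder)
      (fun z hz => by
        rcases eq_or_ne (timeWeight z) 0 with h | h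
        · simp [h, coordField, hz0 hz h]
        · rw [smul_smul, mul_inv_cancel₀ h, one_smul])
      (((hTint ψ).const_mul (s ^ 2)).congr (by
        filter_upwards [ae_restrict_mem (measurableSet_cylinder hΩ)] with z hz
        exact (hr hz).symm))
    have e1 : ∫ z in cylinder Ω, timeWeight z *
        ‖(timeWeight z)⁻¹ • coordField i (s • ψ.1) z‖ ^ 2 = s ^ 2 * ‖T ψ‖ ^ 2 := by
      rw [hTnorm, ← integral_const_mul]
      exact setIntegral_congr_fun (measurableSet_cylinder hΩ) fun z hz => hr hz
    have e2 : ∫ z in cylinder Ω, f z / α *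
        (timeDeriv timeWeight z + spaceDiv (coordField i (s • ψ.1)) z) = C + s * ℓ ψ := by
      change _ = C + s * ∫ z, f z / α * spaceGrad ψ.1 z i ∂P
      rw [hC, ← integral_const_mul, ← integral_add (hint (continuous_timeDeriv contDiff_timeWeight))
        ((hint (continuous_spaceGrad_apply hψ i)).const_mul s)]
      congr 1; ext z
      rw [spaceDiv_coordField hψs, spaceGrad_smul_apply hψ]
      ring
    rw [e1, e2] at h
    linarith
  -- A nonnegative quadratic polynomial has nonpositive discriminant: (ℓ ψ)² ≤ 2 C ‖T ψ‖².
  have hbound : ∀ ψ : V, ‖ℓ ψ‖ ≤ Real.sqrt (2 * C) * ‖T ψ‖ := by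
    intro ψ
    have h1 := discrim_le_zero (hquad ψ)
    have hC0 : 0 ≤ C := by simpa using hquad ψ 0
    rw [← abs_of_nonneg (norm_nonneg (T ψ)), ← Real.sqrt_sq_eq_abs,
      ← Real.sqrt_mul (by positivity), Real.norm_eq_abs]
    refine Real.abs_le_sqrt ?_
    rw [discrim] at h1
    linarith
  obtain ⟨g, hg⟩ := exists_representer ℓ T _ hbound
  have hgm : Measurable (g : ℝ × E d → ℝ) := (Lp.stronglyMeasurable g).measurable
  -- T divides by the square root of the weight, so the representer has to be divided by it once
  -- more; the sign is that of the integration by parts. The weight times the square of this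
  -- function is the square of g wherever the weight is positive.
  refine ⟨fun z => -((Real.sqrt (timeWeight z))⁻¹ * g z), ?_, ?_, fun ψ hψ => ?_⟩
  · exact (contDiff_timeWeight.continuous.sqrt.measurable.inv.mul hgm).neg
  · refine Integrable.mono' (Lp.memLp g).integrable_sq
      ((contDiff_timeWeight.continuous.measurable.mul
        ((contDiff_timeWeight.continuous.sqrt.measurable.inv.mul
          hgm).neg.pow_const 2)).aestronglyMeasurable) ?_
    filter_upwards [ae_restrict_mem (measurableSet_cylinder hΩ)] with z hz
    rw [neg_sq, sq_sqrt_timeWeight_inv_mul hz]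
    rcases eq_or_ne (timeWeight z) 0 with h | h
    · simp [h]; positivity
    · rw [← mul_assoc, mul_inv_cancel₀ h, one_mul, Real.norm_of_nonneg (sq_nonneg _)]
  · have h := hg ⟨ψ, hψ⟩
    change ∫ z, f z / α * spaceGrad ψ z i ∂P = _ at h
    rw [h, L2.inner_def, ← integral_neg]
    refine integral_congr_ae ?_
    filter_upwards [(memLp_div_sqrt_timeWeight hΩ hψ).coeFn_toLp] with z hz
    change inner ℝ (g z) (((memLp_div_sqrt_timeWeight hΩ hψ).toLp _) z) = _
    rw [hz, real_inner_comm]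
    simp
    ring

end Potential

/-! ### Optimality conditions -/

section Optimality

variable {d : ℕ} {Ω : Set (E d)}

theorem spaceDiv_smul_eq_sum {ν : ℝ × E d → ℝ} {u : ℝ × E d → E d} (hν : ContDiff ℝ 1 ν)
    (hu : ContDiff ℝ 1 u) (z : ℝ × E d) :
    spaceDiv (fun z => ν z • u z) z = ∑ i, spaceGrad (fun z => ν z * u z i) z i := by
  rw [spaceDiv_eq_sum (w := fun z => ν z • u z) (hν.smul hu)]
  rfl

theorem tsupport_zero_fun {F : Type*} [Zero F] :
    tsupport (fun _ : ℝ × E d => (0 : F)) = ∅ :=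
  tsupport_eq_empty_iff.2 rfl

theorem IsTestFunction.mul_left {U : Set (ℝ × E d)} {ψ g : ℝ × E d → ℝ}
    (hψ : IsTestFunction U ψ) (hg : ContDiff ℝ ∞ g) : IsTestFunction U fun z => ψ z * g z :=
  ⟨hψ.1.mul hg, hψ.2.1.mul_right, (tsupport_mul_subset_left).trans hψ.2.2⟩

theorem setIntegral_cylinder_eq {F : Type*} [NormedAddCommGroup F] [NormedSpace ℝ F]
    (hΩ : IsCompact Ω) {s : Set (ℝ × E d)} (hs : s ⊆ cylinder Ω)
    {g : ℝ × E d → F} (h : ∀ z, z ∉ s → g z = 0) :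
    ∫ z in s, g z = ∫ z in cylinder Ω, g z :=
  (setIntegral_eq_of_subset_of_forall_sdiff_eq_zero (measurableSet_cylinder hΩ) hs
    fun z hz => h z hz.2).symm

/-- Density of smooth compactly supported functions in L². It supplies smooth velocities close to
the weak gradient, which itself is too rough for the one-sided condition. -/
theorem eq_of_forall_integral_norm_sub_sq {F : Type*} [NormedAddCommGroup F]
    [InnerProductSpace ℝ F] [FiniteDimensional ℝ F] {K : Set (ℝ × E d)} (hK : IsCompact K)
    {G : ℝ × E d → F} (hG : MemLp G 2 (volume.restrict K)) {ε : ℝ} (hε : 0 < ε) :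
    ∃ u : ℝ × E d → F, ContDiff ℝ ∞ u ∧ ∫ z in K, ‖G z - u z‖ ^ 2 ≤ ε := by
  have : IsFiniteMeasure ((volume : Measure (ℝ × E d)).restrict K) :=
    MeasureTheory.isFiniteMeasure_restrict.2 hK.measure_lt_top.ne
  obtain ⟨u, hu1, hu2, hu3⟩ := hG.exist_eLpNorm_sub_le (by simp) (by norm_num)
    (Real.sqrt_pos.2 hε)
  refine ⟨u, hu2, ?_⟩
  have hm : MemLp (G - u) 2 (volume.restrict K) :=
    hG.sub (hu2.continuous.memLp_of_hasCompactSupport hu1)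
  rw [hm.eLpNorm_eq_integral_rpow_norm (by simp) (by simp)] at hu3
  rw [ENNReal.ofReal_le_ofReal_iff (Real.sqrt_nonneg _)] at hu3
  simp only [ENNReal.toReal_ofNat, Real.rpow_ofNat] at hu3
  rw [show (2 : ℝ)⁻¹ = 1 / 2 by norm_num, ← Real.sqrt_eq_rpow] at hu3
  exact (Real.sqrt_le_sqrt_iff hε.le).1 hu3

theorem integral_hamiltonJacobi {a b : ℝ × E d → ℝ} {ψ : ℝ × E d → ℝ} {c : ℝ × E d → ℝ}
    (ha : IntegrableOn (fun z => a z * c z) (cylinder Ω))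
    (hb : IntegrableOn (fun z => b z * ψ z) (cylinder Ω)) :
    ∫ z in cylinder Ω, (-(a z * c z) + (1 / 2) * b z * ψ z) =
      -(∫ z in cylinder Ω, a z * c z) + (1 / 2) * ∫ z in cylinder Ω, b z * ψ z := by
  simp_rw [mul_assoc]
  rw [← integral_neg, ← integral_const_mul, ← integral_add ha.fun_neg (hb.const_mul _)]

/-- The optimality conditions for a minimizer of finite action. -/
theorem IsMinimizer.optimality {ρ₀ ρ₁ : Density Ω} {v : ℝ × E d → E d}
    {μ f : ℝ × E d → ℝ} (hΩ : IsCompact Ω) (hconv : Convex ℝ Ω) {α : ℝ} (hα : 0 < α)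
    (hmin : IsMinimizer α Ω ρ₀ ρ₁ v μ f) (hfin : action α Ω v μ f ≠ ⊤) :
    ∃ (Φ : ℝ × E d → ℝ) (G : ℝ × E d → E d),
      IsWeakSpaceGrad (openCylinder Ω) Φ G ∧
      (∀ᵐ z ∂(volume.restrict (cylinder Ω)), 0 < μ z → v z = G z) ∧
      (∀ᵐ z ∂(volume.restrict (cylinder Ω)), f z = α * Φ z) ∧
      SolvesContinuityEq Ω μ G (fun z => α * Φ z) ∧
      HamiltonJacobiLe (openCylinder Ω) Φ G ∧
      HamiltonJacobiEq (openCylinder Ω ∩ {z | 0 < μ z}) Φ G := by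
  have hadm := hmin.1
  choose g hgm hgi hg using fun i => hmin.exists_gradient hΩ hα hfin i
  set Φ : ℝ × E d → ℝ := fun z => f z / α with hΦdef
  set G : ℝ × E d → E d := fun z => WithLp.toLp 2 fun i => g i z with hGdef
  set U := openCylinder Ω with hU
  set O := U ∩ {z | 0 < μ z} with hO
  have hOo : IsOpen O := hadm.isOpen_pos
  have hUo : IsOpen U := isOpen_openCylinder
  have hUc : U ⊆ cylinder Ω := openCylinder_subset_cylinder
  have hOU : O ⊆ U := inter_subset_left
  have hfΦ : ∀ z, f z = α * Φ z := fun z => by simp only [hΦdef]; field_simp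
  have hΦi : IntegrableOn Φ (cylinder Ω) := hadm.continuityEq.integrable_source.div_const α
  have hΦc : ∀ {h : ℝ × E d → ℝ}, Continuous h → IntegrableOn (fun z => Φ z * h z) (cylinder Ω) :=
    fun {h} hh => (integrableOn_mul_of_continuous hΩ hh hΦi).congr
      (.of_forall fun z => mul_comm _ _)
  have hGm : Measurable G := by
    refine (WithLp.measurable_toLp 2 _).comp (measurable_pi_lambda _ hgm)
  have hGn : ∀ z, ‖G z‖ ^ 2 = ∑ i, g i z ^ 2 := fun z => by
    rw [EuclideanSpace.norm_sq_eq]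
    simp [hGdef]
  have hθG : IntegrableOn (fun z => timeWeight z * ‖G z‖ ^ 2) (cylinder Ω) := by
    have : IntegrableOn (fun z => ∑ i, timeWeight z * g i z ^ 2) (cylinder Ω) :=
      integrable_finsetSum _ fun i _ => hgi i
    refine this.congr (.of_forall fun z => ?_)
    simp only [hGn, Finset.mul_sum]
  -- The weight t (1 - t) is bounded below on compact subsets of the open cylinder, so the weighted
  -- bound becomes local square integrability.
  have hG2K : ∀ K, K ⊆ U → IsCompact K → IntegrableOn (fun z => ‖G z‖ ^ 2) K := by
    intro K hKU hK
    obtain ⟨c, hc, hcK⟩ := exists_le_timeWeight hK hKU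
    refine Integrable.mono' ((hθG.mono_set (hKU.trans hUc)).const_mul c⁻¹)
      (hGm.norm.pow_const 2).aestronglyMeasurable ?_
    filter_upwards [ae_restrict_mem hK.measurableSet] with z hz
    rw [Real.norm_of_nonneg (sq_nonneg _), ← div_eq_inv_mul, le_div_iff₀ hc, mul_comm]
    gcongr
    exact hcK z hz
  have hGLp : ∀ K, K ⊆ U → IsCompact K → MemLp G 2 (volume.restrict K) := fun K hKU hK =>
    (memLp_two_iff_integrable_sq_norm hGm.aestronglyMeasurable).2 (hG2K K hKU hK)
  have hGK : ∀ K, K ⊆ U → IsCompact K → IntegrableOn G K := by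
    intro K hKU hK
    have : IsFiniteMeasure ((volume : Measure (ℝ × E d)).restrict K) :=
      MeasureTheory.isFiniteMeasure_restrict.2 hK.measure_lt_top.ne
    exact (hGLp K hKU hK).integrable (by norm_num)
  have hΦloc : ∀ {W : Set (ℝ × E d)}, W ⊆ U → LocallyIntegrableOn Φ W := fun hW =>
    (hΦi.mono_set (hW.trans hUc)).locallyIntegrableOn
  have hG2loc : LocallyIntegrableOn (fun z => ‖G z‖ ^ 2) U :=
    (locallyIntegrableOn_iff hUo.isLocallyClosed).2 hG2K
  have hGloc : LocallyIntegrableOn G U := (locallyIntegrableOn_iff hUo.isLocallyClosed).2 hGK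
  have hψ0 : ∀ {W : Set (ℝ × E d)} {ψ : ℝ × E d → ℝ}, IsTestFunction W ψ → ∀ z, z ∉ W →
      ψ z = 0 ∧ timeDeriv ψ z = 0 ∧ spaceGrad ψ z = 0 := fun hψ z hz =>
    have hz' : z ∉ tsupport _ := fun h => hz (hψ.2.2 h)
    ⟨image_eq_zero_of_notMem_tsupport hz',
      timeDeriv_eq_zero_of_notMem_tsupport hψ.contDiff_one hz',
      spaceGrad_eq_zero_of_notMem_tsupport hψ.contDiff_one hz'⟩
  -- products of test functions with locally integrable functions
  have hprod : ∀ {h ψ : ℝ × E d → ℝ}, (∀ K, K ⊆ U → IsCompact K → IntegrableOn h K) →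
      Continuous ψ → HasCompactSupport ψ → tsupport ψ ⊆ U →
      IntegrableOn (fun z => h z * ψ z) (cylinder Ω) := by
    intro h ψ hh hψ hψc hψU
    refine IntegrableOn.of_forall_sdiff_eq_zero (IntegrableOn.mul_continuousOn
      (hh _ hψU hψc.isCompact) hψ.continuousOn hψc.isCompact) (measurableSet_cylinder hΩ) ?_
    intro z hz
    rw [image_eq_zero_of_notMem_tsupport hz.2, mul_zero]
  have hgK : ∀ i K, K ⊆ U → IsCompact K → IntegrableOn (g i) K := fun i K hKU hK =>
    (EuclideanSpace.proj (𝕜 := ℝ) i).integrable_comp (hGK K hKU hK)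
  -- the velocity is the weak gradient where the density is positive
  have hvG : ∀ᵐ z, z ∈ O → v z = G z := by
    have hi : ∀ i, ∀ᵐ z, z ∈ O → v z i - g i z = 0 := by
      intro i
      have hvK : ∀ K, K ⊆ O → IsCompact K → IntegrableOn (fun z => v z i) K := by
        intro K hKO hK
        have : IsFiniteMeasure ((volume : Measure (ℝ × E d)).restrict K) :=
          MeasureTheory.isFiniteMeasure_restrict.2 hK.measure_lt_top.ne
        have h2 : MemLp v 2 (volume.restrict K) :=
          (memLp_two_iff_integrable_sq_norm hadm.measurable_velocity.aestronglyMeasurable).2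
            (hadm.integrableOn_velocity_sq hΩ hfin hK hKO)
        exact (EuclideanSpace.proj (𝕜 := ℝ) i).integrable_comp (h2.integrable (by norm_num))
      refine hOo.ae_eq_zero_of_integral_contDiff_smul_eq_zero
        ((locallyIntegrableOn_iff hOo.isLocallyClosed).2 fun K hKO hK =>
          (hvK K hKO hK).sub (hgK i K (hKO.trans hOU) hK)) fun ψ hψ hψc hψO => ?_
      have hψT : IsTestFunction O ψ := ⟨hψ, hψc, hψO⟩
      have hψU : IsTestFunction U ψ := ⟨hψ, hψc, hψO.trans hOU⟩
      -- Varying the momentum alone gives ∫ vᵢ ψ + ∫ Φ ∂ᵢψ = 0, and the last integral is -∫ ψ gᵢ.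
      have h1 := hmin.first_order_eq hΩ hα hfin (ν := fun _ => 0) (w := coordField i ψ)
        contDiff_const (contDiff_coordField hψT.contDiff_one i) HasCompactSupport.zero
        (hasCompactSupport_coordField hψc i)
        (by rw [tsupport_zero_fun]; exact empty_subset _)
        ((tsupport_coordField_subset ψ i).trans hψO)
      have h2 : ∀ z, timeDeriv (fun _ : ℝ × E d => (0 : ℝ)) z = 0 := fun z => by simp [timeDeriv]
      have h3 : ∀ z, inner ℝ (v z) (coordField i ψ z) = v z i * ψ z := fun z => by
        simp [coordField, inner_smul_right, EuclideanSpace.inner_single_right, mul_comm]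
      simp only [h2, h3, spaceDiv_coordField hψT.contDiff_one, mul_zero, sub_zero, zero_add,
        integral_const_mul, hg i ψ hψU] at h1
      have hI1 : IntegrableOn (fun z => v z i * ψ z) (tsupport ψ) :=
        IntegrableOn.mul_continuousOn (hvK _ hψO hψc) hψ.continuous.continuousOn hψc
      have hI1' : IntegrableOn (fun z => v z i * ψ z) (cylinder Ω) :=
        hI1.of_forall_sdiff_eq_zero (measurableSet_cylinder hΩ) fun z hz => by
          rw [image_eq_zero_of_notMem_tsupport hz.2, mul_zero]
      have hI2 : IntegrableOn (fun z => ψ z * g i z) (cylinder Ω) :=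
        (hprod (hgK i) hψ.continuous hψc hψU.2.2).congr (.of_forall fun z => mul_comm _ _)
      rw [← setIntegral_eq_integral_of_forall_compl_eq_zero (s := cylinder Ω)]
      · have : ∀ z, ψ z • (v z i - g i z) = v z i * ψ z - ψ z * g i z := fun z => by
          rw [smul_eq_mul]; ring
        simp_rw [this]
        rw [integral_sub hI1' hI2]
        linarith
      · intro z hz
        rw [(hψ0 hψU z fun h => hz (hUc h)).1, zero_smul]
    filter_upwards [ae_all_iff.2 hi] with z hz hzO
    ext i
    exact sub_eq_zero.1 (hz i hzO)
  have hvGc : ∀ᵐ z ∂(volume.restrict (cylinder Ω)), 0 < μ z → v z = G z := by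
    rw [← restrict_openCylinder hΩ hconv]
    filter_upwards [ae_restrict_of_ae hvG, ae_restrict_mem hUo.measurableSet] with z h1 h2 h3
    exact h1 ⟨h2, h3⟩
  -- Where μ = 0 both momenta vanish, so replacing v by G off {μ > 0} does not affect the equation.
  have hμG : ∀ᵐ z ∂(volume.restrict (cylinder Ω)), μ z • v z = μ z • G z := by
    filter_upwards [hvGc, hadm.nonneg_ae hΩ] with z h1 h2
    rcases h2.eq_or_lt with h | h
    · rw [← h]; simp
    · rw [h1 h]
  refine ⟨Φ, G, ⟨hΦloc subset_rfl, hGloc, fun ψ hψ => ?_⟩, hvGc, .of_forall hfΦ, ?_,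
    ⟨hΦloc subset_rfl, hG2loc, fun ψ hψ hψ0' => ?_⟩, ⟨hΦloc hOU, hG2loc.mono_set hOU,
      fun ψ hψ => ?_⟩⟩
  · rw [setIntegral_cylinder_eq hΩ hUc fun z hz => by rw [(hψ0 hψ z hz).2.2, smul_zero],
      setIntegral_cylinder_eq hΩ hUc fun z hz => by rw [(hψ0 hψ z hz).1, zero_smul]]
    have hI1 : IntegrableOn (fun z => Φ z • spaceGrad ψ z) (cylinder Ω) := by
      exact IntegrableOn.smul_continuousOn hΦi (continuous_spaceGrad hψ.contDiff_one).continuousOn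
        (isCompact_cylinder hΩ)
    have hI2 : IntegrableOn (fun z => ψ z • G z) (cylinder Ω) := by
      refine IntegrableOn.of_forall_sdiff_eq_zero (IntegrableOn.continuousOn_smul
        (hGK _ hψ.2.2 hψ.2.1.isCompact) hψ.1.continuous.continuousOn hψ.2.1.isCompact)
        (measurableSet_cylinder hΩ) fun z hz => ?_
      rw [image_eq_zero_of_notMem_tsupport hz.2, zero_smul]
    ext i
    have e1 := (EuclideanSpace.proj (𝕜 := ℝ) i).integral_comp_comm hI1
    have e2 := (EuclideanSpace.proj (𝕜 := ℝ) i).integral_comp_comm hI2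
    have e3 := hg i ψ hψ
    simp only [PiLp.proj_apply, PiLp.smul_apply, smul_eq_mul] at e1 e2
    rw [PiLp.neg_apply, ← e1, ← e2]
    exact e3
  · have hc := hadm.continuityEq
    refine ⟨hc.integrable_density, hc.integrable_initial, hc.integrable_terminal,
      hc.integrable_flux.congr hμG, ?_, fun φ hφ => ?_⟩
    · simp_rw [← hfΦ]; exact hc.integrable_source
    · rw [hc.weak_eq φ hφ]
      refine integral_congr_ae ?_
      filter_upwards [hμG] with z hz
      rw [hz, ← hfΦ]
  · have hψ1 := hψ.contDiff_one
    have hI : IntegrableOn (fun z => ‖G z‖ ^ 2 * ψ z) (cylinder Ω) :=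
      hprod hG2K hψ1.continuous hψ.2.1 hψ.2.2
    have hIt := hΦc (continuous_timeDeriv hψ1)
    rw [setIntegral_cylinder_eq hΩ hUc fun z hz => by
      rw [(hψ0 hψ z hz).1, (hψ0 hψ z hz).2.1]; simp]
    rw [integral_hamiltonJacobi hIt hI]
    refine le_of_forall_pos_le_add fun ε hε => ?_
    obtain ⟨N, hN0, hN⟩ := exists_bound_of_continuous hΩ hψ1.continuous
    -- Since ψ ≤ N on its support, the tolerance ε/(N + 1) makes the error ∫ ψ ‖G - u‖² at most ε.
    obtain ⟨u, hu, huε⟩ := eq_of_forall_integral_norm_sub_sq hψ.2.1.isCompact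
      (hGLp _ hψ.2.2 hψ.2.1.isCompact) (ε := ε / (N + 1)) (by positivity)
    have hu1 : ContDiff ℝ 1 u := hu.of_le (by exact_mod_cast le_top)
    have huT : ∀ i, IsTestFunction U fun z => ψ z * u z i := fun i =>
      hψ.mul_left (contDiff_coord hu i)
    have hwsupp : tsupport (fun z => ψ z • u z) ⊆ tsupport ψ :=
      closure_mono fun z hz h => hz (by simp [h])
    have hIu : IntegrableOn (fun z => ψ z * ‖u z‖ ^ 2) (cylinder Ω) :=
      (hψ1.continuous.mul (hu1.continuous.norm.pow 2)).continuousOn.integrableOn_compact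
        (isCompact_cylinder hΩ)
    have h1 := hmin.first_order_nonneg hΩ hα hfin (ν := ψ) (w := fun z => ψ z • u z) (u := u) hψ1
      (fun x => (hψ0 hψ _ (by simp [hU, openCylinder])).1)
      (fun x => (hψ0 hψ _ (by simp [hU, openCylinder])).1) (fun z _ => hψ0' z)
      (hψ1.smul hu1) hψ.2.1.smul_right (hwsupp.trans (hψ.2.2.trans hUc)) (fun z _ => rfl) hIu
    have hIG : ∀ i, IntegrableOn (fun z => ψ z * u z i * g i z) (cylinder Ω) := fun i =>
      (hprod (hgK i) (huT i).1.continuous (huT i).2.1 (huT i).2.2).congr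
        (.of_forall fun z => mul_comm _ _)
    have hIgrad : ∀ i, IntegrableOn (fun z => Φ z * spaceGrad (fun z => ψ z * u z i) z i)
      (cylinder Ω) := fun i => hΦc (continuous_spaceGrad_apply (huT i).contDiff_one i)
    have hinner : ∀ z, ψ z * inner ℝ (G z) (u z) = ∑ i, ψ z * u z i * g i z := by
      intro z
      rw [PiLp.inner_apply, Finset.mul_sum]
      refine Finset.sum_congr rfl fun i _ => ?_
      simp [hGdef]; ring
    have hIinner : IntegrableOn (fun z => ψ z * inner ℝ (G z) (u z)) (cylinder Ω) := by
      simp_rw [hinner]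
      exact integrable_finsetSum _ fun i _ => hIG i
    have h2 : ∫ z in cylinder Ω, Φ z * (timeDeriv ψ z + spaceDiv (fun z => ψ z • u z) z) =
        (∫ z in cylinder Ω, Φ z * timeDeriv ψ z) -
          ∫ z in cylinder Ω, ψ z * inner ℝ (G z) (u z) := by
      have e1 : ∫ z in cylinder Ω, Φ z * spaceDiv (fun z => ψ z • u z) z =
          - ∫ z in cylinder Ω, ψ z * inner ℝ (G z) (u z) := by
        simp_rw [spaceDiv_smul_eq_sum hψ1 hu1, hinner, Finset.mul_sum]
        rw [integral_finsetSum _ fun i _ => hIgrad i, integral_finsetSum _ fun i _ => hIG i,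
          ← Finset.sum_neg_distrib]
        exact Finset.sum_congr rfl fun i _ => hg i _ (huT i)
      simp_rw [mul_add]
      rw [integral_add hIt (hΦc (continuous_spaceDiv (w := fun z => ψ z • u z) (hψ1.smul hu1))), e1, sub_eq_add_neg]
    rw [h2] at h1
    -- Completing the square: ½ ψ‖u‖² - ψ⟨G, u⟩ equals -½ ψ‖G‖² plus half the error term. This turns
    -- the one-sided condition for u into the Hamilton-Jacobi inequality for G up to ε/2.
    have hdiff : ∀ z, ψ z * ‖G z - u z‖ ^ 2 =
        ‖G z‖ ^ 2 * ψ z - 2 * (ψ z * inner ℝ (G z) (u z)) + ψ z * ‖u z‖ ^ 2 := by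
      intro z; rw [norm_sub_sq_real]; ring
    have hIa : IntegrableOn (fun z => ‖G z‖ ^ 2 * ψ z - 2 * (ψ z * inner ℝ (G z) (u z)))
        (cylinder Ω) := hI.sub (hIinner.const_mul 2)
    have h3 : ∫ z in cylinder Ω, ψ z * ‖G z - u z‖ ^ 2 =
        (∫ z in cylinder Ω, ‖G z‖ ^ 2 * ψ z) -
          2 * (∫ z in cylinder Ω, ψ z * inner ℝ (G z) (u z)) +
          ∫ z in cylinder Ω, ψ z * ‖u z‖ ^ 2 := by
      simp_rw [hdiff]
      rw [integral_add hIa hIu, integral_sub hI (hIinner.const_mul 2), integral_const_mul]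
    have hIK : IntegrableOn (fun z => ‖G z - u z‖ ^ 2) (tsupport ψ) := by
      have : IsFiniteMeasure ((volume : Measure (ℝ × E d)).restrict (tsupport ψ)) :=
        MeasureTheory.isFiniteMeasure_restrict.2 hψ.2.1.isCompact.measure_lt_top.ne
      exact (memLp_two_iff_integrable_sq_norm
        (hGm.sub hu.continuous.measurable).aestronglyMeasurable).1
        ((hGLp _ hψ.2.2 hψ.2.1.isCompact).sub
          ((memLp_two_iff_integrable_sq_norm hu.continuous.measurable.aestronglyMeasurable).2
          ((hu.continuous.norm.pow 2).continuousOn.integrableOn_compact hψ.2.1.isCompact)))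
    have h4 : ∫ z in cylinder Ω, ψ z * ‖G z - u z‖ ^ 2 ≤ ε := by
      rw [← setIntegral_cylinder_eq hΩ (hψ.2.2.trans hUc) fun z hz => by
        rw [image_eq_zero_of_notMem_tsupport hz, zero_mul]]
      calc ∫ z in tsupport ψ, ψ z * ‖G z - u z‖ ^ 2
          ≤ ∫ z in tsupport ψ, N * ‖G z - u z‖ ^ 2 := by
            refine setIntegral_mono_on (IntegrableOn.continuousOn_mul
              hψ1.continuous.continuousOn hIK hψ.2.1.isCompact) (hIK.const_mul N)
              hψ.2.1.isCompact.measurableSet fun z hz => ?_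
            gcongr
            exact (le_abs_self _).trans (hN z (hUc (hψ.2.2 hz)))
        _ ≤ N * (ε / (N + 1)) := by
            rw [integral_const_mul]; gcongr
        _ ≤ ε := by
            rw [mul_div_assoc', div_le_iff₀ (by positivity)]
            nlinarith
    linarith
  · have hψ1 := hψ.contDiff_one
    have hψU : IsTestFunction U ψ := ⟨hψ.1, hψ.2.1, hψ.2.2.trans hOU⟩
    -- Varying the density alone gives -½ ∫ ‖v‖² ψ + ∫ Φ ∂ₜψ = 0, up to a factor 2. On the support
    -- of ψ the velocity is G.
    have h1 := hmin.first_order_eq hΩ hα hfin (ν := ψ) (w := fun _ => 0) hψ1 contDiff_const hψ.2.1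
      HasCompactSupport.zero hψ.2.2 (by rw [tsupport_zero_fun]; exact empty_subset _)
    have h2 : ∀ z, spaceDiv (fun _ : ℝ × E d => (0 : E d)) z = 0 := fun z => by simp [spaceDiv]
    simp only [h2, inner_zero_right, mul_zero, zero_sub, add_zero, integral_neg] at h1
    have hI : IntegrableOn (fun z => ‖G z‖ ^ 2 * ψ z) (cylinder Ω) :=
      hprod hG2K hψ1.continuous hψU.2.1 hψU.2.2
    have hIt := hΦc (continuous_timeDeriv hψ1)
    rw [setIntegral_cylinder_eq hΩ (hOU.trans hUc) fun z hz => by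
      rw [(hψ0 hψ z hz).1, (hψ0 hψ z hz).2.1]; simp]
    have h3 : ∫ z in cylinder Ω, ‖v z‖ ^ 2 * ψ z = ∫ z in cylinder Ω, ‖G z‖ ^ 2 * ψ z := by
      refine integral_congr_ae ?_
      filter_upwards [ae_restrict_of_ae hvG] with z hz
      by_cases hzO : z ∈ O
      · rw [hz hzO]
      · rw [(hψ0 hψ z hzO).1, mul_zero, mul_zero]
    rw [integral_hamiltonJacobi hIt hI, ← h3]
    linarith

end Optimality

/-! ### The regularizing kernel -/

section Kernel

variable {d : ℕ} {Ω : Set (E d)}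

/-- A smooth probability density supported in `Ω`. -/
structure IsBump (Ω : Set (E d)) (η : E d → ℝ) : Prop where
  contDiff : ContDiff ℝ 1 η
  nonneg : ∀ y, 0 ≤ η y
  eq_zero : ∀ y, y ∉ Ω → η y = 0
  lintegral_eq_one : ∫⁻ y, ENNReal.ofReal (η y) = 1

/-- The nonempty interior of Ω enters the construction here: it leaves room for a C¹ law of the
noise. -/
theorem exists_isBump (h : (interior Ω).Nonempty) : ∃ η, IsBump Ω η := by
  obtain ⟨c, hc⟩ := h
  obtain ⟨r, hr, hrΩ⟩ := Metric.isOpen_iff.1 isOpen_interior c hc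
  let b : ContDiffBump c := ⟨r / 2, r, by positivity, by linarith⟩
  refine ⟨b.normed volume, b.contDiff_normed, b.nonneg_normed, fun y hy => ?_, ?_⟩
  · by_contra h
    have : y ∈ Function.support (b.normed volume) := h
    rw [b.support_normed_eq] at this
    exact hy (interior_subset (hrΩ this))
  · rw [← ofReal_integral_eq_lintegral_ofReal b.integrable_normed (.of_forall b.nonneg_normed),
      b.integral_normed, ENNReal.ofReal_one]

/-- The law of the noise. -/
def noise (η : E d → ℝ) : Measure (E d) := volume.withDensity fun y => ENNReal.ofReal (η y)

theorem IsBump.measurable {η : E d → ℝ} (h : IsBump Ω η) :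
    Measurable fun y => ENNReal.ofReal (η y) :=
  h.contDiff.continuous.measurable.ennreal_ofReal

theorem IsBump.isProbabilityMeasure {η : E d → ℝ} (h : IsBump Ω η) :
    IsProbabilityMeasure (noise η) :=
  ⟨by rw [noise, withDensity_apply _ MeasurableSet.univ, Measure.restrict_univ,
    h.lintegral_eq_one]⟩

theorem IsBump.ae_mem {η : E d → ℝ} (h : IsBump Ω η) : ∀ᵐ y ∂(noise η), y ∈ Ω := by
  rw [noise, ae_withDensity_iff h.measurable]
  refine .of_forall fun y hy => ?_
  by_contra hyΩ
  simp [h.eq_zero y hyΩ] at hy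

/-- The size of the noise at time `t`. -/
def noiseScale (L t : ℝ) : ℝ := L * (t * (1 - t))

theorem noiseScale_pos {L t : ℝ} (hL : 0 < L) (ht : t ∈ Ioo (0 : ℝ) 1) : 0 < noiseScale L t :=
  mul_pos hL (mul_pos ht.1 (by linarith [ht.2]))

theorem noiseScale_nonneg {L t : ℝ} (hL : 0 < L) (ht : t ∈ Icc (0 : ℝ) 1) : 0 ≤ noiseScale L t :=
  mul_nonneg hL.le (mul_nonneg ht.1 (by linarith [ht.2]))

theorem noiseScale_le {L : ℝ} (hL : 0 < L) (t : ℝ) : noiseScale L t ≤ L / 2 := by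
  unfold noiseScale
  nlinarith [sq_nonneg (t - 1 / 2)]

theorem continuous_noiseScale (L : ℝ) : Continuous (noiseScale L) := by
  unfold noiseScale; fun_prop

theorem hasDerivAt_noiseScale (L t : ℝ) :
    HasDerivAt (noiseScale L) (L * (1 - 2 * t)) t := by
  have h := ((hasDerivAt_id' t).fun_mul ((hasDerivAt_id' t).const_sub 1)).const_mul L
  convert! h using 1
  ring

/-- The density at `z` of `(1 - ε) x + ε Y`, where `ε` is the size of the noise at time `t`. -/
def noiseKernel (η : E d → ℝ) (L t : ℝ) (z x : E d) : ℝ :=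
  (noiseScale L t)⁻¹ ^ d * η ((noiseScale L t)⁻¹ • (z - (1 - noiseScale L t) • x))

/-- The map `((t, x), y) ↦ ((t, (1 - ε) x + ε y), x)`. -/
def addNoise (L : ℝ) (p : (ℝ × E d) × E d) : (ℝ × E d) × E d :=
  ((p.1.1, (1 - noiseScale L p.1.1) • p.1.2 + noiseScale L p.1.1 • p.2), p.1.2)

theorem continuous_addNoise (L : ℝ) :
    Continuous (addNoise L : (ℝ × E d) × E d → (ℝ × E d) × E d) := by
  have := continuous_noiseScale L
  unfold addNoise; fun_prop

theorem measurable_noiseKernel {η : E d → ℝ} (h : IsBump Ω η) (L : ℝ) :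
    Measurable fun p : (ℝ × E d) × E d => noiseKernel η L p.1.1 p.1.2 p.2 := by
  have h1 : Measurable fun p : (ℝ × E d) × E d => noiseScale L p.1.1 :=
    (continuous_noiseScale L).measurable.comp measurable_fst.fst
  have h2 := h.contDiff.continuous.measurable
  unfold noiseKernel
  exact (h1.inv.pow_const d).mul (h2.comp (h1.inv.smul
    (measurable_fst.snd.sub ((h1.const_sub 1).smul measurable_snd))))

theorem noiseKernel_nonneg {η : E d → ℝ} (h : IsBump Ω η) {L t : ℝ} (hε : 0 ≤ noiseScale L t)
    (z x : E d) : 0 ≤ noiseKernel η L t z x :=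
  mul_nonneg (pow_nonneg (inv_nonneg.2 hε) _) (h.nonneg _)

/-- If the noise value were in Ω, then z would be a convex combination of it and x, hence in Ω. So
no mass leaves the domain. -/
theorem noiseKernel_eq_zero {η : E d → ℝ} (h : IsBump Ω η) (hconv : Convex ℝ Ω) {L t : ℝ}
    (hε : 0 < noiseScale L t) (hε1 : noiseScale L t ≤ 1) {z x : E d} (hx : x ∈ Ω) (hz : z ∉ Ω) :
    noiseKernel η L t z x = 0 := by
  unfold noiseKernel
  rw [h.eq_zero, mul_zero]
  intro hy
  apply hz
  have := hconv hx hy (by linarith : 0 ≤ 1 - noiseScale L t) hε.le (by ring)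
  rwa [smul_smul, mul_inv_cancel₀ hε.ne', one_smul, add_sub_cancel] at this

theorem lintegral_comp_add_smul {g : E d → ℝ≥0∞} (hg : Measurable g) (a : E d) {r : ℝ}
    (hr : r ≠ 0) : ∫⁻ y, g (a + r • y) = ENNReal.ofReal (|r|⁻¹ ^ d) * ∫⁻ z, g z := by
  have h1 : Measurable fun z => g (a + z) := hg.comp (measurable_const_add a)
  have h2 := lintegral_map (μ := (volume : Measure (E d))) h1 (measurable_const_smul r)
  rw [Measure.map_addHaar_smul _ hr, lintegral_smul_measure, lintegral_add_left_eq_self] at h2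
  rw [← h2]
  simp [abs_pow]

/-- Substitution z = (1 - ε) x + ε y, whose Jacobian is the power of ε in the kernel. The
restriction to Ω is harmless because the kernel vanishes outside. -/
theorem lintegral_noise {η : E d → ℝ} (h : IsBump Ω η) (hΩ : IsCompact Ω) (hconv : Convex ℝ Ω)
    {L t : ℝ} (hε : 0 < noiseScale L t) (hε1 : noiseScale L t ≤ 1) {x : E d} (hx : x ∈ Ω)
    {F : E d → ℝ≥0∞} (hF : Measurable F) :
    ∫⁻ y, F ((1 - noiseScale L t) • x + noiseScale L t • y) ∂(noise η) =
      ∫⁻ z in Ω, ENNReal.ofReal (noiseKernel η L t z x) * F z := by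
  set ε := noiseScale L t with hεdef
  have hη := h.contDiff.continuous.measurable
  have hm : Measurable fun z : E d =>
      ENNReal.ofReal (η (ε⁻¹ • (z - (1 - ε) • x))) * F z :=
    (hη.comp ((measurable_id.sub_const _).const_smul ε⁻¹)).ennreal_ofReal.mul hF
  have h1 := lintegral_comp_add_smul hm ((1 - ε) • x) hε.ne'
  simp only [add_sub_cancel_left, smul_smul, inv_mul_cancel₀ hε.ne', one_smul] at h1
  rw [noise, lintegral_withDensity_eq_lintegral_mul _ h.measurable
    (by fun_prop : Measurable fun y => F ((1 - ε) • x + ε • y))]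
  simp only [Pi.mul_apply]
  rw [h1, ← lintegral_const_mul _ hm, ← lintegral_indicator hΩ.measurableSet]
  refine lintegral_congr fun z => ?_
  by_cases hz : z ∈ Ω
  · rw [indicator_of_mem hz, ← mul_assoc, ← ENNReal.ofReal_mul (by positivity), abs_of_pos hε]
    rfl
  · rw [indicator_of_notMem hz, ← mul_assoc, ← ENNReal.ofReal_mul (by positivity), abs_of_pos hε]
    have := noiseKernel_eq_zero h hconv hε hε1 hx hz
    unfold noiseKernel at this
    rw [← hεdef] at this
    rw [this]; simp

/-- The kernel is a probability density in the arrival point z, not in the starting point x. In x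
the substitution has Jacobian ((1 - ε)/ε)^d, which leaves a total mass of (1 - ε)^(-d) over the
whole space. -/
theorem lintegral_noiseKernel_le {η : E d → ℝ} (h : IsBump Ω η)
    {L t : ℝ} (hε : 0 < noiseScale L t) (hε1 : noiseScale L t ≤ L) (hL1 : L < 1) (z : E d) :
    ∫⁻ x in Ω, ENNReal.ofReal (noiseKernel η L t z x) ≤ ENNReal.ofReal ((1 - L)⁻¹ ^ d) := by
  set ε := noiseScale L t with hεdef
  have h1ε : 0 < 1 - ε := by linarith
  have hr : -(ε⁻¹ * (1 - ε)) ≠ 0 := neg_ne_zero.2 (by positivity)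
  have h1 := lintegral_comp_add_smul h.measurable (ε⁻¹ • z) hr
  rw [h.lintegral_eq_one, mul_one] at h1
  calc ∫⁻ x in Ω, ENNReal.ofReal (noiseKernel η L t z x)
      ≤ ∫⁻ x, ENNReal.ofReal (noiseKernel η L t z x) := setLIntegral_le_lintegral _ _
    _ = ∫⁻ x, ENNReal.ofReal (ε⁻¹ ^ d) *
          ENNReal.ofReal (η (ε⁻¹ • z + (-(ε⁻¹ * (1 - ε))) • x)) := by
        refine lintegral_congr fun x => ?_
        rw [← ENNReal.ofReal_mul (by positivity)]
        unfold noiseKernel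
        rw [← hεdef, smul_sub, smul_smul, neg_smul, sub_eq_add_neg]
    _ = ENNReal.ofReal (ε⁻¹ ^ d) * ENNReal.ofReal (|-(ε⁻¹ * (1 - ε))|⁻¹ ^ d) := by
        have hm : Measurable fun x =>
            ENNReal.ofReal (η (ε⁻¹ • z + (-(ε⁻¹ * (1 - ε))) • x)) :=
          h.measurable.comp (by fun_prop)
        rw [lintegral_const_mul _ hm, h1]
    _ ≤ ENNReal.ofReal ((1 - L)⁻¹ ^ d) := by
        rw [← ENNReal.ofReal_mul (by positivity), ← mul_pow, abs_neg,
          abs_of_pos (by positivity), mul_inv, inv_inv, ← mul_assoc, inv_mul_cancel₀ hε.ne',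
          one_mul]
        have : 0 < 1 - L := by linarith
        gcongr

/-- The measure `dt dx` on the cylinder. -/
abbrev cylMeasure (Ω : Set (E d)) : Measure (ℝ × E d) := volume.restrict (cylinder Ω)

theorem ae_time_mem_Ioo (hΩ : IsCompact Ω) : ∀ᵐ z ∂(cylMeasure Ω), z.1 ∈ Ioo (0 : ℝ) 1 :=
  (ae_mem_Ioo_prod hΩ).mono fun _ hz => hz.1

/-- The joint law of arrival and start has the kernel as its density. Averages over the noise, where
integrability is easy to see, thereby become integrals against the kernel. The end times, where the
kernel degenerates, form a null set. -/
theorem measurePreserving_addNoise {η : E d → ℝ} (h : IsBump Ω η) (hΩ : IsCompact Ω)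
    (hconv : Convex ℝ Ω) {L : ℝ} (hL : 0 < L) (hL1 : L ≤ 1) :
    MeasurePreserving (addNoise L) ((cylMeasure Ω).prod (noise η))
      (((cylMeasure Ω).prod (volume.restrict Ω)).withDensity
        fun p => ENNReal.ofReal (noiseKernel η L p.1.1 p.1.2 p.2)) := by
  have := h.isProbabilityMeasure
  have := isFiniteMeasure_restrict_space hΩ
  have := isFiniteMeasure_restrict_cylinder hΩ
  have hK := (measurable_noiseKernel h L).ennreal_ofReal
  have hFm : ∀ {F : (ℝ × E d) × E d → ℝ≥0∞}, Measurable F →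
      Measurable fun p => F (addNoise L p) := fun hF => hF.comp (continuous_addNoise L).measurable
  refine ⟨(continuous_addNoise L).measurable, Measure.ext_of_lintegral _ fun F hF => ?_⟩
  rw [lintegral_map hF (continuous_addNoise L).measurable,
    lintegral_withDensity_eq_lintegral_mul _ hK hF,
    lintegral_prod _ (hFm hF).aemeasurable,
    lintegral_prod _ (hK.mul hF).aemeasurable]
  have hm1 : Measurable fun z : ℝ × E d => ∫⁻ y, F (addNoise L (z, y)) ∂(noise η) :=
    (hFm hF).lintegral_prod_right'
  have hm2 : Measurable fun z : ℝ × E d => ∫⁻ x in Ω,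
      ((fun p : (ℝ × E d) × E d => ENNReal.ofReal (noiseKernel η L p.1.1 p.1.2 p.2)) * F) (z, x) :=
    (hK.mul hF).lintegral_prod_right'
  change ∫⁻ z, (∫⁻ y, F (addNoise L (z, y)) ∂(noise η)) ∂(cylMeasure Ω) = _
  rw [cylMeasure, restrict_cylinder, lintegral_prod _ hm1.aemeasurable,
    lintegral_prod _ hm2.aemeasurable, ← Measure.restrict_congr_set Ioo_ae_eq_Icc]
  refine setLIntegral_congr_fun measurableSet_Ioo fun t ht => ?_
  have hε := noiseScale_pos hL ht
  have hε1 : noiseScale L t ≤ 1 := (noiseScale_le hL t).trans (by linarith)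
  have hswap := lintegral_lintegral_swap (μ := (volume : Measure (E d)).restrict Ω)
    (ν := (volume : Measure (E d)).restrict Ω)
    (f := fun z x => ENNReal.ofReal (noiseKernel η L t z x) * F ((t, z), x)) ?_
  · refine Eq.trans ?_ hswap.symm
    refine setLIntegral_congr_fun hΩ.measurableSet fun x hx => ?_
    exact lintegral_noise h hΩ hconv hε hε1 hx (F := fun z => F ((t, z), x))
      (hF.comp (by fun_prop))
  · exact ((hK.mul hF).comp (by fun_prop : Measurable fun p : E d × E d =>
      (((t, p.1), p.2) : (ℝ × E d) × E d))).aemeasurable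

end Kernel

/-! ### Regularization of curves -/

section Regularization

variable {d : ℕ} {Ω : Set (E d)}

/-- Weakly continuous curves of densities, given by measurable data. -/
structure IsCurve (Ω : Set (E d)) (μ : ℝ × E d → ℝ) (v : ℝ × E d → E d) (f : ℝ × E d → ℝ) :
    Prop where
  measurable_density : Measurable μ
  nonneg : ∀ z, 0 ≤ μ z
  measurable_velocity : Measurable v
  measurable_source : Measurable f
  integrable_slice : ∀ t ∈ Icc (0 : ℝ) 1, IntegrableOn (fun x => μ (t, x)) Ω
  narrow : ∀ φ : E d → ℝ, ContDiff ℝ 1 φ →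
    ContinuousOn (fun t => ∫ x in Ω, φ x * μ (t, x)) (Icc 0 1)
  continuityEq : SolvesContinuityEq Ω μ v f

theorem ae_prod_time_mem_Ioo (hΩ : IsCompact Ω) {Y : Type*} [MeasurableSpace Y] (ν : Measure Y)
    [SFinite ν] : ∀ᵐ p ∂((cylMeasure Ω).prod ν), p.1.1 ∈ Ioo (0 : ℝ) 1 :=
  Measure.quasiMeasurePreserving_fst.ae (ae_time_mem_Ioo hΩ)

theorem integrable_kernel_smul {F : Type*} [NormedAddCommGroup F] [NormedSpace ℝ F]
    {η : E d → ℝ} (h : IsBump Ω η) (hΩ : IsCompact Ω)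
    (hconv : Convex ℝ Ω) {L : ℝ} (hL : 0 < L) (hL1 : L ≤ 1) {G : (ℝ × E d) × E d → F}
    (hG : StronglyMeasurable G)
    (hi : Integrable (fun p => G (addNoise L p)) ((cylMeasure Ω).prod (noise η))) :
    Integrable (fun p => noiseKernel η L p.1.1 p.1.2 p.2 • G p)
        ((cylMeasure Ω).prod (volume.restrict Ω)) ∧
      ∫ p, G (addNoise L p) ∂((cylMeasure Ω).prod (noise η)) =
        ∫ z, (∫ x in Ω, noiseKernel η L z.1 z.2 x • G (z, x)) ∂(cylMeasure Ω) := by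
  have := isFiniteMeasure_restrict_space hΩ
  have := isFiniteMeasure_restrict_cylinder hΩ
  have hmp := measurePreserving_addNoise h hΩ hconv hL hL1
  have hK := (measurable_noiseKernel h L).ennreal_ofReal
  have hi2 := (hmp.integrable_comp hG.aestronglyMeasurable).1 hi
  have hlt : ∀ᵐ p ∂((cylMeasure Ω).prod (volume.restrict Ω)),
      ENNReal.ofReal (noiseKernel η L p.1.1 p.1.2 p.2) < (⊤ : ℝ≥0∞) := .of_forall fun p =>
    ENNReal.ofReal_lt_top
  -- The sign of the kernel is known only for times in the unit interval, so the truncation at 0 is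
  -- removed almost everywhere.
  have hnn : ∀ᵐ p ∂((cylMeasure Ω).prod (volume.restrict Ω)),
      (ENNReal.ofReal (noiseKernel η L p.1.1 p.1.2 p.2)).toReal • G p =
        noiseKernel η L p.1.1 p.1.2 p.2 • G p := by
    filter_upwards [ae_prod_time_mem_Ioo hΩ (volume.restrict Ω)] with p hp
    rw [ENNReal.toReal_ofReal (noiseKernel_nonneg h (noiseScale_pos hL hp).le _ _)]
  rw [integrable_withDensity_iff_integrable_smul' hK hlt] at hi2
  have hi3 := hi2.congr hnn
  refine ⟨hi3, ?_⟩
  have e1 : ∫ p, G (addNoise L p) ∂((cylMeasure Ω).prod (noise η)) =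
      ∫ p, G p ∂(((cylMeasure Ω).prod (volume.restrict Ω)).withDensity
        fun p => ENNReal.ofReal (noiseKernel η L p.1.1 p.1.2 p.2)) := by
    rw [← hmp.map_eq, integral_map hmp.measurable.aemeasurable hG.aestronglyMeasurable]
  rw [e1, integral_withDensity_eq_integral_toReal_smul hK hlt, integral_congr_ae hnn,
    integral_prod _ hi3]

/-- The velocity of the noisy particles, at time `t` and position `z`, starting from `x`. -/
def noisyVelocity (L : ℝ) (v : ℝ × E d → E d) (p : (ℝ × E d) × E d) : E d :=
  (1 - noiseScale L p.1.1) • v (p.1.1, p.2) +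
    (L * (1 - 2 * p.1.1) * (noiseScale L p.1.1)⁻¹) • (p.1.2 - p.2)

/-- The mean of `g` over the starting points of the particles that arrive at `z`. -/
def smoothed {F : Type*} [NormedAddCommGroup F] [NormedSpace ℝ F] (Ω : Set (E d)) (η : E d → ℝ)
    (L : ℝ) (g : (ℝ × E d) × E d → F) (z : ℝ × E d) : F :=
  ∫ x in Ω, noiseKernel η L z.1 z.2 x • g (z, x)

/-- A function of the starting point, as a function of arrival and start. -/
def atStart {F : Type*} (g : ℝ × E d → F) (p : (ℝ × E d) × E d) : F := g (p.1.1, p.2)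

theorem measurable_atStart {F : Type*} [MeasurableSpace F] {g : ℝ × E d → F} (hg : Measurable g) :
    Measurable (atStart g) :=
  hg.comp (measurable_fst.fst.prodMk measurable_snd)

/-- The regularized density. -/
def smoothDensity (Ω : Set (E d)) (η : E d → ℝ) (L : ℝ) (μ : ℝ × E d → ℝ) (z : ℝ × E d) : ℝ :=
  (Ioo (0 : ℝ) 1 ×ˢ univ).piecewise (smoothed Ω η L (atStart μ)) μ z

/-- The regularized momentum. -/
def smoothFlux (Ω : Set (E d)) (η : E d → ℝ) (L : ℝ) (μ : ℝ × E d → ℝ) (v : ℝ × E d → E d) :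
    ℝ × E d → E d :=
  smoothed Ω η L fun p => atStart μ p • noisyVelocity L v p

/-- The regularized velocity. -/
def smoothVelocity (Ω : Set (E d)) (η : E d → ℝ) (L : ℝ) (μ : ℝ × E d → ℝ) (v : ℝ × E d → E d)
    (z : ℝ × E d) : E d :=
  (smoothed Ω η L (atStart μ) z)⁻¹ • smoothFlux Ω η L μ v z

theorem measurable_noisyVelocity (L : ℝ) {v : ℝ × E d → E d} (hv : Measurable v) :
    Measurable (noisyVelocity L v) := by
  have h1 : Measurable fun p : (ℝ × E d) × E d => noiseScale L p.1.1 :=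
    (continuous_noiseScale L).measurable.comp measurable_fst.fst
  have h2 : Measurable fun p : (ℝ × E d) × E d => L * (1 - 2 * p.1.1) := by fun_prop
  exact ((h1.const_sub 1).smul (measurable_atStart hv)).add
    ((h2.mul h1.inv).smul (measurable_fst.snd.sub measurable_snd))

theorem stronglyMeasurable_smoothed {F : Type*} [NormedAddCommGroup F] [NormedSpace ℝ F]
    {η : E d → ℝ} (h : IsBump Ω η) (hΩ : IsCompact Ω) (L : ℝ) {g : (ℝ × E d) × E d → F}
    (hg : StronglyMeasurable g) : StronglyMeasurable (smoothed Ω η L g) := by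
  have := isFiniteMeasure_restrict_space hΩ
  exact ((measurable_noiseKernel h L).stronglyMeasurable.smul hg).integral_prod_right'

theorem atStart_addNoise {F : Type*} (g : ℝ × E d → F) (L : ℝ) (p : (ℝ × E d) × E d) :
    atStart g (addNoise L p) = g p.1 := rfl

/-- Along the motion z - x = ε (y - x), so the singular factor 1/ε cancels. What remains is the time
derivative of (1 - ε) x + ε y along a particle of velocity v, and its drift is bounded uniformly in
time. -/
theorem noisyVelocity_addNoise {L : ℝ} {v : ℝ × E d → E d} {p : (ℝ × E d) × E d}
    (hε : noiseScale L p.1.1 ≠ 0) : noisyVelocity L v (addNoise L p) =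
      (1 - noiseScale L p.1.1) • v p.1 + (L * (1 - 2 * p.1.1)) • (p.2 - p.1.2) := by
  simp only [noisyVelocity, addNoise]
  congr 1
  have : (1 - noiseScale L p.1.1) • p.1.2 + noiseScale L p.1.1 • p.2 - p.1.2 =
      noiseScale L p.1.1 • (p.2 - p.1.2) := by
    rw [sub_smul, one_smul, smul_sub]; abel
  rw [this, smul_smul, mul_assoc, inv_mul_cancel₀ hε, mul_one]

theorem exists_norm_sub_le (hΩ : IsCompact Ω) :
    ∃ D, 0 ≤ D ∧ ∀ x ∈ Ω, ∀ y ∈ Ω, ‖y - x‖ ≤ D := by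
  obtain ⟨C, hC⟩ := hΩ.isBounded.exists_norm_le
  refine ⟨max (C + C) 0, le_max_right _ _, fun x hx y hy => ?_⟩
  exact ((norm_sub_le _ _).trans (add_le_add (hC y hy) (hC x hx))).trans (le_max_left _ _)

theorem ae_noise_mem {η : E d → ℝ} (h : IsBump Ω η) (hΩ : IsCompact Ω) :
    ∀ᵐ p ∂((cylMeasure Ω).prod (noise η)), p.1 ∈ Ioo (0 : ℝ) 1 ×ˢ Ω ∧ p.2 ∈ Ω := by
  have := h.isProbabilityMeasure
  exact (Measure.quasiMeasurePreserving_fst.ae (ae_mem_Ioo_prod hΩ)).and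
    (Measure.quasiMeasurePreserving_snd.ae h.ae_mem)

theorem norm_drift_le {L t D : ℝ} (hL : 0 < L) (ht : t ∈ Ioo (0 : ℝ) 1) {x y : E d}
    (hD : ‖y - x‖ ≤ D) : ‖(L * (1 - 2 * t)) • (y - x)‖ ≤ L * D := by
  rw [norm_smul, Real.norm_eq_abs, abs_mul, abs_of_pos hL, mul_assoc]
  have h1 : |1 - 2 * t| ≤ 1 := abs_le.2 ⟨by linarith [ht.2], by linarith [ht.1]⟩
  have h0 := norm_nonneg (y - x)
  gcongr
  nlinarith [abs_nonneg (1 - 2 * t)]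

section Curve

variable {η : E d → ℝ} {μ f : ℝ × E d → ℝ} {v : ℝ × E d → E d}

theorem integrable_comp_fst_noise {F : Type*} [NormedAddCommGroup F] (h : IsBump Ω η)
    {g : ℝ × E d → F} (hg : IntegrableOn g (cylinder Ω)) :
    Integrable (fun p : (ℝ × E d) × E d => g p.1) ((cylMeasure Ω).prod (noise η)) := by
  have := h.isProbabilityMeasure
  exact Integrable.comp_fst hg (noise η)

theorem noisyFlux_norm_le {L D : ℝ} (hL : 0 < L) (hL1 : L ≤ 1)
    (hD : ∀ x ∈ Ω, ∀ y ∈ Ω, ‖y - x‖ ≤ D) {p : (ℝ × E d) × E d}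
    (hp : p.1 ∈ Ioo (0 : ℝ) 1 ×ˢ Ω ∧ p.2 ∈ Ω) (hμ : 0 ≤ μ p.1) :
    ‖μ p.1 • noisyVelocity L v (addNoise L p)‖ ≤ ‖μ p.1 • v p.1‖ + L * D * μ p.1 := by
  have hε := noiseScale_pos hL hp.1.1
  have hε1 : noiseScale L p.1.1 ≤ 1 := (noiseScale_le hL _).trans (by linarith)
  rw [noisyVelocity_addNoise hε.ne', smul_add]
  refine (norm_add_le _ _).trans (add_le_add ?_ ?_)
  · rw [smul_comm, norm_smul]
    refine mul_le_of_le_one_left (norm_nonneg _) ?_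
    rw [Real.norm_eq_abs]
    exact abs_le.2 ⟨by linarith, by linarith⟩
  · rw [norm_smul, Real.norm_of_nonneg hμ, mul_comm]
    gcongr
    exact norm_drift_le hL hp.1.1 (hD _ hp.1.2 _ hp.2)

theorem IsCurve.integrable_noisyFlux (hc : IsCurve Ω μ v f) (h : IsBump Ω η) (hΩ : IsCompact Ω)
    {L : ℝ} (hL : 0 < L) (hL1 : L ≤ 1) :
    Integrable (fun p => μ p.1 • noisyVelocity L v (addNoise L p))
      ((cylMeasure Ω).prod (noise η)) := by
  obtain ⟨D, hD0, hD⟩ := exists_norm_sub_le hΩ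
  have h1 := integrable_comp_fst_noise h hc.continuityEq.integrable_flux
  have h2 := integrable_comp_fst_noise h hc.continuityEq.integrable_density
  refine Integrable.mono' (h1.norm.add (h2.const_mul (L * D))) ?_ ?_
  · exact ((hc.measurable_density.comp measurable_fst).smul
      ((measurable_noisyVelocity L hc.measurable_velocity).comp
        (continuous_addNoise L).measurable)).aestronglyMeasurable
  · filter_upwards [ae_noise_mem h hΩ] with p hp
    exact noisyFlux_norm_le hL hL1 hD hp (hc.nonneg _)

theorem smoothDensity_ae_eq (hΩ : IsCompact Ω) (L : ℝ) :
    ∀ᵐ z ∂(cylMeasure Ω), smoothDensity Ω η L μ z = smoothed Ω η L (atStart μ) z := by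
  filter_upwards [ae_time_mem_Ioo hΩ] with z hz
  exact piecewise_eq_of_mem _ _ _ ⟨hz, mem_univ _⟩

/-- Cauchy-Schwarz after splitting |a| into two square roots. With a the kernel times the density it
is Jensen's inequality for the kinetic energy; with a the kernel it controls the source. -/
theorem enorm_integral_smul_sq_le {X F : Type*} [MeasurableSpace X] [NormedAddCommGroup F]
    [NormedSpace ℝ F] {ν : Measure X} {a : X → ℝ} {W : X → F} (ha : AEMeasurable a ν)
    (hW : AEStronglyMeasurable W ν) :
    ‖∫ x, a x • W x ∂ν‖ₑ ^ 2 ≤ (∫⁻ x, ‖a x‖ₑ ∂ν) * ∫⁻ x, ‖a x‖ₑ * ‖W x‖ₑ ^ 2 ∂ν := by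
  have h1 : ‖∫ x, a x • W x ∂ν‖ₑ ≤ ∫⁻ x, ‖a x‖ₑ ^ (1 / 2 : ℝ) * (‖a x‖ₑ ^ (1 / 2 : ℝ) * ‖W x‖ₑ) ∂ν := by
    refine (enorm_integral_le_lintegral_enorm _).trans (lintegral_mono fun x => ?_)
    rw [enorm_smul, ← mul_assoc, ← ENNReal.rpow_add_of_nonneg _ _ (by norm_num) (by norm_num)]
    norm_num
  have h2 := ENNReal.lintegral_mul_le_Lp_mul_Lq ν Real.HolderConjugate.two_two
    (ha.enorm.pow_const (1 / 2 : ℝ)) ((ha.enorm.pow_const (1 / 2 : ℝ)).mul hW.enorm)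
  have h3 := h1.trans h2
  have e1 : ∀ x, (‖a x‖ₑ ^ (1 / 2 : ℝ)) ^ (2 : ℝ) = ‖a x‖ₑ := fun x => by
    rw [← ENNReal.rpow_mul]; norm_num
  simp only [Pi.mul_apply, ENNReal.mul_rpow_of_nonneg _ _ zero_le_two, e1] at h3
  calc ‖∫ x, a x • W x ∂ν‖ₑ ^ 2 ≤ _ := pow_le_pow_left' h3 2
    _ = _ := by
      rw [mul_pow, ← ENNReal.rpow_natCast, ← ENNReal.rpow_natCast, ← ENNReal.rpow_mul,
        ← ENNReal.rpow_mul]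
      norm_num

end Curve

end Regularization

/-! ### Properties of the regularized curve -/

section RegularizedCurve

variable {d : ℕ} {Ω : Set (E d)} {η : E d → ℝ} {μ f : ℝ × E d → ℝ} {v : ℝ × E d → E d} {L : ℝ}

theorem lintegral_kernel_mul (h : IsBump Ω η) (hΩ : IsCompact Ω) (hconv : Convex ℝ Ω)
    (hL : 0 < L) (hL1 : L ≤ 1) {H : (ℝ × E d) × E d → ℝ≥0∞} (hH : Measurable H) :
    ∫⁻ z, (∫⁻ x in Ω, ENNReal.ofReal (noiseKernel η L z.1 z.2 x) * H (z, x)) ∂(cylMeasure Ω) =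
      ∫⁻ p, H (addNoise L p) ∂((cylMeasure Ω).prod (noise η)) := by
  have := isFiniteMeasure_restrict_space hΩ
  have := isFiniteMeasure_restrict_cylinder hΩ
  have hmp := measurePreserving_addNoise h hΩ hconv hL hL1
  have hK := (measurable_noiseKernel h L).ennreal_ofReal
  rw [hmp.lintegral_comp hH, lintegral_withDensity_eq_lintegral_mul _ hK hH,
    lintegral_prod _ (hK.mul hH).aemeasurable]
  rfl

theorem lintegral_comp_fst_noise (h : IsBump Ω η) {H : ℝ × E d → ℝ≥0∞} (hH : Measurable H) :
    ∫⁻ p, H p.1 ∂((cylMeasure Ω).prod (noise η)) = ∫⁻ z, H z ∂(cylMeasure Ω) := by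
  have := h.isProbabilityMeasure
  have hm : Measurable fun p : (ℝ × E d) × E d => H p.1 := hH.comp measurable_fst
  rw [lintegral_prod _ hm.aemeasurable]
  simp

/-! #### The continuity equation -/

/-- The position at time `z.1` of the noisy particle that starts at `z.2`, with its time. -/
def noisyPoint (L : ℝ) (y : E d) (z : ℝ × E d) : ℝ × E d := (addNoise L (z, y)).1

theorem hasFDerivAt_noisyPoint (L : ℝ) (y : E d) (z : ℝ × E d) :
    ∃ A : ℝ × E d →L[ℝ] ℝ × E d, HasFDerivAt (noisyPoint L y) A z ∧
      A (1, 0) = (1, (L * (1 - 2 * z.1)) • (y - z.2)) ∧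
      ∀ w, A (0, w) = (0, (1 - noiseScale L z.1) • w) := by
  have h1 : HasFDerivAt (fun z : ℝ × E d => noiseScale L z.1)
      ((L * (1 - 2 * z.1)) • ContinuousLinearMap.fst ℝ ℝ (E d)) z :=
    (hasDerivAt_noiseScale L z.1).comp_hasFDerivAt z hasFDerivAt_fst
  have h2 := (h1.const_sub 1).smul (hasFDerivAt_snd (𝕜 := ℝ) (p := z))
  have h3 := h1.smul_const y
  refine ⟨_, hasFDerivAt_fst.prodMk (h2.add h3), ?_, fun w => ?_⟩
  · simp [sub_eq_neg_add]
  · simp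

theorem contDiff_noisyPoint (L : ℝ) (y : E d) : ContDiff ℝ 1 (noisyPoint L y) := by
  have h : ContDiff ℝ 1 fun z : ℝ × E d => noiseScale L z.1 := by
    unfold noiseScale; fun_prop
  unfold noisyPoint addNoise
  exact contDiff_fst.prodMk (((contDiff_const.sub h).smul contDiff_snd).add (h.smul contDiff_const))

/-- The integrand of the weak equation, as a function of arrival and start. -/
def noisyIntegrand (L : ℝ) (μ : ℝ × E d → ℝ) (v : ℝ × E d → E d) (f φ : ℝ × E d → ℝ)
    (p : (ℝ × E d) × E d) : ℝ :=
  timeDeriv φ p.1 * atStart μ p + inner ℝ (spaceGrad φ p.1) (atStart μ p • noisyVelocity L v p) +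
    φ p.1 * atStart f p

/-- Chain rule for frozen noise y: the drift comes from the time derivative of the motion and the
factor 1 - ε from its spatial derivative. Together they form the velocity of the noisy particle. -/
theorem weakIntegrand_comp_noisyPoint {φ : ℝ × E d → ℝ} (hφ : ContDiff ℝ 1 φ) (y : E d)
    {z : ℝ × E d} (hε : noiseScale L z.1 ≠ 0) :
    weakIntegrand μ (fun z => μ z • v z) f (fun z => φ (noisyPoint L y z)) z =
      noisyIntegrand L μ v f φ (addNoise L (z, y)) := by
  obtain ⟨A, hA, hA1, hA2⟩ := hasFDerivAt_noisyPoint L y z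
  have hc : HasFDerivAt (fun z => φ (noisyPoint L y z))
      ((fderiv ℝ φ (noisyPoint L y z)).comp A) z :=
    HasFDerivAt.comp (x := z) (f := noisyPoint L y) (g := φ)
      (hφ.differentiable one_ne_zero _).hasFDerivAt hA
  rw [weakIntegrand, timeDeriv_eq_of_hasFDerivAt hc, inner_spaceGrad_of_hasFDerivAt hc,
    noisyIntegrand, noisyVelocity_addNoise hε, inner_smul_right, inner_add_right,
    timeDeriv_eq hφ, inner_spaceGrad hφ, inner_spaceGrad hφ]
  simp only [ContinuousLinearMap.comp_apply, hA1, hA2, atStart_addNoise]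
  change _ = fderiv ℝ φ (noisyPoint L y z) (1, 0) * μ z + μ z * (fderiv ℝ φ (noisyPoint L y z)
    (0, (1 - noiseScale L z.1) • v z) + fderiv ℝ φ (noisyPoint L y z)
    (0, (L * (1 - 2 * z.1)) • (y - z.2))) + φ (noisyPoint L y z) * f z
  have e1 : ((1 : ℝ), (L * (1 - 2 * z.1)) • (y - z.2)) =
      (1, 0) + (0, (L * (1 - 2 * z.1)) • (y - z.2)) := by simp
  have e2 : ((0 : ℝ), (1 - noiseScale L z.1) • μ z • v z) =
      μ z • (0, (1 - noiseScale L z.1) • v z) := by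
    rw [Prod.smul_mk, smul_zero, smul_comm]
  rw [e1, e2, map_add, map_smul, smul_eq_mul]
  ring

theorem noisyPoint_mem (hconv : Convex ℝ Ω) (hL : 0 < L) (hL1 : L ≤ 1) {p : (ℝ × E d) × E d}
    (hp : p.1 ∈ Ioo (0 : ℝ) 1 ×ˢ Ω ∧ p.2 ∈ Ω) : (addNoise L p).1 ∈ cylinder Ω := by
  refine ⟨Ioo_subset_Icc_self hp.1.1, hconv hp.1.2 hp.2 ?_ ?_ (by ring)⟩
  · linarith [noiseScale_le hL p.1.1]
  · exact (noiseScale_pos hL hp.1.1).le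

theorem measurable_noisyIntegrand (hc : IsCurve Ω μ v f) {φ : ℝ × E d → ℝ}
    (hφ : ContDiff ℝ 1 φ) : Measurable (noisyIntegrand L μ v f φ) := by
  have hm := measurable_atStart hc.measurable_density
  exact (((continuous_timeDeriv hφ).measurable.comp measurable_fst).mul hm).add
    (((continuous_spaceGrad hφ).measurable.comp measurable_fst).inner
      (hm.smul (measurable_noisyVelocity L hc.measurable_velocity))) |>.add
    ((hφ.continuous.measurable.comp measurable_fst).mul (measurable_atStart hc.measurable_source))

theorem integrable_noisyIntegrand (hc : IsCurve Ω μ v f) (h : IsBump Ω η) (hΩ : IsCompact Ω)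
    (hconv : Convex ℝ Ω) (hL : 0 < L) (hL1 : L ≤ 1) {φ : ℝ × E d → ℝ} (hφ : ContDiff ℝ 1 φ) :
    Integrable (fun p => noisyIntegrand L μ v f φ (addNoise L p))
      ((cylMeasure Ω).prod (noise η)) := by
  obtain ⟨C₁, h₁, hC₁⟩ := exists_bound_of_continuous hΩ (continuous_timeDeriv hφ)
  obtain ⟨C₂, h₂, hC₂⟩ := exists_bound_of_continuous hΩ (continuous_spaceGrad hφ)
  obtain ⟨C₃, h₃, hC₃⟩ := exists_bound_of_continuous hΩ hφ.continuous
  have i1 := integrable_comp_fst_noise h hc.continuityEq.integrable_density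
  have i2 := hc.integrable_noisyFlux h hΩ hL hL1
  have i3 := integrable_comp_fst_noise h hc.continuityEq.integrable_source
  refine Integrable.mono' (((i1.norm.const_mul C₁).add (i2.norm.const_mul C₂)).add
    (i3.norm.const_mul C₃))
    ((measurable_noisyIntegrand hc hφ).comp (continuous_addNoise L).measurable).aestronglyMeasurable
    ?_
  filter_upwards [ae_noise_mem h hΩ] with p hp
  have hmem := noisyPoint_mem hconv hL hL1 hp
  refine (norm_add_le _ _).trans (add_le_add ((norm_add_le _ _).trans (add_le_add ?_ ?_)) ?_)
  · rw [norm_mul]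
    exact mul_le_mul_of_nonneg_right (hC₁ _ hmem) (norm_nonneg _)
  · refine (norm_inner_le_norm _ _).trans ?_
    exact mul_le_mul_of_nonneg_right (hC₂ _ hmem) (norm_nonneg _)
  · rw [norm_mul]
    exact mul_le_mul_of_nonneg_right (hC₃ _ hmem) (norm_nonneg _)

theorem noisyPoint_of_noiseScale_eq_zero {t : ℝ} (ht : noiseScale L t = 0) (x y : E d) :
    noisyPoint L y (t, x) = (t, x) := by
  simp [noisyPoint, addNoise, ht]

/-- For each y the pulled back test function is C¹ and agrees with φ at the end times, where the
noise has size 0. The weak equation gives the same value for every y, and the noise has total mass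
1. -/
theorem integral_noisyIntegrand (hc : IsCurve Ω μ v f) (h : IsBump Ω η) (hΩ : IsCompact Ω)
    (hconv : Convex ℝ Ω) (hL : 0 < L) (hL1 : L ≤ 1) {φ : ℝ × E d → ℝ} (hφ : ContDiff ℝ 1 φ) :
    ∫ p, noisyIntegrand L μ v f φ (addNoise L p) ∂((cylMeasure Ω).prod (noise η)) =
      (∫ x in Ω, φ (1, x) * μ (1, x)) - ∫ x in Ω, φ (0, x) * μ (0, x) := by
  have := h.isProbabilityMeasure
  have := isFiniteMeasure_restrict_cylinder hΩ
  rw [integral_prod_symm _ (integrable_noisyIntegrand hc h hΩ hconv hL hL1 hφ)]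
  have hy : ∀ y, ∫ z, noisyIntegrand L μ v f φ (addNoise L (z, y)) ∂(cylMeasure Ω) =
      (∫ x in Ω, φ (1, x) * μ (1, x)) - ∫ x in Ω, φ (0, x) * μ (0, x) := by
    intro y
    have hw := hc.continuityEq.weak_eq (fun z => φ (noisyPoint L y z))
      (hφ.comp (contDiff_noisyPoint L y))
    have h0 : noiseScale L 0 = 0 := by simp [noiseScale]
    have h1 : noiseScale L 1 = 0 := by simp [noiseScale]
    simp only [noisyPoint_of_noiseScale_eq_zero h0, noisyPoint_of_noiseScale_eq_zero h1] at hw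
    rw [hw]
    refine integral_congr_ae ?_
    filter_upwards [ae_time_mem_Ioo hΩ] with z hz
    exact (weakIntegrand_comp_noisyPoint hφ y (noiseScale_pos hL hz).ne').symm
  simp_rw [hy]
  simp

theorem IsCurve.integrable_kernel_density (hc : IsCurve Ω μ v f) (h : IsBump Ω η)
    (hΩ : IsCompact Ω) (hconv : Convex ℝ Ω) (hL : 0 < L) (hL1 : L ≤ 1) :
    Integrable (fun p => noiseKernel η L p.1.1 p.1.2 p.2 • atStart μ p)
        ((cylMeasure Ω).prod (volume.restrict Ω)) :=
  (integrable_kernel_smul h hΩ hconv hL hL1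
    (measurable_atStart hc.measurable_density).stronglyMeasurable
    (integrable_comp_fst_noise h hc.continuityEq.integrable_density)).1

theorem IsCurve.integrable_kernel_source (hc : IsCurve Ω μ v f) (h : IsBump Ω η)
    (hΩ : IsCompact Ω) (hconv : Convex ℝ Ω) (hL : 0 < L) (hL1 : L ≤ 1) :
    Integrable (fun p => noiseKernel η L p.1.1 p.1.2 p.2 • atStart f p)
        ((cylMeasure Ω).prod (volume.restrict Ω)) :=
  (integrable_kernel_smul h hΩ hconv hL hL1
    (measurable_atStart hc.measurable_source).stronglyMeasurable
    (integrable_comp_fst_noise h hc.continuityEq.integrable_source)).1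

theorem IsCurve.integrable_kernel_flux (hc : IsCurve Ω μ v f) (h : IsBump Ω η)
    (hΩ : IsCompact Ω) (hconv : Convex ℝ Ω) (hL : 0 < L) (hL1 : L ≤ 1) :
    Integrable (fun p => noiseKernel η L p.1.1 p.1.2 p.2 • (atStart μ p • noisyVelocity L v p))
        ((cylMeasure Ω).prod (volume.restrict Ω)) :=
  (integrable_kernel_smul h hΩ hconv hL hL1
    ((measurable_atStart hc.measurable_density).smul
      (measurable_noisyVelocity L hc.measurable_velocity)).stronglyMeasurable
    (hc.integrable_noisyFlux h hΩ hL hL1)).1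

theorem kernel_mul_density_nonneg (hc : IsCurve Ω μ v f) (h : IsBump Ω η) (hL : 0 < L)
    {z : ℝ × E d} (hz : z.1 ∈ Icc (0 : ℝ) 1) (x : E d) :
    0 ≤ noiseKernel η L z.1 z.2 x • atStart μ (z, x) :=
  mul_nonneg (noiseKernel_nonneg h (noiseScale_nonneg hL hz) _ _) (hc.nonneg _)

theorem smoothed_density_nonneg (hc : IsCurve Ω μ v f) (h : IsBump Ω η) (hL : 0 < L)
    {z : ℝ × E d} (hz : z.1 ∈ Icc (0 : ℝ) 1) : 0 ≤ smoothed Ω η L (atStart μ) z :=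
  integral_nonneg fun x => kernel_mul_density_nonneg hc h hL hz x

/-- A nonnegative integrand with zero integral vanishes almost everywhere, and the integrand of the
flux is a multiple of it. This allows the flux to be written as density times velocity. -/
theorem smoothFlux_eq_zero (hc : IsCurve Ω μ v f) (h : IsBump Ω η) (hL : 0 < L)
    {z : ℝ × E d} (hz : z.1 ∈ Icc (0 : ℝ) 1)
    (hi : IntegrableOn (fun x => noiseKernel η L z.1 z.2 x • atStart μ (z, x)) Ω)
    (h0 : smoothed Ω η L (atStart μ) z = 0) : smoothFlux Ω η L μ v z = 0 := by
  have h1 := (integral_eq_zero_iff_of_nonneg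
    (fun x => kernel_mul_density_nonneg hc h hL hz x) hi).1 h0
  refine integral_eq_zero_of_ae ?_
  filter_upwards [h1] with x hx
  rw [← smul_assoc, hx]
  simp

theorem smoothDensity_smul_smoothVelocity (hc : IsCurve Ω μ v f) (h : IsBump Ω η)
    (hΩ : IsCompact Ω) (hconv : Convex ℝ Ω) (hL : 0 < L) (hL1 : L ≤ 1) :
    ∀ᵐ z ∂(cylMeasure Ω), smoothDensity Ω η L μ z • smoothVelocity Ω η L μ v z =
      smoothFlux Ω η L μ v z := by
  have := isFiniteMeasure_restrict_space hΩ
  filter_upwards [smoothDensity_ae_eq hΩ L, ae_time_mem_Ioo hΩ,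
    (hc.integrable_kernel_density h hΩ hconv hL hL1).prod_right_ae] with z h1 h2 h3
  rw [h1, smoothVelocity]
  by_cases h0 : smoothed Ω η L (atStart μ) z = 0
  · rw [h0, zero_smul, smoothFlux_eq_zero hc h hL (Ioo_subset_Icc_self h2) h3 h0]
  · rw [smul_smul, mul_inv_cancel₀ h0, one_smul]

theorem smoothDensity_zero (x : E d) : smoothDensity Ω η L μ (0, x) = μ (0, x) :=
  piecewise_eq_of_notMem _ _ _ (by simp)

theorem smoothDensity_one (x : E d) : smoothDensity Ω η L μ (1, x) = μ (1, x) :=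
  piecewise_eq_of_notMem _ _ _ (by simp)

/-- The noise-averaged weak equation, regrouped by arrival point. The factors that contain φ depend
on the arrival only, so the integral over the start acts on density, flux and source separately. -/
theorem IsCurve.solvesContinuityEq_smooth (hc : IsCurve Ω μ v f) (h : IsBump Ω η)
    (hΩ : IsCompact Ω) (hconv : Convex ℝ Ω) (hL : 0 < L) (hL1 : L ≤ 1) :
    SolvesContinuityEq Ω (smoothDensity Ω η L μ) (smoothVelocity Ω η L μ v)
      (smoothed Ω η L (atStart f)) := by
  have := isFiniteMeasure_restrict_space hΩ
  have := isFiniteMeasure_restrict_cylinder hΩ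
  have k1 := hc.integrable_kernel_density h hΩ hconv hL hL1
  have k2 := hc.integrable_kernel_flux h hΩ hconv hL hL1
  have k3 := hc.integrable_kernel_source h hΩ hconv hL hL1
  have hflux := smoothDensity_smul_smoothVelocity hc h hΩ hconv hL hL1
  have hdens := smoothDensity_ae_eq (μ := μ) (η := η) hΩ L
  refine ⟨?_, ?_, ?_, ?_, ?_, fun φ hφ => ?_⟩
  · exact k1.integral_prod_left.congr (hdens.mono fun z hz => hz.symm)
  · simpa only [smoothDensity_zero] using hc.continuityEq.integrable_initial
  · simpa only [smoothDensity_one] using hc.continuityEq.integrable_terminal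
  · exact k2.integral_prod_left.congr (hflux.mono fun z hz => hz.symm)
  · exact k3.integral_prod_left
  · simp only [smoothDensity_zero, smoothDensity_one]
    rw [← integral_noisyIntegrand hc h hΩ hconv hL hL1 hφ,
      (integrable_kernel_smul h hΩ hconv hL hL1
        (measurable_noisyIntegrand hc hφ).stronglyMeasurable
        (integrable_noisyIntegrand hc h hΩ hconv hL hL1 hφ)).2]
    refine integral_congr_ae ?_
    filter_upwards [hdens, hflux, k1.prod_right_ae, k2.prod_right_ae, k3.prod_right_ae]
      with z e1 e2 j1 j2 j3
    rw [e2, e1]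
    have e : ∀ x, noiseKernel η L z.1 z.2 x • noisyIntegrand L μ v f φ (z, x) =
        timeDeriv φ z * (noiseKernel η L z.1 z.2 x • atStart μ (z, x)) +
        inner ℝ (spaceGrad φ z)
          (noiseKernel η L z.1 z.2 x • (atStart μ (z, x) • noisyVelocity L v (z, x))) +
        φ z * (noiseKernel η L z.1 z.2 x • atStart f (z, x)) := by
      intro x
      simp only [noisyIntegrand, smul_eq_mul, inner_smul_right]
      ring
    simp_rw [e]
    have j12 : Integrable (fun x => timeDeriv φ z *
        (noiseKernel η L z.1 z.2 x • atStart μ (z, x)) + inner ℝ (spaceGrad φ z)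
        (noiseKernel η L z.1 z.2 x • (atStart μ (z, x) • noisyVelocity L v (z, x))))
        (volume.restrict Ω) := (j1.const_mul _).add (j2.const_inner _)
    rw [integral_add j12 (j3.const_mul _), integral_add (j1.const_mul _) (j2.const_inner _),
      integral_const_mul, integral_const_mul, integral_inner j2]
    rfl

/-! #### The action -/

/-- Averaging over the starts does not increase kinetic energy, by Cauchy-Schwarz, so it suffices to
bound the speed of the individual particles, which is at most ‖v‖ + L D. -/
theorem lintegral_kinetic_smooth_le (hc : IsCurve Ω μ v f) (h : IsBump Ω η)
    (hΩ : IsCompact Ω) (hconv : Convex ℝ Ω) (hL : 0 < L) (hL1 : L ≤ 1) {D : ℝ}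
    (hD : ∀ x ∈ Ω, ∀ y ∈ Ω, ‖y - x‖ ≤ D) :
    ∫⁻ z in cylinder Ω, ENNReal.ofReal (‖smoothVelocity Ω η L μ v z‖ ^ 2 *
        smoothDensity Ω η L μ z) ≤
      ENNReal.ofReal (1 + L) * (∫⁻ z in cylinder Ω, ENNReal.ofReal (‖v z‖ ^ 2 * μ z)) +
        ENNReal.ofReal ((1 + L) * L * D ^ 2) * ∫⁻ z in cylinder Ω, ENNReal.ofReal (μ z) := by
  have := isFiniteMeasure_restrict_space hΩ
  have := isFiniteMeasure_restrict_cylinder hΩ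
  have hWm := measurable_noisyVelocity L hc.measurable_velocity
  have hμm := measurable_atStart hc.measurable_density
  have hHm : Measurable fun p => ‖atStart μ p‖ₑ * ‖noisyVelocity L v p‖ₑ ^ 2 :=
    hμm.enorm.mul (hWm.enorm.pow_const 2)
  calc ∫⁻ z in cylinder Ω, ENNReal.ofReal (‖smoothVelocity Ω η L μ v z‖ ^ 2 *
        smoothDensity Ω η L μ z)
      ≤ ∫⁻ z, (∫⁻ x in Ω, ENNReal.ofReal (noiseKernel η L z.1 z.2 x) *
          (‖atStart μ (z, x)‖ₑ * ‖noisyVelocity L v (z, x)‖ₑ ^ 2)) ∂(cylMeasure Ω) := by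
        refine lintegral_mono_ae ?_
        filter_upwards [smoothDensity_ae_eq (μ := μ) (η := η) hΩ L, ae_time_mem_Ioo hΩ,
          (hc.integrable_kernel_density h hΩ hconv hL hL1).prod_right_ae] with z h1 h2 h3
        rw [h1, smoothVelocity]
        set s := smoothed Ω η L (atStart μ) z with hs
        have hzI := Ioo_subset_Icc_self h2
        have hs0 : 0 ≤ s := smoothed_density_nonneg hc h hL hzI
        rcases hs0.eq_or_lt with h0 | h0
        · rw [← h0]; simp
        have hsl : ∫⁻ x in Ω, ‖noiseKernel η L z.1 z.2 x • atStart μ (z, x)‖ₑ =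
            ENNReal.ofReal s := by
          rw [hs, smoothed, ofReal_integral_eq_lintegral_ofReal h3
            (.of_forall fun x => kernel_mul_density_nonneg hc h hL hzI x)]
          refine lintegral_congr fun x => ?_
          rw [Real.enorm_of_nonneg (kernel_mul_density_nonneg hc h hL hzI x)]
        have hcs := enorm_integral_smul_sq_le (ν := volume.restrict Ω) h3.aestronglyMeasurable.aemeasurable
          (hWm.comp measurable_prodMk_left : Measurable fun x => noisyVelocity L v
            (z, x)).aestronglyMeasurable
        simp only [Function.comp_apply] at hcs
        rw [hsl] at hcs
        have hfl : smoothFlux Ω η L μ v z = ∫ x in Ω,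
            (noiseKernel η L z.1 z.2 x • atStart μ (z, x)) • noisyVelocity L v (z, x) := by
          simp only [smoothFlux, smoothed, smul_assoc]
        rw [← hfl] at hcs
        have e1 : ‖s⁻¹ • smoothFlux Ω η L μ v z‖ ^ 2 * s =
            s⁻¹ * ‖smoothFlux Ω η L μ v z‖ ^ 2 := by
          rw [norm_smul, mul_pow, Real.norm_eq_abs, sq_abs]
          field_simp
        have e2 : ∀ x, ENNReal.ofReal (noiseKernel η L z.1 z.2 x) *
            (‖atStart μ (z, x)‖ₑ * ‖noisyVelocity L v (z, x)‖ₑ ^ 2) =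
            ‖noiseKernel η L z.1 z.2 x • atStart μ (z, x)‖ₑ *
              ‖noisyVelocity L v (z, x)‖ₑ ^ 2 := by
          intro x
          rw [enorm_smul, Real.enorm_of_nonneg
            (noiseKernel_nonneg h (noiseScale_nonneg hL hzI) _ _), mul_assoc]
        simp_rw [e2]
        rw [e1, ENNReal.ofReal_mul (inv_nonneg.2 hs0), ENNReal.ofReal_inv_of_pos h0,
          ENNReal.ofReal_pow (norm_nonneg _), ofReal_norm, mul_comm, ← div_eq_mul_inv]
        exact ENNReal.div_le_of_le_mul' hcs
    _ = ∫⁻ p, ‖μ p.1‖ₑ * ‖noisyVelocity L v (addNoise L p)‖ₑ ^ 2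
          ∂((cylMeasure Ω).prod (noise η)) := lintegral_kernel_mul h hΩ hconv hL hL1 hHm
    _ ≤ ∫⁻ p, (ENNReal.ofReal (1 + L) * ENNReal.ofReal (‖v p.1‖ ^ 2 * μ p.1) +
          ENNReal.ofReal ((1 + L) * L * D ^ 2) * ENNReal.ofReal (μ p.1))
          ∂((cylMeasure Ω).prod (noise η)) := by
        refine lintegral_mono_ae ?_
        filter_upwards [ae_noise_mem h hΩ] with p hp
        have hμ := hc.nonneg p.1
        have hε := noiseScale_pos hL hp.1.1
        have hε1 : noiseScale L p.1.1 ≤ 1 := (noiseScale_le hL _).trans (by linarith)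
        rw [Real.enorm_of_nonneg hμ, ← ofReal_norm,
          ← ENNReal.ofReal_pow (norm_nonneg _), ← ENNReal.ofReal_mul hμ,
          ← ENNReal.ofReal_mul (by positivity), ← ENNReal.ofReal_mul (by positivity),
          ← ENNReal.ofReal_add (by positivity) (by positivity)]
        refine ENNReal.ofReal_le_ofReal ?_
        have hn : ‖noisyVelocity L v (addNoise L p)‖ ≤ ‖v p.1‖ + L * D := by
          rw [noisyVelocity_addNoise hε.ne']
          refine (norm_add_le _ _).trans (add_le_add ?_
            (norm_drift_le hL hp.1.1 (hD _ hp.1.2 _ hp.2)))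
          rw [norm_smul]
          refine mul_le_of_le_one_left (norm_nonneg _) ?_
          rw [Real.norm_eq_abs]
          exact abs_le.2 ⟨by linarith, by linarith⟩
        -- The right side minus (‖v‖ + L D)² is L (‖v‖ - D)². The weights are chosen so that the
        -- second term vanishes as L tends to 0.
        have hn2 : ‖noisyVelocity L v (addNoise L p)‖ ^ 2 ≤
            (1 + L) * ‖v p.1‖ ^ 2 + (1 + L) * L * D ^ 2 := by
          calc ‖noisyVelocity L v (addNoise L p)‖ ^ 2 ≤ (‖v p.1‖ + L * D) ^ 2 := by gcongr
            _ ≤ _ := by nlinarith [mul_nonneg hL.le (sq_nonneg (‖v p.1‖ - D))]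
        calc μ p.1 * ‖noisyVelocity L v (addNoise L p)‖ ^ 2
            ≤ μ p.1 * ((1 + L) * ‖v p.1‖ ^ 2 + (1 + L) * L * D ^ 2) := by gcongr
          _ = _ := by ring
    _ = _ := by
        have m1 : Measurable fun z => ENNReal.ofReal (1 + L) * ENNReal.ofReal (‖v z‖ ^ 2 * μ z) :=
          ((hc.measurable_velocity.norm.pow_const 2).mul
            hc.measurable_density).ennreal_ofReal.const_mul _
        have m2 : Measurable fun z => ENNReal.ofReal ((1 + L) * L * D ^ 2) *
            ENNReal.ofReal (μ z) := hc.measurable_density.ennreal_ofReal.const_mul _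
        rw [lintegral_comp_fst_noise (H := fun z => ENNReal.ofReal (1 + L) *
          ENNReal.ofReal (‖v z‖ ^ 2 * μ z) + ENNReal.ofReal ((1 + L) * L * D ^ 2) *
          ENNReal.ofReal (μ z)) h (m1.add m2), lintegral_add_left m1,
          lintegral_const_mul' _ _ ENNReal.ofReal_ne_top,
          lintegral_const_mul' _ _ ENNReal.ofReal_ne_top]

/-- Cauchy-Schwarz leaves the mass of the kernel in the starting point as a factor. It need not be
1, whence the constant and the condition L < 1. -/
theorem lintegral_source_smooth_le (hc : IsCurve Ω μ v f) (h : IsBump Ω η)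
    (hΩ : IsCompact Ω) (hconv : Convex ℝ Ω) (hL : 0 < L) (hL1 : L < 1) :
    ∫⁻ z in cylinder Ω, ENNReal.ofReal (|smoothed Ω η L (atStart f) z| ^ 2) ≤
      ENNReal.ofReal ((1 - L)⁻¹ ^ d) * ∫⁻ z in cylinder Ω, ENNReal.ofReal (|f z| ^ 2) := by
  have := isFiniteMeasure_restrict_space hΩ
  have hfm := measurable_atStart hc.measurable_source
  have e : ∀ a : ℝ, ENNReal.ofReal (|a| ^ 2) = ‖a‖ₑ ^ 2 := fun a => by
    rw [ENNReal.ofReal_pow (abs_nonneg a), ← Real.norm_eq_abs, ofReal_norm]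
  simp_rw [e]
  calc ∫⁻ z in cylinder Ω, ‖smoothed Ω η L (atStart f) z‖ₑ ^ 2
      ≤ ∫⁻ z, (ENNReal.ofReal ((1 - L)⁻¹ ^ d) * ∫⁻ x in Ω,
          ENNReal.ofReal (noiseKernel η L z.1 z.2 x) * ‖atStart f (z, x)‖ₑ ^ 2)
            ∂(cylMeasure Ω) := by
        refine lintegral_mono_ae ?_
        filter_upwards [ae_time_mem_Ioo hΩ] with z hz
        have hε := noiseScale_pos hL hz
        have hk : ∀ x, ‖noiseKernel η L z.1 z.2 x‖ₑ =
            ENNReal.ofReal (noiseKernel η L z.1 z.2 x) := fun x =>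
          Real.enorm_of_nonneg (noiseKernel_nonneg h hε.le _ _)
        have hcs := enorm_integral_smul_sq_le (ν := volume.restrict Ω)
          ((measurable_noiseKernel h L).comp
            (measurable_prodMk_left (x := z))).aemeasurable
          (hfm.comp measurable_prodMk_left : Measurable fun x => atStart f
            (z, x)).aestronglyMeasurable
        simp only [Function.comp_apply, hk] at hcs
        refine hcs.trans ?_
        gcongr
        exact lintegral_noiseKernel_le h hε ((noiseScale_le hL _).trans (by linarith)) hL1 _
    _ = _ := by
        rw [lintegral_const_mul' _ _ ENNReal.ofReal_ne_top,
          lintegral_kernel_mul h hΩ hconv hL hL1.le (hfm.enorm.pow_const 2)]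
        simp only [atStart_addNoise]
        rw [lintegral_comp_fst_noise (H := fun z => ‖f z‖ₑ ^ 2) h
          (hc.measurable_source.enorm.pow_const 2)]

end RegularizedCurve

/-! ### Relaxation: weakly continuous curves bound the distance -/

section Relaxation

open Filter Topology

variable {d : ℕ} {Ω : Set (E d)} {η : E d → ℝ} {μ f : ℝ × E d → ℝ} {v : ℝ × E d → E d} {L : ℝ}

theorem contDiff_noiseKernel (h : IsBump Ω η) (L t : ℝ) (z : E d) :
    ContDiff ℝ 1 (noiseKernel η L t z) := by
  unfold noiseKernel
  exact contDiff_const.mul (h.contDiff.comp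
    ((contDiff_const.sub (contDiff_id.const_smul _)).const_smul _))

theorem continuousAt_noiseKernel (h : IsBump Ω η) (hL : 0 < L) {p : (ℝ × E d) × E d}
    (hp : p.1.1 ∈ Ioo (0 : ℝ) 1) :
    ContinuousAt (fun p : (ℝ × E d) × E d => noiseKernel η L p.1.1 p.1.2 p.2) p := by
  have h1 : ContinuousAt (fun p : (ℝ × E d) × E d => noiseScale L p.1.1) p :=
    ((continuous_noiseScale L).comp continuous_fst.fst).continuousAt
  have h2 : ContinuousAt (fun p : (ℝ × E d) × E d => (noiseScale L p.1.1)⁻¹) p :=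
    h1.inv₀ (noiseScale_pos hL hp).ne'
  unfold noiseKernel
  refine (h2.pow d).mul (ContinuousAt.comp (g := η) h.contDiff.continuous.continuousAt
    (h2.smul (continuous_fst.snd.continuousAt.sub
      ((continuousAt_const.sub h1).smul continuous_snd.continuousAt))))

theorem IsCurve.continuousOn_narrow (hc : IsCurve Ω μ v f) {φ : E d → ℝ} (hφ : ContDiff ℝ 1 φ)
    {t : ℝ} (ht : t ∈ Ioo (0 : ℝ) 1) : ContinuousAt (fun t => ∫ x in Ω, φ x * μ (t, x)) t :=
  (hc.narrow φ hφ).continuousAt (Icc_mem_nhds ht.1 ht.2)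

theorem integrableOn_mul_slice (hΩ : IsCompact Ω) {ρ φ : E d → ℝ} (hρ : IntegrableOn ρ Ω)
    (hφ : Continuous φ) : IntegrableOn (fun x => φ x * ρ x) Ω :=
  IntegrableOn.continuousOn_mul hφ.continuousOn hρ hΩ

/-- Two effects are separated. The kernel varies uniformly on the compact set Ω and is integrated
against a locally bounded mass; with the kernel frozen, it is a C¹ test function, and the weak
continuity of the curve applies. -/
theorem IsCurve.continuousAt_smoothed (hc : IsCurve Ω μ v f) (h : IsBump Ω η) (hΩ : IsCompact Ω)
    (hL : 0 < L) {z₀ : ℝ × E d} (hz₀ : z₀.1 ∈ Ioo (0 : ℝ) 1) :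
    ContinuousAt (smoothed Ω η L (atStart μ)) z₀ := by
  rw [Metric.continuousAt_iff']
  intro e he
  have hM : ContinuousAt (fun z : ℝ × E d => ∫ x in Ω, (1 : ℝ) * μ (z.1, x)) z₀ :=
    ContinuousAt.comp (f := Prod.fst) (g := fun t => ∫ x in Ω, (1 : ℝ) * μ (t, x))
      (hc.continuousOn_narrow (φ := fun _ => 1) contDiff_const hz₀) continuous_fst.continuousAt
  have hN : ContinuousAt (fun z : ℝ × E d =>
      ∫ x in Ω, noiseKernel η L z₀.1 z₀.2 x * μ (z.1, x)) z₀ :=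
    ContinuousAt.comp (f := Prod.fst)
      (g := fun t => ∫ x in Ω, noiseKernel η L z₀.1 z₀.2 x * μ (t, x))
      (hc.continuousOn_narrow (contDiff_noiseKernel h L z₀.1 z₀.2) hz₀) continuous_fst.continuousAt
  set M₀ := ∫ x in Ω, (1 : ℝ) * μ (z₀.1, x) with hM₀
  have hM₀0 : 0 ≤ M₀ := integral_nonneg fun x => by simpa using hc.nonneg _
  -- Near z₀ the mass is below M₀ + 1, so a variation of the kernel by this amount contributes at
  -- most e/2.
  have hδ : 0 < e / (2 * (M₀ + 1)) := by positivity
  have hk : ∀ᶠ z in 𝓝 z₀, ∀ x ∈ Ω, |noiseKernel η L z.1 z.2 x - noiseKernel η L z₀.1 z₀.2 x| ≤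
      e / (2 * (M₀ + 1)) := by
    refine hΩ.eventually_forall_of_forall_eventually fun x _ => ?_
    have hc1 : ContinuousAt (fun p : (ℝ × E d) × E d =>
        |noiseKernel η L p.1.1 p.1.2 p.2 - noiseKernel η L z₀.1 z₀.2 p.2|) (z₀, x) :=
      ((continuousAt_noiseKernel h hL hz₀).sub
        ((contDiff_noiseKernel h L z₀.1 z₀.2).continuous.comp continuous_snd).continuousAt).abs
    have hlt : |noiseKernel η L (z₀, x).1.1 (z₀, x).1.2 (z₀, x).2 -
        noiseKernel η L z₀.1 z₀.2 (z₀, x).2| < e / (2 * (M₀ + 1)) := by simpa using hδ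
    exact (hc1.eventually (gt_mem_nhds hlt)).mono fun p hp => le_of_lt hp
  have hM1 := hM.eventually (gt_mem_nhds (lt_add_one M₀))
  have hN1 := (Metric.continuousAt_iff'.1 hN) (e / 2) (by positivity)
  have hT : ∀ᶠ z : ℝ × E d in 𝓝 z₀, z.1 ∈ Ioo (0 : ℝ) 1 :=
    continuous_fst.continuousAt.eventually (Ioo_mem_nhds hz₀.1 hz₀.2)
  filter_upwards [hk, hM1, hN1, hT] with z h1 h2 h3 h4
  have hi := hc.integrable_slice z.1 (Ioo_subset_Icc_self h4)
  have i1 := integrableOn_mul_slice hΩ hi (contDiff_noiseKernel h L z.1 z.2).continuous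
  have i2 := integrableOn_mul_slice hΩ hi (contDiff_noiseKernel h L z₀.1 z₀.2).continuous
  have hd : dist (∫ x in Ω, noiseKernel η L z.1 z.2 x * μ (z.1, x))
      (∫ x in Ω, noiseKernel η L z₀.1 z₀.2 x * μ (z.1, x)) ≤ e / (2 * (M₀ + 1)) *
        ∫ x in Ω, (1 : ℝ) * μ (z.1, x) := by
    rw [Real.dist_eq, ← integral_sub i1 i2, ← integral_const_mul, ← Real.norm_eq_abs]
    refine norm_integral_le_of_norm_le ((hi.congr (.of_forall fun x =>
      (one_mul _).symm)).const_mul _) ?_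
    filter_upwards [ae_restrict_mem hΩ.measurableSet] with x hx
    rw [← sub_mul, norm_mul, Real.norm_of_nonneg (hc.nonneg (z.1, x)), one_mul]
    exact mul_le_mul_of_nonneg_right (h1 x hx) (hc.nonneg _)
  calc dist (smoothed Ω η L (atStart μ) z) (smoothed Ω η L (atStart μ) z₀)
      ≤ dist (∫ x in Ω, noiseKernel η L z.1 z.2 x * μ (z.1, x))
          (∫ x in Ω, noiseKernel η L z₀.1 z₀.2 x * μ (z.1, x)) +
        dist (∫ x in Ω, noiseKernel η L z₀.1 z₀.2 x * μ (z.1, x))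
          (∫ x in Ω, noiseKernel η L z₀.1 z₀.2 x * μ (z₀.1, x)) := dist_triangle _ _ _
    _ < e / (2 * (M₀ + 1)) * (M₀ + 1) + e / 2 := by
        refine add_lt_add_of_le_of_lt (hd.trans ?_) h3
        gcongr
    _ = e := by field_simp; norm_num

theorem IsCurve.admissible_smooth (hc : IsCurve Ω μ v f) (h : IsBump Ω η) (hΩ : IsCompact Ω)
    (hconv : Convex ℝ Ω) (hL : 0 < L) (hL1 : L ≤ 1) {ρ₀ ρ₁ : Density Ω}
    (h0 : ∀ᵐ x ∂(volume.restrict Ω), μ (0, x) = ρ₀.1 x)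
    (h1 : ∀ᵐ x ∂(volume.restrict Ω), μ (1, x) = ρ₁.1 x) :
    Admissible Ω ρ₀ ρ₁ (smoothVelocity Ω η L μ v) (smoothDensity Ω η L μ)
      (smoothed Ω η L (atStart f)) where
  continuousOn := by
    have hcont : ContinuousOn (smoothed Ω η L (atStart μ)) (Ioo (0 : ℝ) 1 ×ˢ Ω) := fun z hz =>
      (hc.continuousAt_smoothed h hΩ hL hz.1).continuousWithinAt
    exact hcont.congr fun z hz => piecewise_eq_of_mem _ _ _ ⟨hz.1, mem_univ _⟩
  nonneg := fun z hz => by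
    unfold smoothDensity piecewise
    split_ifs with hz'
    · exact smoothed_density_nonneg hc h hL hz.1
    · exact hc.nonneg z
  measurable_velocity := by
    have m1 := stronglyMeasurable_smoothed h hΩ L
      (measurable_atStart hc.measurable_density).stronglyMeasurable
    have m2 := stronglyMeasurable_smoothed h hΩ L
      ((measurable_atStart hc.measurable_density).smul
        (measurable_noisyVelocity L hc.measurable_velocity)).stronglyMeasurable
    exact m1.measurable.inv.smul m2.measurable
  measurable_source := (stronglyMeasurable_smoothed h hΩ L
      (measurable_atStart hc.measurable_source).stronglyMeasurable).measurable
  continuityEq := hc.solvesContinuityEq_smooth h hΩ hconv hL hL1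
  initial := by simpa only [smoothDensity_zero] using h0
  terminal := by simpa only [smoothDensity_one] using h1

theorem UW2sq_le_of_admissible {α : ℝ} {ρ₀ ρ₁ : Density Ω} (h : Admissible Ω ρ₀ ρ₁ v μ f) :
    UW2sq α Ω ρ₀ ρ₁ ≤ action α Ω v μ f :=
  iInf_le_of_le _ (iInf_le_of_le _ (iInf_le_of_le _ (iInf_le _ h)))

theorem IsCurve.lintegral_density_ne_top (hc : IsCurve Ω μ v f) :
    ∫⁻ z in cylinder Ω, ENNReal.ofReal (μ z) ≠ ⊤ :=
  ((hasFiniteIntegral_iff_ofReal (.of_forall hc.nonneg)).1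
    hc.continuityEq.integrable_density.2).ne

/-- A weakly continuous curve bounds the distance of its end points. -/
theorem IsCurve.UW2sq_le (hc : IsCurve Ω μ v f) (hΩ : IsCompact Ω) (hconv : Convex ℝ Ω)
    (hint : (interior Ω).Nonempty) (α : ℝ) {ρ₀ ρ₁ : Density Ω}
    (h0 : ∀ᵐ x ∂(volume.restrict Ω), μ (0, x) = ρ₀.1 x)
    (h1 : ∀ᵐ x ∂(volume.restrict Ω), μ (1, x) = ρ₁.1 x) :
    UW2sq α Ω ρ₀ ρ₁ ≤ action α Ω v μ f := by
  obtain ⟨η, h⟩ := exists_isBump hint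
  obtain ⟨D, -, hD⟩ := exists_norm_sub_le hΩ
  set K := ∫⁻ z in cylinder Ω, ENNReal.ofReal (‖v z‖ ^ 2 * μ z)
  set M := ∫⁻ z in cylinder Ω, ENNReal.ofReal (μ z) with hMdef
  set S := ∫⁻ z in cylinder Ω, ENNReal.ofReal (|f z| ^ 2)
  have hM : M ≠ ⊤ := hc.lintegral_density_ne_top
  have hbound : ∀ᶠ L : ℝ in 𝓝[>] 0, UW2sq α Ω ρ₀ ρ₁ ≤
      (ENNReal.ofReal (1 + L) * K + ENNReal.ofReal ((1 + L) * L * D ^ 2) * M) +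
        ENNReal.ofReal (1 / α) * (ENNReal.ofReal ((1 - L)⁻¹ ^ d) * S) := by
    filter_upwards [Ioo_mem_nhdsGT one_pos] with L hL
    refine (UW2sq_le_of_admissible (hc.admissible_smooth h hΩ hconv hL.1 hL.2.le h0 h1)).trans ?_
    exact add_le_add (lintegral_kinetic_smooth_le hc h hΩ hconv hL.1 hL.2.le hD)
      (mul_le_mul_right (lintegral_source_smooth_le hc h hΩ hconv hL.1 hL.2) _)
  have t1 : Tendsto (fun L : ℝ => ENNReal.ofReal (1 + L) * K) (𝓝[>] 0) (𝓝 (1 * K)) := by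
    have : Tendsto (fun L : ℝ => ENNReal.ofReal (1 + L)) (𝓝[>] 0) (𝓝 1) := by
      have h : Continuous fun L : ℝ => ENNReal.ofReal (1 + L) :=
        ENNReal.continuous_ofReal.comp (by fun_prop)
      simpa using (h.tendsto 0).mono_left nhdsWithin_le_nhds
    exact ENNReal.Tendsto.mul_const this (Or.inl one_ne_zero)
  -- Finiteness of the mass is essential here, since the coefficient tends to 0. K and S may be
  -- infinite: their coefficients tend to 1.
  have t2 : Tendsto (fun L : ℝ => ENNReal.ofReal ((1 + L) * L * D ^ 2) * M) (𝓝[>] 0)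
      (𝓝 (0 * M)) := by
    have : Tendsto (fun L : ℝ => ENNReal.ofReal ((1 + L) * L * D ^ 2)) (𝓝[>] 0) (𝓝 0) := by
      have h : Continuous fun L : ℝ => ENNReal.ofReal ((1 + L) * L * D ^ 2) :=
        ENNReal.continuous_ofReal.comp (by fun_prop)
      simpa using (h.tendsto 0).mono_left nhdsWithin_le_nhds
    exact ENNReal.Tendsto.mul_const this (Or.inr hM)
  have t3 : Tendsto (fun L : ℝ => ENNReal.ofReal ((1 - L)⁻¹ ^ d) * S) (𝓝[>] 0) (𝓝 (1 * S)) := by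
    have : Tendsto (fun L : ℝ => ENNReal.ofReal ((1 - L)⁻¹ ^ d)) (𝓝[>] 0) (𝓝 1) := by
      have h : ContinuousAt (fun L : ℝ => ENNReal.ofReal ((1 - L)⁻¹ ^ d)) 0 := by
        refine ENNReal.continuous_ofReal.continuousAt.comp (ContinuousAt.pow ?_ d)
        exact ContinuousAt.inv₀ (by fun_prop) (by norm_num)
      have h' := h.tendsto.mono_left (nhdsWithin_le_nhds (s := Ioi 0))
      simpa using h'
    exact ENNReal.Tendsto.mul_const this (Or.inl one_ne_zero)
  have t := (t1.add t2).add (ENNReal.Tendsto.const_mul (a := ENNReal.ofReal (1 / α)) t3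
    (Or.inr ENNReal.ofReal_ne_top))
  rw [one_mul, zero_mul, one_mul, add_zero] at t
  exact ge_of_tendsto t hbound

end Relaxation

/-! ### Weak continuity in time -/

section WeakContinuity

/-- Integration by parts for a product of absolutely continuous primitives; h is only integrable, so
the derivative exists only almost everywhere. -/
theorem integral_mul_primitive {c h : ℝ → ℝ} (hc : Continuous c)
    (hh : IntervalIntegrable h volume 0 1) :
    ∫ t in (0 : ℝ)..1, (c t * (∫ s in (0 : ℝ)..t, h s) + (∫ s in (0 : ℝ)..t, c s) * h t) =
      (∫ s in (0 : ℝ)..1, c s) * ∫ s in (0 : ℝ)..1, h s := by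
  have hci : IntervalIntegrable c volume 0 1 := hc.intervalIntegrable 0 1
  have a1 := hci.absolutelyContinuousOnInterval_intervalIntegral (c := 0) left_mem_uIcc
  have a2 := hh.absolutelyContinuousOnInterval_intervalIntegral (c := 0) left_mem_uIcc
  have key := (a1.mul a2).integral_deriv_eq_sub
  simp only [Pi.mul_apply, intervalIntegral.integral_same, zero_mul, sub_zero] at key
  rw [← key]
  refine intervalIntegral.integral_congr_ae ?_
  filter_upwards [hci.ae_hasDerivAt_integral, hh.ae_hasDerivAt_integral] with t h1 h2 ht
  have ht' := uIoc_subset_uIcc ht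
  exact ((h1 ht' 0 left_mem_uIcc).mul (h2 ht' 0 left_mem_uIcc)).deriv.symm

/-- A function with an integrable weak derivative that is continuous in the interior and takes its
end values weakly is continuous up to the end points. -/
theorem continuousOn_Icc_of_weak_deriv {g h : ℝ → ℝ} (hg : ContinuousOn g (Ioo 0 1))
    (hgi : IntervalIntegrable g volume 0 1) (hh : IntervalIntegrable h volume 0 1)
    (hw : ∀ χ : ℝ → ℝ, ContDiff ℝ 1 χ →
      χ 1 * g 1 - χ 0 * g 0 = ∫ t in (0 : ℝ)..1, (deriv χ t * g t + χ t * h t)) :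
    ContinuousOn g (Icc 0 1) := by
  set H : ℝ → ℝ := fun t => ∫ s in (0 : ℝ)..t, h s with hH
  have hHc : ContinuousOn H (Icc 0 1) := by
    have := intervalIntegral.continuousOn_primitive_interval' hh left_mem_uIcc
    rwa [uIcc_of_le zero_le_one] at this
  have h1 : g 1 = g 0 + H 1 := by
    have := hw (fun _ => 1) contDiff_const
    simp at this
    linarith
  have hHi : IntervalIntegrable H volume 0 1 :=
    ContinuousOn.intervalIntegrable (by rwa [uIcc_of_le zero_le_one])
  set u : ℝ → ℝ := fun t => g t - g 0 - H t with hu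
  have hui : IntervalIntegrable u volume 0 1 :=
    (hgi.sub (intervalIntegrable_const (c := g 0))).sub hHi
  -- Testing with the primitive χ of c and integrating by parts shows that u is orthogonal to every
  -- continuous c. The end terms cancel by `h1`.
  have hz : ∀ c : ℝ → ℝ, Continuous c → ∫ t in (0 : ℝ)..1, c t * u t = 0 := by
    intro c hc
    set χ : ℝ → ℝ := fun t => ∫ s in (0 : ℝ)..t, c s with hχ
    have hd : ∀ t, HasDerivAt χ (c t) t := fun t => hc.integral_hasStrictDerivAt 0 t |>.hasDerivAt
    have hχ1 : ContDiff ℝ 1 χ := contDiff_one_iff_deriv.2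
      ⟨fun t => (hd t).differentiableAt, by
        rw [show deriv χ = c from funext fun t => (hd t).deriv]; exact hc⟩
    have e1 := hw χ hχ1
    have e2 := integral_mul_primitive hc hh
    have hχc : ContinuousOn χ (uIcc 0 1) := hχ1.continuous.continuousOn
    have i1 : IntervalIntegrable (fun t => c t * g t + χ t * h t) volume 0 1 :=
      (hgi.continuousOn_mul hc.continuousOn).add (hh.continuousOn_mul hχc)
    have i2 : IntervalIntegrable (fun t => c t * H t + χ t * h t) volume 0 1 :=
      (hHi.continuousOn_mul hc.continuousOn).add (hh.continuousOn_mul hχc)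
    have i3 : IntervalIntegrable (fun t => c t * g 0) volume 0 1 :=
      (hc.mul continuous_const).intervalIntegrable 0 1
    have e3 : ∫ t in (0 : ℝ)..1, c t * g 0 = χ 1 * g 0 := intervalIntegral.integral_mul_const _ _
    have hχ0 : χ 0 = 0 := intervalIntegral.integral_same
    simp only [fun t => (hd t).deriv] at e1
    calc ∫ t in (0 : ℝ)..1, c t * u t
        = ∫ t in (0 : ℝ)..1, ((c t * g t + χ t * h t) - c t * g 0 - (c t * H t + χ t * h t)) := by
          congr 1; ext t; simp only [hu]; ring
      _ = 0 := by
          rw [intervalIntegral.integral_sub (i1.sub i3) i2, intervalIntegral.integral_sub i1 i3,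
            e3, e2, ← e1, hχ0, h1]
          change _ - χ 1 * H 1 = 0
          ring
  have hu0 : ∀ᵐ t, t ∈ Ioo (0 : ℝ) 1 → u t = 0 := by
    refine isOpen_Ioo.ae_eq_zero_of_integral_contDiff_smul_eq_zero ?_ fun c hc _ hcs => ?_
    · exact (((intervalIntegrable_iff_integrableOn_Ioc_of_le zero_le_one).1 hui).mono_set
        Ioo_subset_Ioc_self).locallyIntegrableOn
    · have := hz c hc.continuous
      rw [intervalIntegral.integral_of_le zero_le_one] at this
      rw [← this]
      refine (setIntegral_eq_integral_of_forall_compl_eq_zero fun t ht => ?_).symm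
      have : t ∉ tsupport c := fun h => ht (Ioo_subset_Ioc_self (hcs h))
      simp [image_eq_zero_of_notMem_tsupport this]
  -- Both sides are continuous on the open interval, so equality almost everywhere is equality
  -- everywhere there. The two end points are covered by H 0 = 0 and by `h1`.
  have heq : EqOn g (fun t => g 0 + H t) (Ioo 0 1) := by
    refine Measure.eqOn_Ioo_of_ae_eq (μ := volume) ?_ hg
      ((continuousOn_const.add hHc).mono Ioo_subset_Icc_self)
    filter_upwards [(ae_restrict_iff' measurableSet_Ioo).2 hu0] with t ht
    simp only [hu] at ht
    linarith
  refine (continuousOn_const.add hHc : ContinuousOn (fun t => g 0 + H t) _).congr fun t ht => ?_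
  rcases ht.1.eq_or_lt with rfl | h0
  · simp [hH]
  rcases ht.2.eq_or_lt with rfl | h2
  · exact h1
  exact heq ⟨h0, h2⟩

/-! ### Pairings with spatial test functions, and Borel versions of admissible triples -/

variable {d : ℕ} {Ω : Set (E d)} {μ f : ℝ × E d → ℝ} {v : ℝ × E d → E d}

theorem intervalIntegrable_integral_slice (hΩ : IsCompact Ω) {g : ℝ × E d → ℝ}
    (hg : IntegrableOn g (cylinder Ω)) :
    IntervalIntegrable (fun t => ∫ x in Ω, g (t, x)) volume 0 1 := by
  have := isFiniteMeasure_restrict_space hΩ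
  unfold IntegrableOn at hg
  rw [restrict_cylinder] at hg
  rw [intervalIntegrable_iff_integrableOn_Icc_of_le zero_le_one]
  exact hg.integral_prod_left

theorem ae_integrableOn_slice (hΩ : IsCompact Ω) {g : ℝ × E d → ℝ}
    (hg : IntegrableOn g (cylinder Ω)) :
    ∀ᵐ t : ℝ, t ∈ uIoc 0 1 → IntegrableOn (fun x => g (t, x)) Ω := by
  have := isFiniteMeasure_restrict_space hΩ
  unfold IntegrableOn at hg
  rw [restrict_cylinder] at hg
  filter_upwards [(ae_restrict_iff' measurableSet_Icc).1 hg.prod_right_ae] with t ht h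
  rw [uIoc_of_le zero_le_one] at h
  exact ht (Ioc_subset_Icc_self h)

theorem timeDeriv_mul_apply (χ : ℝ → ℝ) (φ : E d → ℝ) (z : ℝ × E d) :
    timeDeriv (fun z => χ z.1 * φ z.2) z = deriv χ z.1 * φ z.2 := by
  simp [timeDeriv]

theorem inner_spaceGrad_mul_apply (χ : ℝ → ℝ) {φ : E d → ℝ} (hφ : ContDiff ℝ 1 φ) (z : ℝ × E d)
    (w : E d) : inner ℝ (spaceGrad (fun z => χ z.1 * φ z.2) z) w =
      χ z.1 * inner ℝ (gradient φ z.2) w := by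
  simp only [spaceGrad, gradient, InnerProductSpace.toDual_symm_apply]
  rw [fderiv_const_mul (hφ.differentiable one_ne_zero z.2)]
  rfl

/-- The pairing of a solution with a test function of the space variable is continuous up to the
end times when it is so in between. -/
theorem SolvesContinuityEq.continuousOn_Icc (h : SolvesContinuityEq Ω μ v f) (hΩ : IsCompact Ω)
    {φ : E d → ℝ} (hφ : ContDiff ℝ 1 φ)
    (hc : ContinuousOn (fun t => ∫ x in Ω, φ x * μ (t, x)) (Ioo 0 1)) :
    ContinuousOn (fun t => ∫ x in Ω, φ x * μ (t, x)) (Icc 0 1) := by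
  have hgrad : Continuous (gradient φ) :=
    (LinearIsometryEquiv.continuous _).comp (hφ.continuous_fderiv one_ne_zero)
  have i1 : IntegrableOn (fun z : ℝ × E d => φ z.2 * μ z) (cylinder Ω) :=
    integrableOn_mul_of_continuous hΩ (hφ.continuous.comp continuous_snd) h.integrable_density
  have i2 : IntegrableOn (fun z : ℝ × E d => inner ℝ (gradient φ z.2) (μ z • v z) + φ z.2 * f z)
      (cylinder Ω) :=
    (integrableOn_inner_of_continuous hΩ (hgrad.comp continuous_snd) h.integrable_flux).add
      (integrableOn_mul_of_continuous hΩ (hφ.continuous.comp continuous_snd) h.integrable_source)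
  refine continuousOn_Icc_of_weak_deriv hc (intervalIntegrable_integral_slice hΩ i1)
    (intervalIntegrable_integral_slice hΩ i2) fun χ hχ => ?_
  have hψ : ContDiff ℝ 1 fun z : ℝ × E d => χ z.1 * φ z.2 :=
    (hχ.comp contDiff_fst).mul (hφ.comp contDiff_snd)
  have e := h.weak_eq _ hψ
  have i3 := integrableOn_weakIntegrand hΩ h.integrable_density h.integrable_flux
    h.integrable_source hψ
  replace e := e.trans (integral_cylinder i3)
  simp only [mul_assoc, integral_const_mul] at e
  rw [e]
  refine intervalIntegral.integral_congr_ae ?_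
  filter_upwards [ae_integrableOn_slice hΩ i1, ae_integrableOn_slice hΩ i2] with t h1 h2 ht
  rw [← integral_const_mul, ← integral_const_mul, ← integral_add ((h1 ht).const_mul _)
    ((h2 ht).const_mul _)]
  refine integral_congr_ae (.of_forall fun x => ?_)
  simp only [timeDeriv_mul_apply, inner_spaceGrad_mul_apply χ hφ]
  ring

theorem continuousOn_pairing (hΩ : IsCompact Ω) (hm : Measurable μ)
    (hμ : ContinuousOn μ (Ioo (0 : ℝ) 1 ×ˢ Ω)) {φ : E d → ℝ} (hφ : Continuous φ) :
    ContinuousOn (fun t => ∫ x in Ω, φ x * μ (t, x)) (Ioo 0 1) := by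
  have := isFiniteMeasure_restrict_space hΩ
  intro t₀ ht₀
  obtain ⟨a, ha0, ha⟩ := exists_between ht₀.1
  obtain ⟨b, hb, hb1⟩ := exists_between ht₀.2
  have hsub : Icc a b ×ˢ Ω ⊆ Ioo (0 : ℝ) 1 ×ˢ Ω := prod_mono (Icc_subset_Ioo ha0 hb1) le_rfl
  have hcont : ContinuousOn (fun z : ℝ × E d => φ z.2 * μ z) (Icc a b ×ˢ Ω) :=
    (hφ.comp continuous_snd).continuousOn.mul (hμ.mono hsub)
  obtain ⟨C, hC⟩ := (isCompact_Icc.prod hΩ).exists_bound_of_continuousOn hcont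
  have hon : ContinuousOn (fun t => ∫ x in Ω, φ x * μ (t, x)) (Icc a b) := by
    refine continuousOn_of_dominated (bound := fun _ => C) (fun t _ => ?_) (fun t ht => ?_)
      (integrable_const _) ?_
    · exact (hφ.measurable.mul (hm.comp measurable_prodMk_left)).aestronglyMeasurable
    · filter_upwards [ae_restrict_mem hΩ.measurableSet] with x hx
      exact hC (t, x) ⟨ht, hx⟩
    · filter_upwards [ae_restrict_mem hΩ.measurableSet] with x hx
      exact hcont.comp (by fun_prop : ContinuousOn (fun t : ℝ => (t, x)) (Icc a b))
        fun t ht => ⟨ht, hx⟩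
  exact (hon.continuousAt (Icc_mem_nhds ha hb)).continuousWithinAt

/-- The solutions of the continuity equation depend only on the classes of the density. -/
theorem SolvesContinuityEq.congr {μ' f' : ℝ × E d → ℝ} {v' : ℝ × E d → E d}
    (h : SolvesContinuityEq Ω μ v f)
    (hμ : μ' =ᵐ[volume.restrict (cylinder Ω)] μ)
    (hm : (fun z => μ' z • v' z) =ᵐ[volume.restrict (cylinder Ω)] fun z => μ z • v z)
    (hf : f' =ᵐ[volume.restrict (cylinder Ω)] f)
    (h0 : ∀ᵐ x ∂(volume.restrict Ω), μ' (0, x) = μ (0, x))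
    (h1 : ∀ᵐ x ∂(volume.restrict Ω), μ' (1, x) = μ (1, x)) : SolvesContinuityEq Ω μ' v' f' where
  integrable_density := h.integrable_density.congr hμ.symm
  integrable_initial := h.integrable_initial.congr (Filter.EventuallyEq.symm h0)
  integrable_terminal := h.integrable_terminal.congr (Filter.EventuallyEq.symm h1)
  integrable_flux := h.integrable_flux.congr hm.symm
  integrable_source := h.integrable_source.congr hf.symm
  weak_eq := fun φ hφ => by
    have e0 : ∫ x in Ω, φ (0, x) * μ' (0, x) = ∫ x in Ω, φ (0, x) * μ (0, x) :=
      integral_congr_ae (h0.mono fun x hx => by simp only [hx])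
    have e1 : ∫ x in Ω, φ (1, x) * μ' (1, x) = ∫ x in Ω, φ (1, x) * μ (1, x) :=
      integral_congr_ae (h1.mono fun x hx => by simp only [hx])
    rw [e0, e1, h.weak_eq φ hφ]
    refine integral_congr_ae ?_
    filter_upwards [hμ, hm, hf] with z a b c
    rw [b, a, c]

/-- A Borel version of the density of an admissible triple. -/
def borelDensity (Ω : Set (E d)) (ρ₀ ρ₁ : Density Ω) (μ : ℝ × E d → ℝ) (z : ℝ × E d) : ℝ :=
  if z.1 = 0 then |ρ₀.1 z.2| else if z.1 = 1 then |ρ₁.1 z.2| else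
    (Ioo (0 : ℝ) 1 ×ˢ Ω).indicator μ z

theorem measurable_density_coe (ρ : Density Ω) : Measurable ρ.1 :=
  (Lp.stronglyMeasurable ρ.1).measurable

theorem Density.abs_ae_eq (ρ : Density Ω) : ∀ᵐ x ∂(volume.restrict Ω), |ρ.1 x| = ρ.1 x :=
  ρ.2.mono fun _ hx => abs_of_nonneg hx

theorem Density.integrableOn (ρ : Density Ω) : IntegrableOn ρ.1 Ω := L1.integrable_coeFn ρ.1

theorem borelDensity_of_mem {ρ₀ ρ₁ : Density Ω} {z : ℝ × E d} (hz : z ∈ Ioo (0 : ℝ) 1 ×ˢ Ω) :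
    borelDensity Ω ρ₀ ρ₁ μ z = μ z := by
  rw [borelDensity, if_neg hz.1.1.ne', if_neg hz.1.2.ne, indicator_of_mem hz]

/-- The density is changed only on a null set of the cylinder and, at the end times, on null sets of
Ω, so equation and action are unaffected. The absolute values are needed because the chosen
representatives of ρ₀ and ρ₁ are nonnegative only almost everywhere. -/
theorem Admissible.exists_isCurve {ρ₀ ρ₁ : Density Ω} (h : Admissible Ω ρ₀ ρ₁ v μ f)
    (hΩ : IsCompact Ω) : ∃ μ', IsCurve Ω μ' v f ∧
      (∀ᵐ x ∂(volume.restrict Ω), μ' (0, x) = ρ₀.1 x) ∧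
      (∀ᵐ x ∂(volume.restrict Ω), μ' (1, x) = ρ₁.1 x) ∧
      ∀ α, action α Ω v μ' f = action α Ω v μ f := by
  have hae : borelDensity Ω ρ₀ ρ₁ μ =ᵐ[volume.restrict (cylinder Ω)] μ :=
    (ae_mem_Ioo_prod hΩ).mono fun z hz => borelDensity_of_mem hz
  have hs0 : ∀ x, borelDensity Ω ρ₀ ρ₁ μ (0, x) = |ρ₀.1 x| := fun x => by simp [borelDensity]
  have hs1 : ∀ x, borelDensity Ω ρ₀ ρ₁ μ (1, x) = |ρ₁.1 x| := fun x => by simp [borelDensity]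
  have h0 : ∀ᵐ x ∂(volume.restrict Ω), borelDensity Ω ρ₀ ρ₁ μ (0, x) = ρ₀.1 x := by
    simpa only [hs0] using Density.abs_ae_eq ρ₀
  have h1 : ∀ᵐ x ∂(volume.restrict Ω), borelDensity Ω ρ₀ ρ₁ μ (1, x) = ρ₁.1 x := by
    simpa only [hs1] using Density.abs_ae_eq ρ₁
  have hm : Measurable (borelDensity Ω ρ₀ ρ₁ μ) :=
    Measurable.ite (measurable_fst (measurableSet_singleton 0))
      ((measurable_density_coe ρ₀).comp measurable_snd).abs
      (Measurable.ite (measurable_fst (measurableSet_singleton 1))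
        ((measurable_density_coe ρ₁).comp measurable_snd).abs (h.measurable_indicator hΩ))
  have hcont : ContinuousOn (borelDensity Ω ρ₀ ρ₁ μ) (Ioo (0 : ℝ) 1 ×ˢ Ω) :=
    h.continuousOn.congr fun z hz => borelDensity_of_mem hz
  have hsol : SolvesContinuityEq Ω (borelDensity Ω ρ₀ ρ₁ μ) v f := by
    refine h.continuityEq.congr hae ?_ (ae_eq_refl f) ?_ ?_
    · filter_upwards [hae] with z hz
      simp only [hz]
    · filter_upwards [h0, h.initial] with x a b using a.trans b.symm
    · filter_upwards [h1, h.terminal] with x a b using a.trans b.symm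
  refine ⟨_, ⟨hm, fun z => ?_, h.measurable_velocity, h.measurable_source, fun t ht => ?_,
    fun φ hφ => hsol.continuousOn_Icc hΩ hφ (continuousOn_pairing hΩ hm hcont hφ.continuous),
    hsol⟩, h0, h1, fun α => ?_⟩
  · unfold borelDensity
    split_ifs
    · exact abs_nonneg _
    · exact abs_nonneg _
    · exact indicator_nonneg (fun z hz => h.nonneg z ⟨Ioo_subset_Icc_self hz.1, hz.2⟩) z
  · rcases ht.1.eq_or_lt with rfl | ht0
    · exact hsol.integrable_initial
    rcases ht.2.eq_or_lt with rfl | ht1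
    · exact hsol.integrable_terminal
    · refine ContinuousOn.integrableOn_compact hΩ (hcont.comp
        (by fun_prop : ContinuousOn (fun x : E d => (t, x)) Ω) fun x hx => ⟨⟨ht0, ht1⟩, hx⟩)
  · unfold action
    congr 1
    refine lintegral_congr_ae ?_
    filter_upwards [hae] with z hz
    rw [hz]

end WeakContinuity

/-! ### Changes of time -/

section TimeChange

variable {d : ℕ} {Ω : Set (E d)} {μ f : ℝ × E d → ℝ} {v : ℝ × E d → E d} {b c : ℝ}

/-- An affine change of time. -/
def timeMap (c b : ℝ) (z : ℝ × E d) : ℝ × E d := (c * z.1 + b, z.2)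

theorem continuous_timeMap : Continuous (timeMap c b : ℝ × E d → ℝ × E d) := by
  unfold timeMap; fun_prop

theorem timeMap_inv_timeMap (hc : c ≠ 0) (z : ℝ × E d) :
    timeMap c⁻¹ (-(c⁻¹ * b)) (timeMap c b z) = z := by
  ext1
  · simp only [timeMap]; field_simp; ring
  · rfl

theorem timeMap_timeMap_inv (hc : c ≠ 0) (z : ℝ × E d) :
    timeMap c b (timeMap c⁻¹ (-(c⁻¹ * b)) z) = z := by
  ext1
  · simp only [timeMap]; field_simp; ring
  · rfl

theorem measurableEmbedding_timeMap (hc : c ≠ 0) :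
    MeasurableEmbedding (timeMap c b : ℝ × E d → ℝ × E d) :=
  Homeomorph.measurableEmbedding
    { toFun := timeMap c b
      invFun := timeMap c⁻¹ (-(c⁻¹ * b))
      left_inv := timeMap_inv_timeMap hc
      right_inv := timeMap_timeMap_inv hc
      continuous_toFun := continuous_timeMap
      continuous_invFun := continuous_timeMap }

theorem map_timeMap (hc : c ≠ 0) :
    (volume : Measure (ℝ × E d)).map (timeMap c b) = ENNReal.ofReal |c⁻¹| • volume := by
  have h1 : (volume : Measure ℝ).map (fun t => c * t + b) = ENNReal.ofReal |c⁻¹| • volume := by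
    have : (fun t : ℝ => c * t + b) = (fun t => t + b) ∘ fun t => c * t := rfl
    rw [this, ← Measure.map_map (measurable_add_const b) (measurable_const_mul c),
      Real.map_volume_mul_left hc, Measure.map_smul, map_add_right_eq_self]
  have h2 := Measure.map_prod_map (volume : Measure ℝ) (volume : Measure (E d))
    (f := fun t => c * t + b) (g := id) (by fun_prop) measurable_id
  rw [h1, Measure.map_id, Measure.prod_smul_left] at h2
  exact h2.symm

theorem setIntegral_comp_timeMap (hc : c ≠ 0) (S : Set (ℝ × E d)) (g : ℝ × E d → ℝ) :
    ∫ z in timeMap c b ⁻¹' S, g (timeMap c b z) = |c⁻¹| * ∫ z in S, g z := by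
  rw [← (measurableEmbedding_timeMap hc).setIntegral_map, map_timeMap hc, Measure.restrict_smul,
    integral_smul_measure, ENNReal.toReal_ofReal (abs_nonneg _), smul_eq_mul]

theorem setLIntegral_comp_timeMap (hc : c ≠ 0) (S : Set (ℝ × E d)) (g : ℝ × E d → ℝ≥0∞) :
    ∫⁻ z in timeMap c b ⁻¹' S, g (timeMap c b z) = ENNReal.ofReal |c⁻¹| * ∫⁻ z in S, g z := by
  rw [← (measurableEmbedding_timeMap hc).lintegral_map,
    ← (measurableEmbedding_timeMap hc).restrict_map, map_timeMap hc, Measure.restrict_smul,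
    lintegral_smul_measure, smul_eq_mul]

theorem integrableOn_comp_timeMap {F : Type*} [NormedAddCommGroup F] (hc : c ≠ 0)
    {S : Set (ℝ × E d)} {g : ℝ × E d → F} (hg : IntegrableOn g S) :
    IntegrableOn (fun z => g (timeMap c b z)) (timeMap c b ⁻¹' S) := by
  refine ((measurableEmbedding_timeMap hc).integrableOn_map_iff (μ := volume)).1 ?_
  rw [map_timeMap hc]
  unfold IntegrableOn
  rw [Measure.restrict_smul]
  exact Integrable.smul_measure hg ENNReal.ofReal_ne_top

theorem weakIntegrand_timeMap {φ : ℝ × E d → ℝ} (hφ : ContDiff ℝ 1 φ) (z : ℝ × E d) :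
    weakIntegrand (fun z => μ (timeMap c b z)) (fun z => μ (timeMap c b z) • c • v (timeMap c b z))
      (fun z => c * f (timeMap c b z)) (fun z => φ (timeMap c b z)) z =
      c * weakIntegrand μ (fun z => μ z • v z) f φ (timeMap c b z) := by
  have h1 : timeDeriv (fun z => φ (timeMap c b z)) z = c * timeDeriv φ (timeMap c b z) := by
    have h : HasDerivAt (fun s => φ (s, z.2)) (fderiv ℝ φ (timeMap c b z) (1, 0))
        (c * z.1 + b) := hasDerivAt_time (hφ.differentiable one_ne_zero (timeMap c b z)).hasFDerivAt
    have h2 : HasDerivAt (fun t : ℝ => c * t + b) c z.1 := by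
      simpa using ((hasDerivAt_id z.1).const_mul c).add_const b
    have h3 := HasDerivAt.comp z.1 (h₂ := fun s => φ (s, z.2)) h h2
    rw [timeDeriv_eq hφ, mul_comm]
    exact h3.deriv
  have h2 : spaceGrad (fun z => φ (timeMap c b z)) z = spaceGrad φ (timeMap c b z) := rfl
  simp only [weakIntegrand, h1, h2, real_inner_smul_right]
  ring

/-- The weak continuity equation on the time interval that `timeMap c b` maps onto `[0,1]`. -/
theorem SolvesContinuityEq.integral_timeMap (h : SolvesContinuityEq Ω μ v f) (hc : c ≠ 0)
    {φ : ℝ × E d → ℝ} (hφ : ContDiff ℝ 1 φ) :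
    ∫ z in timeMap c b ⁻¹' cylinder Ω, weakIntegrand (fun z => μ (timeMap c b z))
        (fun z => μ (timeMap c b z) • c • v (timeMap c b z)) (fun z => c * f (timeMap c b z)) φ z =
      c * |c⁻¹| * ((∫ x in Ω, φ (c⁻¹ * 1 + -(c⁻¹ * b), x) * μ (1, x)) -
        ∫ x in Ω, φ (c⁻¹ * 0 + -(c⁻¹ * b), x) * μ (0, x)) := by
  set ψ : ℝ × E d → ℝ := fun z => φ (timeMap c⁻¹ (-(c⁻¹ * b)) z) with hψ
  have hψ1 : ContDiff ℝ 1 ψ := hφ.comp (by unfold timeMap; fun_prop)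
  have e : φ = fun z => ψ (timeMap c b z) := funext fun z => by
    simp only [hψ, timeMap_inv_timeMap hc]
  have h1 := h.weak_eq ψ hψ1
  have h2 : ∀ z, weakIntegrand (fun z => μ (timeMap c b z))
        (fun z => μ (timeMap c b z) • c • v (timeMap c b z)) (fun z => c * f (timeMap c b z)) φ z =
      c * weakIntegrand μ (fun z => μ z • v z) f ψ (timeMap c b z) := fun z => by
    conv_lhs => rw [e]
    exact weakIntegrand_timeMap hψ1 z
  simp only [h2]
  rw [integral_const_mul, setIntegral_comp_timeMap hc, mul_assoc]
  congr 2
  exact h1.symm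

/-- The square of the velocity contributes c², and the change of variables in time contributes
1/|c|. -/
theorem lintegral_kinetic_timeMap (hc : c ≠ 0) (S : Set (ℝ × E d)) :
    ∫⁻ z in timeMap c b ⁻¹' S, ENNReal.ofReal (‖c • v (timeMap c b z)‖ ^ 2 * μ (timeMap c b z)) =
      ENNReal.ofReal |c| * ∫⁻ z in S, ENNReal.ofReal (‖v z‖ ^ 2 * μ z) := by
  have : ∀ z, ENNReal.ofReal (‖c • v (timeMap c b z)‖ ^ 2 * μ (timeMap c b z)) =
      ENNReal.ofReal (c ^ 2) * ENNReal.ofReal (‖v (timeMap c b z)‖ ^ 2 * μ (timeMap c b z)) :=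
    fun z => by
      rw [← ENNReal.ofReal_mul (sq_nonneg c), norm_smul, mul_pow, Real.norm_eq_abs, sq_abs,
        mul_assoc]
  simp only [this]
  rw [lintegral_const_mul' _ _ ENNReal.ofReal_ne_top,
    setLIntegral_comp_timeMap hc S fun z => ENNReal.ofReal (‖v z‖ ^ 2 * μ z), ← mul_assoc,
    ← ENNReal.ofReal_mul (sq_nonneg c)]
  congr 2
  rw [← sq_abs, abs_inv]
  field_simp

theorem lintegral_source_timeMap (hc : c ≠ 0) (S : Set (ℝ × E d)) :
    ∫⁻ z in timeMap c b ⁻¹' S, ENNReal.ofReal (|c * f (timeMap c b z)| ^ 2) =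
      ENNReal.ofReal |c| * ∫⁻ z in S, ENNReal.ofReal (|f z| ^ 2) := by
  have : ∀ z, ENNReal.ofReal (|c * f (timeMap c b z)| ^ 2) =
      ENNReal.ofReal (c ^ 2) * ENNReal.ofReal (|f (timeMap c b z)| ^ 2) := fun z => by
    rw [← ENNReal.ofReal_mul (sq_nonneg c), abs_mul, mul_pow, sq_abs c]
  simp only [this]
  rw [lintegral_const_mul' _ _ ENNReal.ofReal_ne_top,
    setLIntegral_comp_timeMap hc S fun z => ENNReal.ofReal (|f z| ^ 2), ← mul_assoc,
    ← ENNReal.ofReal_mul (sq_nonneg c)]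
  congr 2
  rw [← sq_abs, abs_inv]
  field_simp

/-! ### Symmetry -/

theorem timeMap_preimage_cylinder_reverse :
    timeMap (-1) 1 ⁻¹' cylinder Ω = cylinder Ω := by
  ext z
  simp only [timeMap, cylinder, mem_preimage, mem_prod, mem_Icc]
  constructor <;> rintro ⟨⟨h1, h2⟩, h3⟩ <;> exact ⟨⟨by linarith, by linarith⟩, h3⟩

/-- Reversing time changes the signs of velocity and source, which the action does not see. -/
theorem Admissible.reverse {ρ₀ ρ₁ : Density Ω} (h : Admissible Ω ρ₀ ρ₁ v μ f) :
    Admissible Ω ρ₁ ρ₀ (fun z => (-1 : ℝ) • v (timeMap (-1) 1 z)) (fun z => μ (timeMap (-1) 1 z))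
      (fun z => (-1) * f (timeMap (-1) 1 z)) := by
  have hc : (-1 : ℝ) ≠ 0 := by norm_num
  have e0 : ∀ x : E d, timeMap (-1) 1 (0, x) = (1, x) := fun x => by simp [timeMap]
  have e1 : ∀ x : E d, timeMap (-1) 1 (1, x) = (0, x) := fun x => by simp [timeMap]
  have hI : ∀ {F : Type} [NormedAddCommGroup F] {g : ℝ × E d → F}, IntegrableOn g (cylinder Ω) →
      IntegrableOn (fun z => g (timeMap (-1) 1 z)) (cylinder Ω) := fun {F} _ {g} hg => by
    have := integrableOn_comp_timeMap (b := 1) hc hg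
    rwa [timeMap_preimage_cylinder_reverse] at this
  refine ⟨?_, ?_, ?_, ?_, ⟨hI h.continuityEq.integrable_density, ?_, ?_, ?_, ?_, fun φ hφ => ?_⟩,
    ?_, ?_⟩
  · refine h.continuousOn.comp continuous_timeMap.continuousOn ?_
    rintro z ⟨⟨h1, h2⟩, h3⟩
    refine ⟨⟨?_, ?_⟩, h3⟩ <;> simp only [timeMap] <;> linarith
  · intro z hz
    refine h.nonneg _ ?_
    rwa [← mem_preimage, timeMap_preimage_cylinder_reverse]
  · exact (h.measurable_velocity.comp continuous_timeMap.measurable).const_smul (-1 : ℝ)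
  · exact (h.measurable_source.comp continuous_timeMap.measurable).const_mul (-1)
  · simpa only [e0] using h.continuityEq.integrable_terminal
  · simpa only [e1] using h.continuityEq.integrable_initial
  · refine ((hI h.continuityEq.integrable_flux).smul (-1 : ℝ)).congr (.of_forall fun z => ?_)
    exact smul_comm (-1 : ℝ) (μ (timeMap (-1) 1 z)) (v (timeMap (-1) 1 z))
  · exact (hI h.continuityEq.integrable_source).const_mul (-1)
  · have := h.continuityEq.integral_timeMap (b := 1) hc hφ
    rw [timeMap_preimage_cylinder_reverse] at this
    refine Eq.trans ?_ this.symm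
    simp only [e0, e1]
    norm_num
  · simpa only [e0] using h.terminal
  · simpa only [e1] using h.initial

theorem UW2sq_le_reverse (α : ℝ) (ρ₀ ρ₁ : Density Ω) : UW2sq α Ω ρ₁ ρ₀ ≤ UW2sq α Ω ρ₀ ρ₁ := by
  refine le_iInf fun v => le_iInf fun μ => le_iInf fun f => le_iInf fun h => ?_
  refine (UW2sq_le_of_admissible h.reverse).trans (le_of_eq ?_)
  have hc : (-1 : ℝ) ≠ 0 := by norm_num
  have h1 := lintegral_kinetic_timeMap (v := v) (μ := μ) (b := 1) hc (cylinder Ω)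
  have h2 := lintegral_source_timeMap (f := f) (b := 1) hc (cylinder Ω)
  rw [timeMap_preimage_cylinder_reverse, abs_neg, abs_one, ENNReal.ofReal_one, one_mul] at h1 h2
  unfold action
  rw [h1, h2]

end TimeChange

/-! ### Concatenation of curves -/

section Concatenation

variable {d : ℕ} {Ω : Set (E d)} {s : ℝ}

/-- The map of `[0,s]` onto `[0,1]`. -/
def firstMap (s : ℝ) : ℝ × E d → ℝ × E d := timeMap s⁻¹ 0

/-- The map of `[s,1]` onto `[0,1]`. -/
def secondMap (s : ℝ) : ℝ × E d → ℝ × E d := timeMap (1 - s)⁻¹ (-(s * (1 - s)⁻¹))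

/-- The function that equals `g` up to time `s` and `h` afterwards. -/
def concat {F : Type*} (s : ℝ) (g h : ℝ × E d → F) (z : ℝ × E d) : F :=
  if z.1 ≤ s then g z else h z

theorem measurable_concat {F : Type*} [MeasurableSpace F] {g h : ℝ × E d → F} (hg : Measurable g)
    (hh : Measurable h) : Measurable (concat s g h) :=
  Measurable.ite (measurable_fst measurableSet_Iic) hg hh

theorem firstMap_preimage_cylinder (hs : s ∈ Ioo (0 : ℝ) 1) :
    firstMap s ⁻¹' cylinder Ω = Icc 0 s ×ˢ Ω := by
  ext z
  simp only [firstMap, timeMap, cylinder, mem_preimage, mem_prod, mem_Icc, add_zero]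
  rw [inv_mul_le_iff₀ hs.1, mul_one, inv_mul_eq_div, le_div_iff₀ hs.1, zero_mul]

theorem secondMap_fst (hs : s ∈ Ioo (0 : ℝ) 1) (z : ℝ × E d) :
    (secondMap s z).1 = (z.1 - s) / (1 - s) := by
  have : 1 - s ≠ 0 := by linarith [hs.2]
  simp only [secondMap, timeMap]
  field_simp
  ring

theorem secondMap_preimage_cylinder (hs : s ∈ Ioo (0 : ℝ) 1) :
    secondMap s ⁻¹' cylinder Ω = Icc s 1 ×ˢ Ω := by
  have h1 : 0 < 1 - s := by linarith [hs.2]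
  ext z
  simp only [cylinder, mem_preimage, mem_prod, mem_Icc, secondMap_fst hs]
  rw [le_div_iff₀ h1, zero_mul, div_le_one h1]
  constructor
  · rintro ⟨⟨a, b⟩, c⟩; exact ⟨⟨by linarith, by linarith⟩, c⟩
  · rintro ⟨⟨a, b⟩, c⟩; exact ⟨⟨by linarith, by linarith⟩, c⟩

theorem Ioc_prod_ae_eq : (Ioc s 1 ×ˢ Ω : Set (ℝ × E d)) =ᵐ[volume] Icc s 1 ×ˢ Ω :=
  Measure.set_prod_ae_eq Ioc_ae_eq_Icc (ae_eq_refl Ω)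

/-- The slice t = s lies in both pieces, but it is null. -/
theorem restrict_cylinder_eq_add (hΩ : IsCompact Ω) (hs : s ∈ Ioo (0 : ℝ) 1) :
    (volume : Measure (ℝ × E d)).restrict (cylinder Ω) =
      volume.restrict (firstMap s ⁻¹' cylinder Ω) +
        volume.restrict (secondMap s ⁻¹' cylinder Ω) := by
  rw [firstMap_preimage_cylinder hs, secondMap_preimage_cylinder hs,
    ← Measure.restrict_congr_set Ioc_prod_ae_eq,
    ← Measure.restrict_union _ (measurableSet_Ioc.prod hΩ.measurableSet), ← union_prod,
    Icc_union_Ioc_eq_Icc hs.1.le hs.2.le]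
  · rfl
  · rw [disjoint_left]
    rintro z ⟨h1, -⟩ ⟨h2, -⟩
    exact absurd h1.2 (not_le.2 h2.1)

theorem concat_ae_eq_left {F : Type*} (hΩ : IsCompact Ω) (hs : s ∈ Ioo (0 : ℝ) 1)
    (g h : ℝ × E d → F) :
    concat s g h =ᵐ[volume.restrict (firstMap s ⁻¹' cylinder Ω)] g := by
  rw [firstMap_preimage_cylinder hs]
  filter_upwards [ae_restrict_mem (measurableSet_Icc.prod hΩ.measurableSet)] with z hz
  exact if_pos hz.1.2

theorem concat_ae_eq_right {F : Type*} (hΩ : IsCompact Ω) (hs : s ∈ Ioo (0 : ℝ) 1)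
    (g h : ℝ × E d → F) :
    concat s g h =ᵐ[volume.restrict (secondMap s ⁻¹' cylinder Ω)] h := by
  rw [secondMap_preimage_cylinder hs, ← Measure.restrict_congr_set Ioc_prod_ae_eq]
  filter_upwards [ae_restrict_mem (measurableSet_Ioc.prod hΩ.measurableSet)] with z hz
  exact if_neg (not_le.2 hz.1.1)

theorem integrableOn_concat {F : Type*} [NormedAddCommGroup F] (hΩ : IsCompact Ω)
    (hs : s ∈ Ioo (0 : ℝ) 1) {g h : ℝ × E d → F}
    (hg : IntegrableOn g (firstMap s ⁻¹' cylinder Ω))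
    (hh : IntegrableOn h (secondMap s ⁻¹' cylinder Ω)) :
    IntegrableOn (concat s g h) (cylinder Ω) := by
  unfold IntegrableOn
  rw [restrict_cylinder_eq_add hΩ hs]
  exact (hg.congr (concat_ae_eq_left hΩ hs g h).symm).add_measure
    (hh.congr (concat_ae_eq_right hΩ hs g h).symm)

theorem integral_concat (hΩ : IsCompact Ω) (hs : s ∈ Ioo (0 : ℝ) 1) {g h : ℝ × E d → ℝ}
    (hg : IntegrableOn g (firstMap s ⁻¹' cylinder Ω))
    (hh : IntegrableOn h (secondMap s ⁻¹' cylinder Ω)) :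
    ∫ z in cylinder Ω, concat s g h z =
      (∫ z in firstMap s ⁻¹' cylinder Ω, g z) + ∫ z in secondMap s ⁻¹' cylinder Ω, h z := by
  rw [restrict_cylinder_eq_add hΩ hs, integral_add_measure
    (hg.congr (concat_ae_eq_left hΩ hs g h).symm) (hh.congr (concat_ae_eq_right hΩ hs g h).symm),
    integral_congr_ae (concat_ae_eq_left hΩ hs g h),
    integral_congr_ae (concat_ae_eq_right hΩ hs g h)]

theorem lintegral_concat (hΩ : IsCompact Ω) (hs : s ∈ Ioo (0 : ℝ) 1) (g h : ℝ × E d → ℝ≥0∞) :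
    ∫⁻ z in cylinder Ω, concat s g h z =
      (∫⁻ z in firstMap s ⁻¹' cylinder Ω, g z) + ∫⁻ z in secondMap s ⁻¹' cylinder Ω, h z := by
  rw [restrict_cylinder_eq_add hΩ hs, lintegral_add_measure,
    lintegral_congr_ae (concat_ae_eq_left hΩ hs g h),
    lintegral_congr_ae (concat_ae_eq_right hΩ hs g h)]

variable {μ₁ f₁ μ₂ f₂ : ℝ × E d → ℝ} {v₁ v₂ : ℝ × E d → E d}

/-- The density of the curve that runs through `μ₁` on `[0,s]` and through `μ₂` on `[s,1]`. -/
def concatDensity (s : ℝ) (μ₁ μ₂ : ℝ × E d → ℝ) : ℝ × E d → ℝ :=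
  concat s (fun z => μ₁ (firstMap s z)) fun z => μ₂ (secondMap s z)

/-- The velocity of a concatenated curve. -/
def concatVelocity (s : ℝ) (v₁ v₂ : ℝ × E d → E d) : ℝ × E d → E d :=
  concat s (fun z => s⁻¹ • v₁ (firstMap s z)) fun z => (1 - s)⁻¹ • v₂ (secondMap s z)

/-- The source of a concatenated curve. -/
def concatSource (s : ℝ) (f₁ f₂ : ℝ × E d → ℝ) : ℝ × E d → ℝ :=
  concat s (fun z => s⁻¹ * f₁ (firstMap s z)) fun z => (1 - s)⁻¹ * f₂ (secondMap s z)

theorem concatDensity_of_le {t : ℝ} (ht : t ≤ s) (x : E d) :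
    concatDensity s μ₁ μ₂ (t, x) = μ₁ (t / s, x) := by
  simp only [concatDensity, concat, if_pos ht, firstMap, timeMap, add_zero, inv_mul_eq_div]

theorem concatDensity_of_lt (hs : s ∈ Ioo (0 : ℝ) 1) {t : ℝ} (ht : s < t) (x : E d) :
    concatDensity s μ₁ μ₂ (t, x) = μ₂ ((t - s) / (1 - s), x) := by
  simp only [concatDensity, concat, if_neg (not_le.2 ht)]
  congr 1
  exact Prod.ext (secondMap_fst hs _) rfl

theorem measurable_firstMap : Measurable (firstMap s : ℝ × E d → ℝ × E d) :=
  continuous_timeMap.measurable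

theorem measurable_secondMap : Measurable (secondMap s : ℝ × E d → ℝ × E d) :=
  continuous_timeMap.measurable

/-- The two rescaled weak equations are added; their end terms at time s cancel because the curves
match there almost everywhere. The density may jump pointwise at s, but its pairings with test
functions do not. -/
theorem IsCurve.concat (h₁ : IsCurve Ω μ₁ v₁ f₁) (h₂ : IsCurve Ω μ₂ v₂ f₂) (hΩ : IsCompact Ω)
    (hs : s ∈ Ioo (0 : ℝ) 1) (hj : ∀ᵐ x ∂(volume.restrict Ω), μ₁ (1, x) = μ₂ (0, x)) :
    IsCurve Ω (concatDensity s μ₁ μ₂) (concatVelocity s v₁ v₂) (concatSource s f₁ f₂) := by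
  have hs' : 0 < 1 - s := by linarith [hs.2]
  have hc₁ : s⁻¹ ≠ 0 := (inv_pos.2 hs.1).ne'
  have hc₂ : (1 - s)⁻¹ ≠ 0 := (inv_pos.2 hs').ne'
  have hd₁ : ∀ t ∈ Icc 0 s, t / s ∈ Icc (0 : ℝ) 1 := fun t ht =>
    ⟨div_nonneg ht.1 hs.1.le, (div_le_one hs.1).2 ht.2⟩
  have hd₂ : ∀ t ∈ Icc s 1, (t - s) / (1 - s) ∈ Icc (0 : ℝ) 1 := fun t ht =>
    ⟨div_nonneg (by linarith [ht.1]) hs'.le, (div_le_one hs').2 (by linarith [ht.2])⟩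
  have iμ₁ := integrableOn_comp_timeMap (b := 0) hc₁ h₁.continuityEq.integrable_density
  have iμ₂ := integrableOn_comp_timeMap (b := -(s * (1 - s)⁻¹)) hc₂
    h₂.continuityEq.integrable_density
  have im₁ : IntegrableOn (fun z => μ₁ (firstMap s z) • s⁻¹ • v₁ (firstMap s z))
      (firstMap s ⁻¹' cylinder Ω) :=
    ((integrableOn_comp_timeMap (b := 0) hc₁ h₁.continuityEq.integrable_flux).smul s⁻¹).congr
      (.of_forall fun z => smul_comm s⁻¹ (μ₁ (firstMap s z)) (v₁ (firstMap s z)))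
  have im₂ : IntegrableOn (fun z => μ₂ (secondMap s z) • (1 - s)⁻¹ • v₂ (secondMap s z))
      (secondMap s ⁻¹' cylinder Ω) :=
    ((integrableOn_comp_timeMap (b := -(s * (1 - s)⁻¹)) hc₂
      h₂.continuityEq.integrable_flux).smul (1 - s)⁻¹).congr
      (.of_forall fun z => smul_comm (1 - s)⁻¹ (μ₂ (secondMap s z)) (v₂ (secondMap s z)))
  have if₁ := (integrableOn_comp_timeMap (b := 0) hc₁
    h₁.continuityEq.integrable_source).const_mul s⁻¹
  have if₂ := (integrableOn_comp_timeMap (b := -(s * (1 - s)⁻¹)) hc₂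
    h₂.continuityEq.integrable_source).const_mul (1 - s)⁻¹
  have hflux : (fun z => concatDensity s μ₁ μ₂ z • concatVelocity s v₁ v₂ z) =
      UnnormalizedOT.concat s (fun z => μ₁ (firstMap s z) • s⁻¹ • v₁ (firstMap s z))
        fun z => μ₂ (secondMap s z) • (1 - s)⁻¹ • v₂ (secondMap s z) := by
    funext z
    simp only [concatDensity, concatVelocity, UnnormalizedOT.concat]
    split_ifs <;> rfl
  have hslice : ∀ t ∈ Icc (0 : ℝ) 1, IntegrableOn (fun x => concatDensity s μ₁ μ₂ (t, x)) Ω := by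
    intro t ht
    rcases le_or_gt t s with hts | hts
    · simp only [concatDensity_of_le hts]
      exact h₁.integrable_slice _ (hd₁ t ⟨ht.1, hts⟩)
    · simp only [concatDensity_of_lt hs hts]
      exact h₂.integrable_slice _ (hd₂ t ⟨hts.le, ht.2⟩)
  -- At t = s the concatenation takes its value from μ₁; under the integral it may be replaced by
  -- the initial value of μ₂.
  have hpair : ∀ φ : E d → ℝ, ∀ t, s ≤ t → ∫ x in Ω, φ x * concatDensity s μ₁ μ₂ (t, x) =
      ∫ x in Ω, φ x * μ₂ ((t - s) / (1 - s), x) := by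
    intro φ t ht
    rcases ht.eq_or_lt with rfl | ht
    · simp only [concatDensity_of_le le_rfl, div_self hs.1.ne', sub_self, zero_div]
      exact integral_congr_ae (hj.mono fun x hx => by simp only [hx])
    · simp only [concatDensity_of_lt hs ht]
  refine ⟨?_, fun z => ?_, ?_, ?_, hslice, fun φ hφ => ?_, ?_, hslice 0 (by simp),
    hslice 1 (by simp), ?_, ?_, fun φ hφ => ?_⟩
  · exact measurable_concat (h₁.measurable_density.comp measurable_firstMap)
      (h₂.measurable_density.comp measurable_secondMap)
  · unfold concatDensity UnnormalizedOT.concat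
    split_ifs
    exacts [h₁.nonneg _, h₂.nonneg _]
  · exact measurable_concat ((h₁.measurable_velocity.comp measurable_firstMap).const_smul s⁻¹)
      ((h₂.measurable_velocity.comp measurable_secondMap).const_smul (1 - s)⁻¹)
  · exact measurable_concat ((h₁.measurable_source.comp measurable_firstMap).const_mul s⁻¹)
      ((h₂.measurable_source.comp measurable_secondMap).const_mul (1 - s)⁻¹)
  · rw [← Icc_union_Icc_eq_Icc hs.1.le hs.2.le]
    refine ContinuousOn.union_of_isClosed ?_ ?_ isClosed_Icc isClosed_Icc
    · refine ((h₁.narrow φ hφ).comp (by fun_prop : ContinuousOn (fun t => t / s) (Icc 0 s))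
        hd₁).congr fun t ht => ?_
      simp only [concatDensity_of_le ht.2, Function.comp_apply]
    · refine ((h₂.narrow φ hφ).comp
        (by fun_prop : ContinuousOn (fun t => (t - s) / (1 - s)) (Icc s 1)) hd₂).congr
        fun t ht => ?_
      rw [hpair φ t ht.1]
      rfl
  · exact integrableOn_concat hΩ hs iμ₁ iμ₂
  · rw [hflux]
    exact integrableOn_concat hΩ hs im₁ im₂
  · exact integrableOn_concat hΩ hs if₁ if₂
  · have e₁ := h₁.continuityEq.integral_timeMap (b := 0) hc₁ hφ
    have e₂ := h₂.continuityEq.integral_timeMap (b := -(s * (1 - s)⁻¹)) hc₂ hφ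
    have hsplit : ∀ z, weakIntegrand (concatDensity s μ₁ μ₂)
        (fun z => concatDensity s μ₁ μ₂ z • concatVelocity s v₁ v₂ z) (concatSource s f₁ f₂) φ z =
        UnnormalizedOT.concat s (weakIntegrand (fun z => μ₁ (firstMap s z))
          (fun z => μ₁ (firstMap s z) • s⁻¹ • v₁ (firstMap s z))
          (fun z => s⁻¹ * f₁ (firstMap s z)) φ)
          (weakIntegrand (fun z => μ₂ (secondMap s z))
          (fun z => μ₂ (secondMap s z) • (1 - s)⁻¹ • v₂ (secondMap s z))
          (fun z => (1 - s)⁻¹ * f₂ (secondMap s z)) φ) z := fun z => by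
      simp only [weakIntegrand, concatDensity, concatVelocity, concatSource, UnnormalizedOT.concat]
      split_ifs <;> rfl
    have hW : ∀ {S : Set (ℝ × E d)} {μ f : ℝ × E d → ℝ} {m : ℝ × E d → E d}, IsCompact S →
        IntegrableOn μ S → IntegrableOn m S → IntegrableOn f S →
        IntegrableOn (weakIntegrand μ m f φ) S := by
      intro S μ f m hS hμ hm hf
      refine ((hμ.continuousOn_mul (continuous_timeDeriv hφ).continuousOn hS).add ?_).add
        (hf.continuousOn_mul hφ.continuous.continuousOn hS)
      obtain ⟨C, hC⟩ := hS.exists_bound_of_continuousOn (continuous_spaceGrad hφ).continuousOn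
      refine Integrable.mono' (hm.norm.const_mul C)
        ((continuous_spaceGrad hφ).aestronglyMeasurable.inner hm.aestronglyMeasurable) ?_
      filter_upwards [ae_restrict_mem hS.measurableSet] with z hz
      exact (norm_inner_le_norm _ _).trans (by gcongr; exact hC z hz)
    have hK₁ : IsCompact (firstMap s ⁻¹' cylinder Ω) := by
      rw [firstMap_preimage_cylinder hs]; exact isCompact_Icc.prod hΩ
    have hK₂ : IsCompact (secondMap s ⁻¹' cylinder Ω) := by
      rw [secondMap_preimage_cylinder hs]; exact isCompact_Icc.prod hΩ
    change _ = ∫ z in cylinder Ω, weakIntegrand (concatDensity s μ₁ μ₂)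
        (fun z => concatDensity s μ₁ μ₂ z • concatVelocity s v₁ v₂ z) (concatSource s f₁ f₂) φ z
    simp only [hsplit]
    refine Eq.trans ?_ ((integral_concat hΩ hs (hW hK₁ iμ₁ im₁ if₁) (hW hK₂ iμ₂ im₂ if₂)).trans
      (congrArg₂ (· + ·) e₁ e₂)).symm
    -- The inverse time changes send 0 and 1 to 0 and s on the first piece, and to s and 1 on the
    -- second. The factors c |c⁻¹| are 1 because c > 0.
    have a1 : s⁻¹⁻¹ * 1 + -(s⁻¹⁻¹ * 0) = s := by simp
    have a0 : s⁻¹⁻¹ * 0 + -(s⁻¹⁻¹ * 0) = 0 := by simp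
    have b1 : (1 - s)⁻¹⁻¹ * 1 + -((1 - s)⁻¹⁻¹ * -(s * (1 - s)⁻¹)) = 1 := by
      field_simp; ring
    have b0 : (1 - s)⁻¹⁻¹ * 0 + -((1 - s)⁻¹⁻¹ * -(s * (1 - s)⁻¹)) = s := by
      field_simp; ring
    have c1 : s⁻¹ * |s⁻¹⁻¹| = 1 := by
      rw [inv_inv, abs_of_pos hs.1, inv_mul_cancel₀ hs.1.ne']
    have c2 : (1 - s)⁻¹ * |(1 - s)⁻¹⁻¹| = 1 := by
      rw [inv_inv, abs_of_pos hs', inv_mul_cancel₀ hs'.ne']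
    rw [a1, a0, b1, b0, c1, c2, one_mul, one_mul]
    have d1 : ∫ x in Ω, φ (s, x) * μ₁ (1, x) = ∫ x in Ω, φ (s, x) * μ₂ (0, x) :=
      integral_congr_ae (hj.mono fun x hx => by simp only [hx])
    have d2 : ∀ x, concatDensity s μ₁ μ₂ (0, x) = μ₁ (0, x) := fun x => by
      rw [concatDensity_of_le hs.1.le, zero_div]
    have d3 : ∀ x, concatDensity s μ₁ μ₂ (1, x) = μ₂ (1, x) := fun x => by
      rw [concatDensity_of_lt hs hs.2, div_self hs'.ne']
    simp only [d2, d3]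
    rw [d1]
    ring

theorem action_concat (hΩ : IsCompact Ω) (hs : s ∈ Ioo (0 : ℝ) 1) (α : ℝ) :
    action α Ω (concatVelocity s v₁ v₂) (concatDensity s μ₁ μ₂) (concatSource s f₁ f₂) =
      ENNReal.ofReal s⁻¹ * action α Ω v₁ μ₁ f₁ +
        ENNReal.ofReal (1 - s)⁻¹ * action α Ω v₂ μ₂ f₂ := by
  have hs' : 0 < 1 - s := by linarith [hs.2]
  have hc₁ : 0 < s⁻¹ := inv_pos.2 hs.1
  have hc₂ : 0 < (1 - s)⁻¹ := inv_pos.2 hs'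
  have e1 : ∀ z, ENNReal.ofReal (‖concatVelocity s v₁ v₂ z‖ ^ 2 * concatDensity s μ₁ μ₂ z) =
      concat s (fun z => ENNReal.ofReal (‖s⁻¹ • v₁ (firstMap s z)‖ ^ 2 * μ₁ (firstMap s z)))
        (fun z => ENNReal.ofReal (‖(1 - s)⁻¹ • v₂ (secondMap s z)‖ ^ 2 * μ₂ (secondMap s z))) z :=
    fun z => by
      simp only [concatVelocity, concatDensity, concat]
      split_ifs <;> rfl
  have e2 : ∀ z, ENNReal.ofReal (|concatSource s f₁ f₂ z| ^ 2) =
      concat s (fun z => ENNReal.ofReal (|s⁻¹ * f₁ (firstMap s z)| ^ 2))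
        (fun z => ENNReal.ofReal (|(1 - s)⁻¹ * f₂ (secondMap s z)| ^ 2)) z := fun z => by
    simp only [concatSource, concat]
    split_ifs <;> rfl
  unfold action
  simp only [e1, e2]
  rw [lintegral_concat hΩ hs, lintegral_concat hΩ hs]
  unfold firstMap secondMap
  rw [lintegral_kinetic_timeMap hc₁.ne', lintegral_kinetic_timeMap hc₂.ne',
    lintegral_source_timeMap hc₁.ne', lintegral_source_timeMap hc₂.ne', abs_of_pos hc₁,
    abs_of_pos hc₂]
  ring

end Concatenation

/-! ### Interpolation and finiteness -/

section Interpolation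

variable {d : ℕ} {Ω : Set (E d)} {X : ℝ → ℝ}

/-- A function that increases from `0` to `1` on `[0,1]`, at a speed proportional to
`(t (1 - t)) ^ n`. -/
theorem exists_ramp (n : ℕ) : ∃ (X : ℝ → ℝ) (c : ℝ),
    (∀ t, HasDerivAt X (c * (t * (1 - t)) ^ n) t) ∧ X 0 = 0 ∧ X 1 = 1 ∧
      ∀ t ∈ Icc (0 : ℝ) 1, X t ∈ Icc (0 : ℝ) 1 := by
  set w : ℝ → ℝ := fun s => (s * (1 - s)) ^ n with hw
  have hwc : Continuous w := by fun_prop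
  have hi : ∀ a b, IntervalIntegrable w volume a b := fun a b => hwc.intervalIntegrable a b
  have hw0 : ∀ s ∈ Icc (0 : ℝ) 1, 0 ≤ w s := fun s hs =>
    pow_nonneg (mul_nonneg hs.1 (by linarith [hs.2])) n
  have hI : 0 < ∫ s in (0 : ℝ)..1, w s :=
    intervalIntegral.intervalIntegral_pos_of_pos_on (hi 0 1)
      (fun s hs => pow_pos (mul_pos hs.1 (by linarith [hs.2])) n) one_pos
  refine ⟨fun t => (∫ s in (0 : ℝ)..1, w s)⁻¹ * ∫ s in (0 : ℝ)..t, w s,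
    (∫ s in (0 : ℝ)..1, w s)⁻¹, fun t => ?_, by simp, inv_mul_cancel₀ hI.ne', fun t ht => ?_⟩
  · exact (hwc.integral_hasStrictDerivAt 0 t).hasDerivAt.const_mul _
  · have h1 : 0 ≤ ∫ s in (0 : ℝ)..t, w s :=
      intervalIntegral.integral_nonneg ht.1 fun s hs => hw0 s ⟨hs.1, hs.2.trans ht.2⟩
    have h2 : 0 ≤ ∫ s in t..1, w s :=
      intervalIntegral.integral_nonneg ht.2 fun s hs => hw0 s ⟨ht.1.trans hs.1, hs.2⟩
    have h3 := intervalIntegral.integral_add_adjacent_intervals (hi 0 t) (hi t 1)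
    refine ⟨mul_nonneg (inv_nonneg.2 hI.le) h1, ?_⟩
    rw [inv_mul_le_iff₀ hI, mul_one]
    linarith

/-- The density `(1 - X) ρ₀ + X ρ₁`. -/
def interpDensity (X : ℝ → ℝ) (ρ₀ ρ₁ : Density Ω) (z : ℝ × E d) : ℝ :=
  |1 - X z.1| * |ρ₀.1 z.2| + |X z.1| * |ρ₁.1 z.2|

/-- The source of the curve `(1 - X) ρ₀ + X ρ₁`, where `Y` is the derivative of `X`. -/
def interpSource (Y : ℝ → ℝ) (ρ₀ ρ₁ : Density Ω) (z : ℝ × E d) : ℝ :=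
  Y z.1 * (|ρ₁.1 z.2| - |ρ₀.1 z.2|)

theorem integrableOn_time_mul (hΩ : IsCompact Ω) {a : ℝ → ℝ} (ha : Continuous a) {r : E d → ℝ}
    (hr : IntegrableOn r Ω) : IntegrableOn (fun z : ℝ × E d => a z.1 * r z.2) (cylinder Ω) := by
  have := isFiniteMeasure_restrict_space hΩ
  refine integrableOn_mul_of_continuous hΩ (ha.comp continuous_fst) ?_
  unfold IntegrableOn
  rw [restrict_cylinder]
  exact Integrable.comp_snd hr _

theorem Density.integrableOn_abs (ρ : Density Ω) : IntegrableOn (fun x => |ρ.1 x|) Ω :=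
  (Density.integrableOn ρ).abs

/-- The velocity is zero, so for each x the weak equation is the fundamental theorem of calculus for
φ times the interpolated density. No spatial regularity of ρ₀ and ρ₁ is involved. -/
theorem isCurve_interp (hΩ : IsCompact Ω) {Y : ℝ → ℝ} (hX : ∀ t, HasDerivAt X (Y t) t)
    (hY : Continuous Y) (hX0 : X 0 = 0) (hX1 : X 1 = 1)
    (hXI : ∀ t ∈ Icc (0 : ℝ) 1, X t ∈ Icc (0 : ℝ) 1) (ρ₀ ρ₁ : Density Ω) :
    IsCurve Ω (interpDensity X ρ₀ ρ₁) 0 (interpSource Y ρ₀ ρ₁) := by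
  have hXc : Continuous X := continuous_iff_continuousAt.2 fun t => (hX t).continuousAt
  have m0 : Measurable fun z : ℝ × E d => |ρ₀.1 z.2| :=
    ((measurable_density_coe ρ₀).comp measurable_snd).abs
  have m1 : Measurable fun z : ℝ × E d => |ρ₁.1 z.2| :=
    ((measurable_density_coe ρ₁).comp measurable_snd).abs
  have j0 := Density.integrableOn_abs ρ₀
  have j1 := Density.integrableOn_abs ρ₁
  have hslice : ∀ t, IntegrableOn (fun x => interpDensity X ρ₀ ρ₁ (t, x)) Ω := fun t =>
    (j0.const_mul |1 - X t|).add (j1.const_mul |X t|)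
  have hμ : IntegrableOn (interpDensity X ρ₀ ρ₁) (cylinder Ω) :=
    (integrableOn_time_mul hΩ (by fun_prop : Continuous fun t => |1 - X t|) j0).add
      (integrableOn_time_mul hΩ (by fun_prop : Continuous fun t => |X t|) j1)
  have hf : IntegrableOn (interpSource Y ρ₀ ρ₁) (cylinder Ω) :=
    integrableOn_time_mul hΩ hY (j1.sub j0)
  have hm : IntegrableOn (fun z => interpDensity X ρ₀ ρ₁ z • (0 : ℝ × E d → E d) z)
      (cylinder Ω) := by
    simp only [Pi.zero_apply, smul_zero]
    exact integrableOn_zero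
  have e0 : ∀ x, interpDensity X ρ₀ ρ₁ (0, x) = |ρ₀.1 x| := fun x => by
    simp [interpDensity, hX0]
  have e1 : ∀ x, interpDensity X ρ₀ ρ₁ (1, x) = |ρ₁.1 x| := fun x => by
    simp [interpDensity, hX1]
  refine ⟨?_, fun z => ?_, measurable_const, ?_, fun t _ => hslice t, fun φ hφ => ?_, hμ,
    hslice 0, hslice 1, hm, hf, fun φ hφ => ?_⟩
  · exact ((by fun_prop : Continuous fun z : ℝ × E d => |1 - X z.1|).measurable.mul m0).add
      ((by fun_prop : Continuous fun z : ℝ × E d => |X z.1|).measurable.mul m1)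
  · unfold interpDensity; positivity
  · exact (hY.measurable.comp measurable_fst).mul (m1.sub m0)
  · have i0 := integrableOn_mul_slice hΩ j0 hφ.continuous
    have i1 := integrableOn_mul_slice hΩ j1 hφ.continuous
    have : ∀ t, ∫ x in Ω, φ x * interpDensity X ρ₀ ρ₁ (t, x) =
        |1 - X t| * (∫ x in Ω, φ x * |ρ₀.1 x|) + |X t| * ∫ x in Ω, φ x * |ρ₁.1 x| := fun t => by
      rw [← integral_const_mul, ← integral_const_mul, ← integral_add (i0.const_mul _)
        (i1.const_mul _)]
      congr 1
      ext x
      simp only [interpDensity]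
      ring
    simp only [this]
    fun_prop
  · have hW := integrableOn_weakIntegrand hΩ hμ hm hf hφ
    refine Eq.trans ?_ (integral_cylinder_symm hΩ hW).symm
    have key : ∀ x, ∫ t in (0 : ℝ)..1, weakIntegrand (interpDensity X ρ₀ ρ₁)
        (fun z => interpDensity X ρ₀ ρ₁ z • (0 : ℝ × E d → E d) z) (interpSource Y ρ₀ ρ₁) φ (t, x) =
        φ (1, x) * |ρ₁.1 x| - φ (0, x) * |ρ₀.1 x| := by
      intro x
      set F : ℝ → ℝ := fun t => φ (t, x) * ((1 - X t) * |ρ₀.1 x| + X t * |ρ₁.1 x|) with hF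
      have hd : ∀ t, HasDerivAt F (timeDeriv φ (t, x) * ((1 - X t) * |ρ₀.1 x| + X t * |ρ₁.1 x|) +
          φ (t, x) * (-Y t * |ρ₀.1 x| + Y t * |ρ₁.1 x|)) t := fun t => by
        have h1 := hasDerivAt_time (hφ.differentiable one_ne_zero (t, x)).hasFDerivAt
        rw [← timeDeriv_eq hφ] at h1
        exact h1.mul ((((hX t).const_sub 1).mul_const _).add ((hX t).mul_const _))
      have hc : Continuous fun t => timeDeriv φ (t, x) * ((1 - X t) * |ρ₀.1 x| + X t * |ρ₁.1 x|) +
          φ (t, x) * (-Y t * |ρ₀.1 x| + Y t * |ρ₁.1 x|) := by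
        have c1 : Continuous fun t : ℝ => timeDeriv φ (t, x) :=
          (continuous_timeDeriv hφ).comp (by fun_prop)
        have c2 : Continuous fun t : ℝ => φ (t, x) := hφ.continuous.comp (by fun_prop)
        fun_prop
      have hFTC := intervalIntegral.integral_eq_sub_of_hasDerivAt (fun t _ => hd t)
        (hc.intervalIntegrable 0 1)
      have hF1 : F 1 = φ (1, x) * |ρ₁.1 x| := by simp [hF, hX1]
      have hF0 : F 0 = φ (0, x) * |ρ₀.1 x| := by simp [hF, hX0]
      rw [hF1, hF0] at hFTC
      rw [← hFTC]
      refine intervalIntegral.integral_congr fun t ht => ?_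
      rw [uIcc_of_le zero_le_one] at ht
      have hXt := hXI t ht
      simp only [weakIntegrand, interpDensity, interpSource, Pi.zero_apply, smul_zero,
        inner_zero_right, abs_of_nonneg hXt.1, abs_of_nonneg (sub_nonneg.2 hXt.2)]
      ring
    simp only [key, e0, e1]
    exact (integral_sub
      (integrableOn_mul_slice hΩ j1 (hφ.continuous.comp (by fun_prop : Continuous fun x : E d => ((1 : ℝ), x))))
      (integrableOn_mul_slice hΩ j0
        (hφ.continuous.comp (by fun_prop : Continuous fun x : E d => ((0 : ℝ), x))))).symm

theorem interpDensity_zero (hX0 : X 0 = 0) (ρ₀ ρ₁ : Density Ω) :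
    ∀ᵐ x ∂(volume.restrict Ω), interpDensity X ρ₀ ρ₁ (0, x) = ρ₀.1 x := by
  filter_upwards [Density.abs_ae_eq ρ₀] with x hx
  simp [interpDensity, hX0, hx]

theorem interpDensity_one (hX1 : X 1 = 1) (ρ₀ ρ₁ : Density Ω) :
    ∀ᵐ x ∂(volume.restrict Ω), interpDensity X ρ₀ ρ₁ (1, x) = ρ₁.1 x := by
  filter_upwards [Density.abs_ae_eq ρ₁] with x hx
  simp [interpDensity, hX1, hx]

/-- The constant curve has zero action, but ρ need not be continuous; only the relaxation makes it
an allowed competitor. The choice of ramp is immaterial, as the source is a multiple of |ρ| - |ρ|.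
-/
theorem UW2sq_self (hΩ : IsCompact Ω) (hconv : Convex ℝ Ω) (hint : (interior Ω).Nonempty) (α : ℝ)
    (ρ : Density Ω) : UW2sq α Ω ρ ρ = 0 := by
  obtain ⟨X, c, hX, hX0, hX1, hXI⟩ := exists_ramp 0
  have hc := isCurve_interp hΩ hX (by fun_prop) hX0 hX1 hXI ρ ρ
  have h := hc.UW2sq_le hΩ hconv hint α (interpDensity_zero hX0 ρ ρ) (interpDensity_one hX1 ρ ρ)
  refine le_antisymm (h.trans (le_of_eq ?_)) zero_le
  simp [action, interpSource]

theorem IsBump.exists_le {η : E d → ℝ} (h : IsBump Ω η) (hΩ : IsCompact Ω) :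
    ∃ B, 0 ≤ B ∧ ∀ y, |η y| ≤ B := by
  obtain ⟨B, hB⟩ := hΩ.exists_bound_of_continuousOn h.contDiff.continuous.continuousOn
  refine ⟨max B 0, le_max_right _ _, fun y => ?_⟩
  by_cases hy : y ∈ Ω
  · exact (hB y hy).trans (le_max_left _ _)
  · rw [h.eq_zero y hy, abs_zero]
    exact le_max_right _ _

/-- The source of the interpolation need not be square integrable, so its own action may be
infinite. Its regularization with L = 1 has a bounded source, and its velocity comes from the drift
alone. -/
theorem UW2sq_ne_top (hΩ : IsCompact Ω) (hconv : Convex ℝ Ω) (hint : (interior Ω).Nonempty)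
    (α : ℝ) (ρ₀ ρ₁ : Density Ω) : UW2sq α Ω ρ₀ ρ₁ ≠ ⊤ := by
  have := isFiniteMeasure_restrict_cylinder hΩ
  -- The speed of the ramp, proportional to (t (1 - t))^d, compensates the factor (t (1 - t))^(-d)
  -- of the kernel for L = 1.
  obtain ⟨X, c, hX, hX0, hX1, hXI⟩ := exists_ramp d
  obtain ⟨η, h⟩ := exists_isBump hint
  obtain ⟨B, hB0, hB⟩ := h.exists_le hΩ
  obtain ⟨D, -, hD⟩ := exists_norm_sub_le hΩ
  have hc := isCurve_interp hΩ hX (by fun_prop) hX0 hX1 hXI ρ₀ ρ₁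
  have hadm := hc.admissible_smooth h hΩ hconv one_pos le_rfl (interpDensity_zero hX0 ρ₀ ρ₁)
    (interpDensity_one hX1 ρ₀ ρ₁)
  refine ne_top_of_le_ne_top ?_ (UW2sq_le_of_admissible hadm)
  refine ENNReal.add_ne_top.2 ⟨ne_top_of_le_ne_top ?_ (lintegral_kinetic_smooth_le hc h hΩ hconv
    one_pos le_rfl hD), ENNReal.mul_ne_top ENNReal.ofReal_ne_top ?_⟩
  · simp only [Pi.zero_apply, norm_zero, ne_eq, OfNat.ofNat_ne_zero, not_false_eq_true, zero_pow,
      zero_mul, ENNReal.ofReal_zero, lintegral_zero, mul_zero, zero_add]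
    exact ENNReal.mul_ne_top ENNReal.ofReal_ne_top hc.lintegral_density_ne_top
  · set M := ∫ x in Ω, B * |c| * (|ρ₁.1 x| + |ρ₀.1 x|)
    have hbound : ∀ᵐ z ∂(volume.restrict (cylinder Ω)),
        ENNReal.ofReal (|smoothed Ω η 1
          (atStart (interpSource (fun t => c * (t * (1 - t)) ^ d) ρ₀ ρ₁)) z| ^ 2) ≤
          ENNReal.ofReal (M ^ 2) := by
      filter_upwards [ae_mem_Ioo_prod hΩ] with z hz
      refine ENNReal.ofReal_le_ofReal (pow_le_pow_left₀ (abs_nonneg _) ?_ 2)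
      rw [← Real.norm_eq_abs]
      unfold smoothed
      have hε : 0 < z.1 * (1 - z.1) := mul_pos hz.1.1 (by linarith [hz.1.2])
      refine norm_integral_le_of_norm_le (g := fun x => B * |c| * (|ρ₁.1 x| + |ρ₀.1 x|))
        (((Density.integrableOn_abs ρ₁).add (Density.integrableOn_abs ρ₀)).const_mul _)
        (.of_forall fun x => ?_)
      have e : noiseKernel (d := d) η 1 z.1 z.2 x • atStart
          (interpSource (fun t => c * (t * (1 - t)) ^ d) ρ₀ ρ₁) (z, x) =
          η ((noiseScale 1 z.1)⁻¹ • (z.2 - (1 - noiseScale 1 z.1) • x)) * c *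
            (|ρ₁.1 x| - |ρ₀.1 x|) := by
        have : (z.1 * (1 - z.1))⁻¹ ^ d * (z.1 * (1 - z.1)) ^ d = 1 := by
          rw [← mul_pow, inv_mul_cancel₀ hε.ne', one_pow]
        simp only [noiseKernel, atStart, interpSource, smul_eq_mul, noiseScale, one_mul]
        linear_combination η ((z.1 * (1 - z.1))⁻¹ • (z.2 - (1 - z.1 * (1 - z.1)) • x)) * c *
          (|ρ₁.1 x| - |ρ₀.1 x|) * this
      rw [e, norm_mul, norm_mul]
      have h1 := hB ((noiseScale 1 z.1)⁻¹ • (z.2 - (1 - noiseScale 1 z.1) • x))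
      have h2 : ‖|ρ₁.1 x| - |ρ₀.1 x|‖ ≤ |ρ₁.1 x| + |ρ₀.1 x| := by
        refine (norm_sub_le _ _).trans (le_of_eq ?_)
        simp
      exact mul_le_mul (mul_le_mul_of_nonneg_right h1 (abs_nonneg c)) h2 (norm_nonneg _)
        (by positivity)
    refine ne_top_of_le_ne_top ?_ (lintegral_mono_ae hbound)
    rw [lintegral_const]
    exact ENNReal.mul_ne_top ENNReal.ofReal_ne_top (measure_ne_top _ _)

end Interpolation

/-! ### The metric -/

section Metric

variable {d : ℕ} {Ω : Set (E d)} {α : ℝ}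

theorem UW2sq_comm (ρ₀ ρ₁ : Density Ω) : UW2sq α Ω ρ₀ ρ₁ = UW2sq α Ω ρ₁ ρ₀ :=
  le_antisymm (UW2sq_le_reverse α ρ₁ ρ₀) (UW2sq_le_reverse α ρ₀ ρ₁)

theorem exists_admissible_lt {ρ₀ ρ₁ : Density Ω} {r : ℝ≥0∞} (h : UW2sq α Ω ρ₀ ρ₁ < r) :
    ∃ v μ f, Admissible Ω ρ₀ ρ₁ v μ f ∧ action α Ω v μ f < r := by
  simp only [UW2sq, iInf_lt_iff] at h
  obtain ⟨v, μ, f, h1, h2⟩ := h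
  exact ⟨v, μ, f, h1, h2⟩

theorem UW2_sq (ρ₀ ρ₁ : Density Ω) : UW2 α Ω ρ₀ ρ₁ ^ 2 = UW2sq α Ω ρ₀ ρ₁ := by
  rw [UW2, ← ENNReal.rpow_natCast, ← ENNReal.rpow_mul]
  norm_num

/-- Near-optimal curves are replaced by Borel versions, concatenated, and returned to the infimum by
the relaxation. -/
theorem UW2sq_lt_add (hΩ : IsCompact Ω) (hconv : Convex ℝ Ω) (hint : (interior Ω).Nonempty)
    {ρ₀ ρ₁ ρ₂ : Density Ω} {a b : ℝ} (ha : 0 < a) (hb : 0 < b)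
    (h1 : UW2sq α Ω ρ₀ ρ₁ < ENNReal.ofReal (a ^ 2))
    (h2 : UW2sq α Ω ρ₁ ρ₂ < ENNReal.ofReal (b ^ 2)) :
    UW2sq α Ω ρ₀ ρ₂ ≤ ENNReal.ofReal ((a + b) ^ 2) := by
  obtain ⟨v₁, μ₁, f₁, adm₁, act₁⟩ := exists_admissible_lt h1
  obtain ⟨v₂, μ₂, f₂, adm₂, act₂⟩ := exists_admissible_lt h2
  obtain ⟨ν₁, c₁, i₁, t₁, e₁⟩ := adm₁.exists_isCurve hΩ
  obtain ⟨ν₂, c₂, i₂, t₂, e₂⟩ := adm₂.exists_isCurve hΩ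
  have hab : 0 < a + b := by positivity
  -- The share of time that minimizes a²/s + b²/(1 - s); the minimum is (a + b)².
  have hs : a / (a + b) ∈ Ioo (0 : ℝ) 1 := ⟨by positivity, (div_lt_one hab).2 (by linarith)⟩
  have hs1 : 1 - a / (a + b) = b / (a + b) := by field_simp; ring
  have hj : ∀ᵐ x ∂(volume.restrict Ω), ν₁ (1, x) = ν₂ (0, x) := by
    filter_upwards [t₁, i₂] with x h h' using h.trans h'.symm
  have hc := c₁.concat c₂ hΩ hs hj
  refine (hc.UW2sq_le hΩ hconv hint α (i₁.mono fun x hx => ?_) (t₂.mono fun x hx => ?_)).trans ?_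
  · rw [concatDensity_of_le hs.1.le, zero_div, hx]
  · rw [concatDensity_of_lt hs hs.2, div_self (by linarith [hs.2]), hx]
  · rw [action_concat hΩ hs, e₁, e₂, hs1]
    calc _ ≤ ENNReal.ofReal (a / (a + b))⁻¹ * ENNReal.ofReal (a ^ 2) +
          ENNReal.ofReal (b / (a + b))⁻¹ * ENNReal.ofReal (b ^ 2) := by
          gcongr
      _ = ENNReal.ofReal ((a + b) ^ 2) := by
          rw [← ENNReal.ofReal_mul (by positivity), ← ENNReal.ofReal_mul (by positivity),
            ← ENNReal.ofReal_add (by positivity) (by positivity)]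
          congr 1
          field_simp

theorem UW2_ne_top (hΩ : IsCompact Ω) (hconv : Convex ℝ Ω) (hint : (interior Ω).Nonempty)
    (ρ₀ ρ₁ : Density Ω) : UW2 α Ω ρ₀ ρ₁ ≠ ⊤ :=
  ENNReal.rpow_ne_top_of_nonneg (by norm_num) (UW2sq_ne_top hΩ hconv hint α ρ₀ ρ₁)

theorem UW2_triangle (hΩ : IsCompact Ω) (hconv : Convex ℝ Ω) (hint : (interior Ω).Nonempty)
    (ρ₀ ρ₁ ρ₂ : Density Ω) :
    UW2 α Ω ρ₀ ρ₂ ≤ UW2 α Ω ρ₀ ρ₁ + UW2 α Ω ρ₁ ρ₂ := by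
  have fin := fun ρ ρ' => UW2_ne_top (α := α) hΩ hconv hint ρ ρ'
  refine ENNReal.le_of_forall_pos_le_add fun ε hε _ => ?_
  have hlt : ∀ ρ ρ' : Density Ω, UW2sq α Ω ρ ρ' <
      ENNReal.ofReal (((UW2 α Ω ρ ρ').toReal + ε / 2) ^ 2) := fun ρ ρ' => by
    rw [← UW2_sq, ENNReal.ofReal_pow (by positivity)]
    refine (ENNReal.pow_lt_pow_left_iff two_ne_zero).2 ?_
    refine (ENNReal.lt_ofReal_iff_toReal_lt (fin ρ ρ')).2 ?_
    have : (0 : ℝ) < ε := hε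
    linarith
  have hpos : ∀ ρ ρ' : Density Ω, 0 < (UW2 α Ω ρ ρ').toReal + ε / 2 := fun ρ ρ' => by
    have : (0 : ℝ) < ε := hε
    have := ENNReal.toReal_nonneg (a := UW2 α Ω ρ ρ')
    linarith
  have h := UW2sq_lt_add hΩ hconv hint (hpos ρ₀ ρ₁) (hpos ρ₁ ρ₂) (hlt ρ₀ ρ₁) (hlt ρ₁ ρ₂)
  rw [← UW2_sq, ENNReal.ofReal_pow (add_pos (hpos _ _) (hpos _ _)).le,
    ENNReal.pow_le_pow_left_iff two_ne_zero] at h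
  refine h.trans (le_of_eq ?_)
  rw [show (UW2 α Ω ρ₀ ρ₁).toReal + ε / 2 + ((UW2 α Ω ρ₁ ρ₂).toReal + ε / 2) =
    (UW2 α Ω ρ₀ ρ₁).toReal + (UW2 α Ω ρ₁ ρ₂).toReal + ε by ring,
    ENNReal.ofReal_add (by positivity) (by positivity),
    ENNReal.ofReal_add ENNReal.toReal_nonneg ENNReal.toReal_nonneg, ENNReal.ofReal_toReal (fin _ _),
    ENNReal.ofReal_toReal (fin _ _), ENNReal.ofReal_coe_nnreal]

/-! ### Separation of points -/

theorem Admissible.integral_kinetic_le {ρ₀ ρ₁ : Density Ω} {v : ℝ × E d → E d}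
    {μ f : ℝ × E d → ℝ} (hΩ : IsCompact Ω) (h : Admissible Ω ρ₀ ρ₁ v μ f)
    {a : ℝ} (ha : 0 ≤ a) (hact : action α Ω v μ f ≤ ENNReal.ofReal a) :
    ∫ z in cylinder Ω, ‖v z‖ ^ 2 * μ z ≤ a := by
  rw [integral_eq_lintegral_of_nonneg_ae
    ((h.nonneg_ae hΩ).mono fun z hz => mul_nonneg (sq_nonneg _) hz)
    h.aestronglyMeasurable_velocity_sq_mul]
  refine ENNReal.toReal_le_of_le_ofReal ha (le_trans ?_ hact)
  exact le_self_add

theorem Admissible.integral_source_le {ρ₀ ρ₁ : Density Ω} {v : ℝ × E d → E d}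
    {μ f : ℝ × E d → ℝ} (hα : 0 < α) (h : Admissible Ω ρ₀ ρ₁ v μ f)
    {a : ℝ} (ha : 0 ≤ a) (hact : action α Ω v μ f ≤ ENNReal.ofReal a) :
    ∫ z in cylinder Ω, f z ^ 2 ≤ α * a := by
  have h1 : ENNReal.ofReal (1 / α) * (∫⁻ z in cylinder Ω, ENNReal.ofReal (|f z| ^ 2)) ≤
      ENNReal.ofReal a := le_trans le_add_self hact
  simp_rw [sq_abs] at h1
  rw [integral_eq_lintegral_of_nonneg_ae (.of_forall fun z => sq_nonneg _)
    (h.measurable_source.pow_const 2).aestronglyMeasurable]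
  refine ENNReal.toReal_le_of_le_ofReal (by positivity) ?_
  rw [ENNReal.ofReal_mul hα.le]
  calc _ = ENNReal.ofReal α * (ENNReal.ofReal (1 / α) *
        ∫⁻ z in cylinder Ω, ENNReal.ofReal (f z ^ 2)) := by
        rw [← mul_assoc, ← ENNReal.ofReal_mul hα.le, mul_one_div_cancel hα.ne',
          ENNReal.ofReal_one, one_mul]
    _ ≤ _ := by gcongr

/-- The mass of a curve is controlled by its source. -/
theorem Admissible.integral_density_le {ρ₀ ρ₁ : Density Ω} {v : ℝ × E d → E d}
    {μ f : ℝ × E d → ℝ} (hΩ : IsCompact Ω) (h : Admissible Ω ρ₀ ρ₁ v μ f)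
    (hf : IntegrableOn (fun z => f z ^ 2) (cylinder Ω)) :
    ∫ z in cylinder Ω, μ z ≤ (∫ x in Ω, ρ₀.1 x) + (∫ z in cylinder Ω, f z ^ 2) +
      (volume.restrict (cylinder Ω)).real univ := by
  have := isFiniteMeasure_restrict_cylinder hΩ
  -- The time derivative -1 of this test function produces minus the total mass, its zero at t = 1
  -- removes the terminal value, and its gradient is 0, so the velocity does not enter.
  have hφ : ContDiff ℝ 1 fun z : ℝ × E d => 1 - z.1 := by fun_prop
  have e := h.continuityEq.weak_eq _ hφ
  have h1 : ∀ z : ℝ × E d, timeDeriv (fun z => 1 - z.1) z = -1 := fun z => by simp [timeDeriv]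
  have h2 : ∀ z : ℝ × E d, spaceGrad (fun z => 1 - z.1) z = 0 := fun z => by
    simp [spaceGrad, gradient_fun_const]
  have i1 : IntegrableOn (fun z => (1 - z.1) * f z) (cylinder Ω) :=
    integrableOn_mul_of_continuous hΩ hφ.continuous h.continuityEq.integrable_source
  have i0 := h.continuityEq.integrable_density
  have e0 : ∫ x in Ω, μ (0, x) = ∫ x in Ω, ρ₀.1 x := integral_congr_ae h.initial
  simp only [h1, h2, inner_zero_left, add_zero, sub_self, zero_mul, integral_zero, sub_zero,
    one_mul, zero_sub, neg_mul, e0] at e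
  rw [integral_add i0.fun_neg i1, integral_neg] at e
  have h3 : ∫ z in cylinder Ω, (1 - z.1) * f z ≤ ∫ z in cylinder Ω, (f z ^ 2 + 1) := by
    refine integral_mono_ae i1 (hf.add (integrable_const 1)) ?_
    filter_upwards [ae_restrict_mem (measurableSet_cylinder hΩ)] with z hz
    have := hz.1.1
    have := hz.1.2
    nlinarith [sq_nonneg (f z - (1 - z.1)), sq_nonneg (f z)]
  rw [integral_add hf (integrable_const 1), integral_const, smul_eq_mul, mul_one] at h3
  linarith

/-- Curves of small action move the pairing with a test function only a little. -/
theorem Admissible.abs_integral_sub_le {ρ₀ ρ₁ : Density Ω} {v : ℝ × E d → E d}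
    {μ f : ℝ × E d → ℝ} (hΩ : IsCompact Ω) (hα : 0 < α) (h : Admissible Ω ρ₀ ρ₁ v μ f)
    {φ : E d → ℝ} (hφ : ContDiff ℝ 1 φ) {C δ : ℝ} (hC : 0 ≤ C) (hδ : 0 < δ) (hδ1 : δ ≤ 1)
    (hφC : ∀ x ∈ Ω, |φ x| ≤ C) (hgC : ∀ x ∈ Ω, ‖gradient φ x‖ ≤ C)
    (hact : action α Ω v μ f ≤ ENNReal.ofReal (δ ^ 2)) :
    |(∫ x in Ω, φ x * ρ₁.1 x) - ∫ x in Ω, φ x * ρ₀.1 x| ≤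
      C * δ * (1 + 2 * α + (∫ x in Ω, ρ₀.1 x) +
        2 * (volume.restrict (cylinder Ω)).real univ) := by
  have := isFiniteMeasure_restrict_cylinder hΩ
  have hfin : action α Ω v μ f ≠ ⊤ := ne_top_of_le_ne_top ENNReal.ofReal_ne_top hact
  have iK := h.integrableOn_kinetic hΩ hfin
  have iS := h.integrableOn_source_sq hα hfin
  have iM := h.continuityEq.integrable_density
  have hK := h.integral_kinetic_le hΩ (sq_nonneg δ) hact
  have hS := h.integral_source_le hα (sq_nonneg δ) hact
  have hM := h.integral_density_le hΩ iS
  have e := h.continuityEq.weak_eq (fun z => φ z.2) (hφ.comp contDiff_snd)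
  have a0 : ∫ x in Ω, φ x * μ (0, x) = ∫ x in Ω, φ x * ρ₀.1 x :=
    integral_congr_ae (h.initial.mono fun x hx => by simp only [hx])
  have a1 : ∫ x in Ω, φ x * μ (1, x) = ∫ x in Ω, φ x * ρ₁.1 x :=
    integral_congr_ae (h.terminal.mono fun x hx => by simp only [hx])
  have t1 : ∀ z, timeDeriv (fun z : ℝ × E d => φ z.2) z = 0 := fun z => by simp [timeDeriv]
  have t2 : ∀ z, spaceGrad (fun z : ℝ × E d => φ z.2) z = gradient φ z.2 := fun z => rfl
  simp only [a0, a1, t1, t2, zero_mul, zero_add] at e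
  set M := ∫ z in cylinder Ω, μ z
  set S := ∫ z in cylinder Ω, f z ^ 2
  set K := ∫ z in cylinder Ω, ‖v z‖ ^ 2 * μ z
  set V := (volume.restrict (cylinder Ω)).real univ
  have hV : 0 ≤ V := measureReal_nonneg
  have hbound : ‖∫ z in cylinder Ω, (inner ℝ (gradient φ z.2) (μ z • v z) + φ z.2 * f z)‖ ≤
      ∫ z in cylinder Ω, C * (δ⁻¹ * (‖v z‖ ^ 2 * μ z) + δ * μ z + (δ⁻¹ * f z ^ 2 + δ)) := by
    refine norm_integral_le_of_norm_le ((((iK.const_mul _).add (iM.const_mul _)).add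
      ((iS.const_mul _).add (integrable_const δ))).const_mul C) ?_
    filter_upwards [ae_restrict_mem (measurableSet_cylinder hΩ), h.nonneg_ae hΩ] with z hz hμ
    have n1 : ‖(inner ℝ (gradient φ z.2) (μ z • v z) : ℝ)‖ ≤ C * (μ z * ‖v z‖) := by
      refine (norm_inner_le_norm _ _).trans ?_
      rw [norm_smul, Real.norm_of_nonneg hμ]
      exact mul_le_mul_of_nonneg_right (hgC _ hz.2) (by positivity)
    have n2 : ‖φ z.2 * f z‖ ≤ C * |f z| := by
      rw [norm_mul]
      exact mul_le_mul_of_nonneg_right (hφC _ hz.2) (norm_nonneg _)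
    -- Young's inequality with weight δ: energies of order δ², multiplied by 1/δ, are again of order
    -- δ.
    have young : ∀ y : ℝ, y ≤ δ⁻¹ * y ^ 2 + δ := fun y => by
      have : 0 ≤ δ⁻¹ * (y - δ) ^ 2 + δ⁻¹ * y ^ 2 := by positivity
      have e1 : δ⁻¹ * (y - δ) ^ 2 = δ⁻¹ * y ^ 2 - 2 * y + δ := by field_simp; ring
      nlinarith [mul_pos hδ hδ]
    have y1 := mul_le_mul_of_nonneg_left (young ‖v z‖) hμ
    have y2 := young |f z|
    rw [sq_abs] at y2
    calc _ ≤ C * (μ z * ‖v z‖) + C * |f z| := (norm_add_le _ _).trans (add_le_add n1 n2)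
      _ = C * (μ z * ‖v z‖ + |f z|) := by ring
      _ ≤ _ := mul_le_mul_of_nonneg_left (by linarith) hC
  have hI : ∫ z in cylinder Ω, C * (δ⁻¹ * (‖v z‖ ^ 2 * μ z) + δ * μ z + (δ⁻¹ * f z ^ 2 + δ)) =
      C * (δ⁻¹ * K + δ * M + (δ⁻¹ * S + δ * V)) := by
    have j1 : IntegrableOn (fun z => δ⁻¹ * (‖v z‖ ^ 2 * μ z) + δ * μ z) (cylinder Ω) :=
      (iK.const_mul _).add (iM.const_mul _)
    have j2 : IntegrableOn (fun z => δ⁻¹ * f z ^ 2 + δ) (cylinder Ω) :=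
      (iS.const_mul _).add (integrable_const δ)
    rw [integral_const_mul, integral_add j1 j2, integral_add (iK.const_mul _) (iM.const_mul _),
      integral_add (iS.const_mul _) (integrable_const δ), integral_const_mul, integral_const_mul,
      integral_const_mul, integral_const, smul_eq_mul, mul_comm _ δ]
  rw [hI, ← e, Real.norm_eq_abs] at hbound
  refine hbound.trans ?_
  rw [mul_assoc]
  refine mul_le_mul_of_nonneg_left ?_ hC
  have k1 : δ⁻¹ * K ≤ δ := by
    rw [inv_mul_le_iff₀ hδ]; nlinarith
  have k2 : δ⁻¹ * S ≤ δ * α := by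
    rw [inv_mul_le_iff₀ hδ]; nlinarith
  -- Here δ ≤ 1 is used to make the bound on the mass independent of δ.
  have k3 : S ≤ α := hS.trans (by nlinarith [mul_nonneg hδ.le (sub_nonneg.2 hδ1)])
  have k4 : δ * M ≤ δ * ((∫ x in Ω, ρ₀.1 x) + α + V) :=
    mul_le_mul_of_nonneg_left (by linarith) hδ.le
  nlinarith

theorem integral_eq_of_UW2sq_eq_zero (hΩ : IsCompact Ω) (hα : 0 < α) {ρ₀ ρ₁ : Density Ω}
    (h : UW2sq α Ω ρ₀ ρ₁ = 0) {φ : E d → ℝ} (hφ : ContDiff ℝ 1 φ) :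
    ∫ x in Ω, φ x * ρ₁.1 x = ∫ x in Ω, φ x * ρ₀.1 x := by
  have hgrad : Continuous (gradient φ) :=
    (LinearIsometryEquiv.continuous _).comp (hφ.continuous_fderiv one_ne_zero)
  obtain ⟨C₁, hC₁⟩ := hΩ.exists_bound_of_continuousOn hφ.continuous.continuousOn
  obtain ⟨C₂, hC₂⟩ := hΩ.exists_bound_of_continuousOn hgrad.continuousOn
  set C := max (max C₁ C₂) 0
  set R := 1 + 2 * α + (∫ x in Ω, ρ₀.1 x) + 2 * (volume.restrict (cylinder Ω)).real univ
  have hbound : ∀ᶠ δ : ℝ in nhdsWithin 0 (Ioi 0),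
      |(∫ x in Ω, φ x * ρ₁.1 x) - ∫ x in Ω, φ x * ρ₀.1 x| ≤ C * δ * R := by
    filter_upwards [Ioo_mem_nhdsGT one_pos] with δ hδ
    have hlt : UW2sq α Ω ρ₀ ρ₁ < ENNReal.ofReal (δ ^ 2) := by
      rw [h]; exact ENNReal.ofReal_pos.2 (pow_pos hδ.1 2)
    obtain ⟨v, μ, f, hadm, hact⟩ := exists_admissible_lt hlt
    exact hadm.abs_integral_sub_le hΩ hα hφ (le_max_right _ _) hδ.1 hδ.2.le
      (fun x hx => (hC₁ x hx).trans ((le_max_left _ _).trans (le_max_left _ _)))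
      (fun x hx => (hC₂ x hx).trans ((le_max_right _ _).trans (le_max_left _ _))) hact.le
  have hlim : Filter.Tendsto (fun δ : ℝ => C * δ * R) (nhdsWithin 0 (Ioi 0)) (nhds 0) := by
    have : Continuous fun δ : ℝ => C * δ * R := by fun_prop
    have h0 := (this.tendsto 0).mono_left (nhdsWithin_le_nhds (s := Ioi 0))
    simpa using h0
  exact sub_eq_zero.1 (abs_nonpos_iff.1 (ge_of_tendsto hlim hbound))

theorem eq_of_UW2sq_eq_zero (hΩ : IsCompact Ω) (hα : 0 < α) {ρ₀ ρ₁ : Density Ω}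
    (h : UW2sq α Ω ρ₀ ρ₁ = 0) : ρ₀ = ρ₁ := by
  have i0 := Density.integrableOn ρ₀
  have i1 := Density.integrableOn ρ₁
  have hae : ∀ᵐ x ∂(volume.restrict Ω), ρ₀.1 x - ρ₁.1 x = 0 := by
    refine ae_eq_zero_of_integral_contDiff_smul_eq_zero
      (Integrable.locallyIntegrable (i0.sub i1)) fun g hg _ => ?_
    have hg1 : ContDiff ℝ 1 g := hg.of_le (by exact_mod_cast le_top)
    simp only [smul_eq_mul, mul_sub]
    rw [integral_sub (integrableOn_mul_slice hΩ i0 hg.continuous)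
      (integrableOn_mul_slice hΩ i1 hg.continuous), integral_eq_of_UW2sq_eq_zero hΩ hα h hg1,
      sub_self]
  exact Subtype.ext (Lp.ext (hae.mono fun x hx => sub_eq_zero.1 hx))

theorem UW2_eq_zero_iff (hΩ : IsCompact Ω) (hconv : Convex ℝ Ω) (hint : (interior Ω).Nonempty)
    (hα : 0 < α) (ρ₀ ρ₁ : Density Ω) : UW2 α Ω ρ₀ ρ₁ = 0 ↔ ρ₀ = ρ₁ := by
  have h0 : UW2 α Ω ρ₀ ρ₁ = 0 ↔ UW2sq α Ω ρ₀ ρ₁ = 0 :=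
    ENNReal.rpow_eq_zero_iff_of_pos (by norm_num)
  rw [h0]
  constructor
  · exact eq_of_UW2sq_eq_zero hΩ hα
  · rintro rfl
    exact UW2sq_self hΩ hconv hint α _

end Metric

end

end UnnormalizedOT


/-! ### The main theorem -/

theorem mainTheorem4 (d : ℕ) (Ω : Set (UnnormalizedOT.E d)) (hΩc : IsCompact Ω)
    (hΩconv : Convex ℝ Ω) (hΩint : (interior Ω).Nonempty) (α : ℝ) (hα : 0 < α) :
    -- `UW₂` is finite and is a metric on the densities
    ((∀ ρ₀ ρ₁ : UnnormalizedOT.Density Ω, UnnormalizedOT.UW2 α Ω ρ₀ ρ₁ ≠ ⊤) ∧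
      (∀ ρ₀ ρ₁ : UnnormalizedOT.Density Ω, UnnormalizedOT.UW2 α Ω ρ₀ ρ₁ = 0 ↔ ρ₀ = ρ₁) ∧
      (∀ ρ₀ ρ₁ : UnnormalizedOT.Density Ω,
        UnnormalizedOT.UW2 α Ω ρ₀ ρ₁ = UnnormalizedOT.UW2 α Ω ρ₁ ρ₀) ∧
      (∀ ρ₀ ρ₁ ρ₂ : UnnormalizedOT.Density Ω,
        UnnormalizedOT.UW2 α Ω ρ₀ ρ₂ ≤
          UnnormalizedOT.UW2 α Ω ρ₀ ρ₁ + UnnormalizedOT.UW2 α Ω ρ₁ ρ₂)) ∧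
    -- the optimality conditions for minimizers, with `G` the weak gradient of `Φ`
    (∀ (ρ₀ ρ₁ : UnnormalizedOT.Density Ω) (v : ℝ × UnnormalizedOT.E d → UnnormalizedOT.E d)
      (μ f : ℝ × UnnormalizedOT.E d → ℝ),
      UnnormalizedOT.IsMinimizer α Ω ρ₀ ρ₁ v μ f →
      ∃ (Φ : ℝ × UnnormalizedOT.E d → ℝ) (G : ℝ × UnnormalizedOT.E d → UnnormalizedOT.E d),
        UnnormalizedOT.IsWeakSpaceGrad (UnnormalizedOT.openCylinder Ω) Φ G ∧
        (∀ᵐ z ∂(MeasureTheory.volume.restrict (UnnormalizedOT.cylinder Ω)),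
          0 < μ z → v z = G z) ∧
        (∀ᵐ z ∂(MeasureTheory.volume.restrict (UnnormalizedOT.cylinder Ω)), f z = α * Φ z) ∧
        UnnormalizedOT.SolvesContinuityEq Ω μ G (fun z => α * Φ z) ∧
        UnnormalizedOT.HamiltonJacobiLe (UnnormalizedOT.openCylinder Ω) Φ G ∧
        UnnormalizedOT.HamiltonJacobiEq
          (UnnormalizedOT.openCylinder Ω ∩ {z | 0 < μ z}) Φ G) := by
  refine ⟨⟨UnnormalizedOT.UW2_ne_top hΩc hΩconv hΩint,
    UnnormalizedOT.UW2_eq_zero_iff hΩc hΩconv hΩint hα, fun ρ₀ ρ₁ => ?_,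
    UnnormalizedOT.UW2_triangle hΩc hΩconv hΩint⟩, fun ρ₀ ρ₁ v μ f hmin => ?_⟩
  · rw [UnnormalizedOT.UW2, UnnormalizedOT.UW2sq_comm]
    rfl
  · refine hmin.optimality hΩc hΩconv hα ?_
    -- A minimizer has finite action because the distance is finite. The first variations need this.
    rw [hmin.2]
    exact UnnormalizedOT.UW2sq_ne_top hΩc hΩconv hΩint α ρ₀ ρ₁
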